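/- Let $\widehat f(\zeta)=\int_{\mathbb R^2}e^{-ix\cdot\zeta}f(x)\,dx$ and let $\Lambda_1,\Lambda_2,\Lambda_3$ be the Fourier multipliers on $\mathbb R^2$ with symbols $\sqrt{|\zeta|^2+1}$, $\sqrt{2|\zeta|^2+4}$, $\sqrt{4|\zeta|^2+16}$. Consider on $[0,\infty)\times\mathbb R^2$ the system for $\mathbf u=(u_1,\dots,u_6)$, with complex-valued components, $$ \begin{cases} (\partial_t+i\Lambda_1)u_1=0,\\ (\partial_t+i\Lambda_2)u_2=0,\\ (\partial_t+i\Lambda_3)u_3=0,\\ (\partial_t+i\Lambda_1)u_4=u_2\,\overline{u_1},\\ (\partial_t+i\Lambda_2)u_5=u_3\,\overline{u_2},\\ (\partial_t+i\Lambda_1)u_6=u_5\,\overline{u_4}. \end{cases} $$ A global solution with initial data $\mathbf u_0$ is a map $\mathbf u:[0,\infty)\to L^2(\mathbb R^2)^6$ with $\mathbf u(0)=\mathbf u_0$ such that at every $t\ge 0$ each component is differentiable in $L^2$ (one-sidedly at $t=0$) and lies in the domain of its operator $\Lambda$, each quadratic term lies in $L^2$, and the equations hold in $L^2$. Write $\|\mathbf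 u\|_{L^2}=\big(\sum_{j=1}^6\|u_j\|_{L^2}^2\big)^{1/2}$. Let $\varphi:\mathbb R\to[0,1]$ be any even smooth function supported in $[-1.2,1.2]$ and equal to $1$ on $[-1.1,1.1]$, and for $l\in\mathbb Z$ let $P_l$ be the Fourier multiplier with symbol $\varphi(|\zeta|/2^{l})-\varphi(|\zeta|/2^{l-1})$. Then for every $\varepsilon>0$ there are initial data $\mathbf u_0$ whose six components are Schwartz functions, such that (i) $\widehat{P_l\mathbf u_0}\ne 0$ for every integer $l\le 0$, and $\widehat{\mathbf u_0}(\zeta)=0$ whenever $|\zeta|\ge 1.2$; (ii) $\|\mathbf u_0\|_{L^2}\le\varepsilon$; (iii) there is exactly one global solution $\mathbf u$ with initial data $\mathbf u_0$, and $\lim_{t\to\infty}\|\mathbf u(t)\|_{L^2}=+\infty$. -/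

import Mathlib

open MeasureTheory Filter
open scoped FourierTransform SchwartzMap ContDiff ComplexConjugate

noncomputable section

namespace KleinGordon

/-- The spatial domain `ℝ²`. -/
abbrev Plane : Type := EuclideanSpace ℝ (Fin 2)

/-- The space `L²(ℝ²; ℂ)`. -/
abbrev L2 : Type := Lp ℂ 2 (volume : Measure Plane)

/-- Mathlib's Fourier transform has the kernel `exp (-2πi ⟨x, ξ⟩)`. Its variable `ξ` corresponds
to the frequency `2πξ` for the kernel `exp (-i ⟨x, ζ⟩)`, for which `-Δ` has the symbol `|ζ|²`.
This is the length `|ζ|` of that frequency. -/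
def freq (ξ : Plane) : ℝ := 2 * Real.pi * ‖ξ‖

/-- The symbol `√(c² |ζ|² + b²)` of `√(b² - c² Δ)`, in terms of `c2 = c²` and `b2 = b²`. -/
def dispersion (c2 b2 : ℝ) (ξ : Plane) : ℝ := Real.sqrt (c2 * freq ξ ^ 2 + b2)

/-- The symbol of `Λ₁`, namely `√(|ζ|² + 1)`. -/
def symbol1 : Plane → ℝ := dispersion 1 1

/-- The symbol of `Λ₂`, namely `√(2|ζ|² + 4)`. -/
def symbol2 : Plane → ℝ := dispersion 2 4

/-- The symbol of `Λ₃`, namely `√(4|ζ|² + 16)`. -/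
def symbol3 : Plane → ℝ := dispersion 4 16

/-- `g = m(D) f` in `L²`: the function `f` is in the domain of the Fourier multiplier `m`,
and `g` is its image. -/
def IsMultiplierImage (m : Plane → ℝ) (f g : L2) : Prop :=
  (𝓕 g : L2) =ᵐ[volume] fun ξ => (m ξ : ℂ) * (𝓕 f : L2) ξ

/-- The symbols of the operators in the six equations (components are numbered from `0`). -/
def systemSymbol : Fin 6 → Plane → ℝ :=
  ![symbol1, symbol2, symbol3, symbol1, symbol2, symbol1]

/-- The right-hand sides `0, 0, 0, u₂ ū₁, u₃ ū₂, u₅ ū₄` of the six equations; the component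
`uⱼ` of the usual numbering is `v (j - 1)`. -/
def nonlinearity (v : Fin 6 → Plane → ℂ) : Fin 6 → Plane → ℂ :=
  ![fun _ => 0,
    fun _ => 0,
    fun _ => 0,
    fun x => v 1 x * conj (v 0 x),
    fun x => v 2 x * conj (v 1 x),
    fun x => v 4 x * conj (v 3 x)]

/-- `u` is a global (strong, `L²`-valued) solution on `[0, ∞)` of the Cauchy problem
`(∂ₜ + iΛ) uⱼ = Nⱼ(u)`, `u(0) = u₀`: at each time `t ≥ 0` each component is in the domain of its
operator `Λ`, its quadratic term is in `L²`, and `∂ₜ uⱼ = -iΛ uⱼ + Nⱼ(u)` in `L²`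
(with the one-sided derivative at `t = 0`). Values of `u` at negative times play no role. -/
structure IsGlobalSolution (u₀ : Fin 6 → L2) (u : ℝ → Fin 6 → L2) : Prop where
  initial : u 0 = u₀
  equation : ∀ t : ℝ, 0 ≤ t → ∀ j : Fin 6, ∃ w n : L2,
    IsMultiplierImage (systemSymbol j) (u t j) w ∧
    (n =ᵐ[volume] nonlinearity (fun k => u t k) j) ∧
    HasDerivWithinAt (fun s => u s j) (-(Complex.I • w) + n) (Set.Ici 0) t

/-- The `L²` norm of a vector of six functions. -/
def vecNorm (v : Fin 6 → L2) : ℝ := Real.sqrt (∑ j, ‖v j‖ ^ 2)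

/-- The six components of a Schwartz function with values in `ℂ⁶`, as elements of `L²`. -/
def toL2 (u₀ : Fin 6 → 𝓢(Plane, ℂ)) : Fin 6 → L2 := fun j => (u₀ j).toLp 2 volume

/-- The cutoff functions of Littlewood-Paley theory: even, smooth, with values in `[0, 1]`,
supported in `[-1.2, 1.2]` and equal to `1` on `[-1.1, 1.1]`. -/
structure IsCutoff (φ : ℝ → ℝ) : Prop where
  smooth : ContDiff ℝ ∞ φ
  even : ∀ x, φ (-x) = φ x
  range : ∀ x, φ x ∈ Set.Icc (0 : ℝ) 1
  support : tsupport φ ⊆ Set.Icc (-1.2) 1.2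
  eq_one : ∀ x ∈ Set.Icc (-1.1 : ℝ) 1.1, φ x = 1

/-- The symbol `φₗ(ζ) = φ(|ζ| / 2ˡ) - φ(|ζ| / 2ˡ⁻¹)`. -/
def pieceSymbol (φ : ℝ → ℝ) (l : ℤ) (ξ : Plane) : ℝ :=
  φ (freq ξ / 2 ^ l) - φ (freq ξ / 2 ^ (l - 1))

/-- The Littlewood-Paley projection `Pₗ`, the Fourier multiplier with symbol `φₗ`. -/
def piece (φ : ℝ → ℝ) (l : ℤ) (f : 𝓢(Plane, ℂ)) : 𝓢(Plane, ℂ) :=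
  SchwartzMap.fourierMultiplierCLM ℂ (fun ξ => (pieceSymbol φ l ξ : ℂ)) f

end KleinGordon

end

noncomputable section

namespace KleinGordon

/-! The masses `1, 2, 4` satisfy `2 = 1 + 1` and `4 = 2 + 2`, and the coefficients of `|ζ|²` make
the quadratic resonance degenerate as well. Written for the profiles `exp(itΛ) u`, the products `u₂
ū₁` and `u₅ ū₄` oscillate with the phase `phase kap`, and `u₃ ū₂` with `2 * phase (kap / 2)`. By
`phase_mul`, for small output frequency `ξ` and inner frequency `μ` this phase is approximately
`(k²/16)|μ|⁴ + k⟪ξ, μ⟫`; at `ξ = 0` it vanishes to fourth order in `μ`.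

First generation. The two terms balance for `|μ| ~ l = |ξ|^(1/3)`, where both have size `l⁴`. The
region `|μ| ~ l` has area `l²` and stays coherent for a time `l⁻⁴`, so the time integral of the
source has size `l⁻² = |ξ|^(-2/3)`. After scaling, and after a dyadic decomposition of `|μ| > l`,
this is a statement about families of phases depending smoothly on parameters in a compact set that
contains the limit `l = 0`. On these sets the phase and its gradient do not vanish together, and one
second derivative is positive where the corresponding first derivative vanishes. Hence the integrals
in `μ` decay like `τ^(-1/2)` (`norm_integral_cexp_le`), and their time integrals converge uniformly
(`IsPhaseFamily.exists_timeInt_bounds`). The profiles of `u₄` and `u₅` therefore approach `L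
|ξ|^(-2/3)` as `ξ → 0` and `s|ξ|^(4/3) → ∞` (`exists_profBounds`). The constant `L` is nonzero
because the mean in time of the scaled profile is an integral against a nonnegative Fejér kernel,
bounded below by the area of a sublevel set of the phase (`exists_integral_scaledProf_ge`,
`scaledProf_limit_ne_zero`).

Second generation. The source of `u₆` is the interaction of these two singular profiles. For output
frequencies `|ζ| ≤ t^(-4/5)` the pairing `⟪ζ, μ⟫` is negligible at the scale `|μ| ~ t^(-1/4)`
selected by the quartic term. Time `t`, area `t^(-1/2)` and singularity `|μ|^(-4/3) ~ t^(1/3)`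
multiply to `t^(5/6)`, with a nonzero constant (`tendsto_duhamel`,
`integral_limitIntegrand_ne_zero`). Replacing the profiles at time `s` by those at time `t` costs
only `O(t^(3/4))` (`exists_duhamel_sub_frozen_le`). The square root of the area of the disc of
radius `t^(-4/5)` has order `t^(-4/5)`, so the `L²` norm of `u₆` is at least a constant times
`t^(5/6 - 4/5) = t^(1/30)` (`tendsto_norm_lastProf`).

The system is triangular, so these formulas define a global solution, and uniqueness follows
component by component from conservation of the `L²` norm for the linear equation. All of this holds
for data of any size; smallness is obtained by multiplying the data by a constant. -/

/-! ### Integration by parts and a van der Corput estimate -/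

/-- Integration by parts along a line for an oscillating exponential. -/
lemma integral_cexp_mul_lineDeriv {q q' : Plane → ℝ} {B B' : Plane → ℂ} {v : Plane}
    (hq : Continuous q) (hq' : Continuous q') (hB : Continuous B) (hB' : Continuous B')
    (hcB : HasCompactSupport B) (hcB' : HasCompactSupport B')
    (hqd : ∀ b, HasLineDerivAt ℝ q (q' b) b v) (hBd : ∀ b, HasLineDerivAt ℝ B (B' b) b v)
    (τ : ℝ) :
    Complex.I * τ * ∫ b, Complex.exp (-Complex.I * τ * q b) * (q' b * B b)
      = ∫ b, Complex.exp (-Complex.I * τ * q b) * B' b := by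
  have hexp : Continuous fun b => Complex.exp (-Complex.I * τ * q b) := by fun_prop
  have key := integral_bilinear_hasLineDerivAt_right_eq_neg_left_of_integrable
    (μ := (volume : Measure Plane)) (B := ContinuousLinearMap.mul ℝ ℂ)
    (f := fun b => Complex.exp (-Complex.I * τ * q b))
    (f' := fun b => Complex.exp (-Complex.I * τ * q b) * (-Complex.I * τ * q' b))
    (g := B) (g' := B') (v := v) ?_ ?_ ?_ ?_ ?_
  · simp only [ContinuousLinearMap.mul_apply'] at key
    rw [key, ← integral_const_mul, ← integral_neg]
    congr 1; ext b; ring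
  · exact (Continuous.integrable_of_hasCompactSupport (by simp; fun_prop)
      hcB.mul_left)
  · exact (Continuous.integrable_of_hasCompactSupport (by simp; fun_prop)
      hcB'.mul_left)
  · exact (Continuous.integrable_of_hasCompactSupport (by simp; fun_prop)
      hcB.mul_left)
  · intro b _
    have h := hqd b
    unfold HasLineDerivAt at h ⊢
    have h1 := ((h.ofReal_comp).const_mul (-Complex.I * τ)).cexp
    simpa using h1
  · intro b _
    exact hBd b

/-- Integration by parts along a line for two real functions, one of compact support. -/
lemma integral_mul_lineDeriv {f f' g g' : Plane → ℝ} {v : Plane}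
    (hf : Continuous f) (hf' : Continuous f') (hg : Continuous g) (hg' : Continuous g')
    (hcg : HasCompactSupport g) (hcg' : HasCompactSupport g')
    (hfd : ∀ b, HasLineDerivAt ℝ f (f' b) b v) (hgd : ∀ b, HasLineDerivAt ℝ g (g' b) b v) :
    ∫ b, g b * f' b = - ∫ b, g' b * f b := by
  have key := integral_bilinear_hasLineDerivAt_right_eq_neg_left_of_integrable
    (μ := (volume : Measure Plane)) (B := ContinuousLinearMap.mul ℝ ℝ)
    (f := g) (f' := g') (g := f) (g' := f') (v := v) ?_ ?_ ?_ ?_ ?_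
  · simpa only [ContinuousLinearMap.mul_apply'] using key
  · exact (Continuous.integrable_of_hasCompactSupport (by simp; fun_prop)
      hcg'.mul_right)
  · exact (Continuous.integrable_of_hasCompactSupport (by simp; fun_prop)
      hcg.mul_right)
  · exact (Continuous.integrable_of_hasCompactSupport (by simp; fun_prop)
      hcg.mul_right)
  · exact fun b _ => hgd b
  · exact fun b _ => hfd b

/-- The integral of `β / (q₁² + κ²)` is `O(1/κ)` if `q₁` has a derivative which is bounded
below where `q₁` is small. -/
lemma integral_div_sq_add_sq_le {q1 q11 β β1 : Plane → ℝ} {v : Plane} {M c V κ : ℝ} {S : Set Plane}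
    (hq1 : Continuous q1) (hq11 : Continuous q11) (hβ : Continuous β) (hβ1 : Continuous β1)
    (hcβ : HasCompactSupport β) (hcβ1 : HasCompactSupport β1)
    (hq1d : ∀ b, HasLineDerivAt ℝ q1 (q11 b) b v) (hβd : ∀ b, HasLineDerivAt ℝ β (β1 b) b v)
    (hV : volume S ≤ ENNReal.ofReal V) (hV0 : 0 ≤ V)
    (hβS : ∀ b, b ∉ S → β b = 0) (hβ1S : ∀ b, b ∉ S → β1 b = 0)
    (hβ0 : ∀ b, 0 ≤ β b) (hβM : ∀ b, β b ≤ M) (hβ1M : ∀ b, |β1 b| ≤ M) (hc : 0 < c)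
    (hN : ∀ b, β b ≠ 0 → c ≤ q11 b + q1 b ^ 2) (hκ : 0 < κ) (hκ1 : κ ≤ 1) :
    ∫ b, β b / (q1 b ^ 2 + κ ^ 2) ≤ 3 * M * V / (c * κ) := by
  have hM : 0 ≤ M := (abs_nonneg _).trans (hβ1M 0)
  have hd : ∀ b, 0 < q1 b ^ 2 + κ ^ 2 := fun b => by positivity
  have hd' : ∀ b, q1 b ^ 2 + κ ^ 2 ≠ 0 := fun b => (hd b).ne'
  have hSfin : volume S < ⊤ := hV.trans_lt ENNReal.ofReal_lt_top
  have hSV : (volume S).toReal ≤ V := ENNReal.toReal_le_of_le_ofReal hV0 hV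
  have bound : ∀ (f : Plane → ℝ) (K : ℝ), (∀ b, b ∉ S → f b = 0) → (∀ b, |f b| ≤ K) →
      0 ≤ K → |∫ b, f b| ≤ K * V := by
    intro f K hfS hfK hK
    rw [← setIntegral_eq_integral_of_forall_compl_eq_zero (s := S) hfS]
    calc |∫ b in S, f b| ≤ K * volume.real S := by
          rw [← Real.norm_eq_abs]
          exact norm_setIntegral_le_of_norm_le_const hSfin (fun b _ => hfK b)
      _ ≤ K * V := by
          unfold Measure.real; gcongr
  -- The derivative of `arctan (q1 / κ) / κ` along `v` is `q11 / (q1² + κ²)`. This primitive is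
  -- `O(1/κ)` whatever the values of `q1`, so integrating by parts against `β` never requires
  -- locating the zeros of `q1`.
  have hat : Continuous fun b => Real.arctan (q1 b / κ) / κ := by
    have := Real.continuous_arctan
    fun_prop
  have hat' : Continuous fun b => q11 b / (q1 b ^ 2 + κ ^ 2) := by
    fun_prop (disch := exact hd')
  have hatd : ∀ b, HasLineDerivAt ℝ (fun b => Real.arctan (q1 b / κ) / κ)
      (q11 b / (q1 b ^ 2 + κ ^ 2)) b v := by
    intro b
    have h := hq1d b
    unfold HasLineDerivAt at h ⊢
    have h1 := ((h.div_const κ).arctan).div_const κ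
    refine h1.congr_deriv ?_
    simp only [zero_smul, add_zero]
    have := hd' b
    have h3 : 1 + (q1 b / κ) ^ 2 = (q1 b ^ 2 + κ ^ 2) / κ ^ 2 := by field_simp; ring
    rw [h3]
    field_simp
  have ibp := integral_mul_lineDeriv hat hat' hβ hβ1 hcβ hcβ1 hatd hβd
  have h1 : ∫ b, β b * (q11 b / (q1 b ^ 2 + κ ^ 2)) ≤ (M * (2 / κ)) * V := by
    rw [ibp]
    refine (neg_le_abs _).trans (bound _ _ (fun b hb => by simp [hβ1S b hb]) (fun b => ?_)
      (by positivity))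
    rw [abs_mul, abs_div, abs_of_pos hκ]
    gcongr
    · exact hβ1M b
    · have h2 := Real.arctan_lt_pi_div_two (q1 b / κ)
      have h3 := Real.neg_pi_div_two_lt_arctan (q1 b / κ)
      have := Real.pi_lt_four
      exact abs_le.2 ⟨by linarith, by linarith⟩
  have h2 : ∫ b, β b ≤ M * V :=
    (le_abs_self _).trans (bound _ _ hβS (fun b => by rw [abs_of_nonneg (hβ0 b)]; exact hβM b) hM)
  have i1 : Integrable fun b => β b * (q11 b / (q1 b ^ 2 + κ ^ 2)) :=
    Continuous.integrable_of_hasCompactSupport (by fun_prop) hcβ.mul_right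
  have i2 : Integrable β := hβ.integrable_of_hasCompactSupport hcβ
  have i3 : Integrable fun b => β b / (q1 b ^ 2 + κ ^ 2) := by
    have : Continuous fun b => (q1 b ^ 2 + κ ^ 2)⁻¹ := by fun_prop (disch := exact hd')
    simp only [div_eq_mul_inv]
    exact Continuous.integrable_of_hasCompactSupport (by fun_prop) hcβ.mul_right
  -- Where `β ≠ 0`, `c ≤ q11 + (q1² + κ²)`; dividing by `q1² + κ²` bounds the integrand by the one
  -- just estimated plus `β`.
  calc ∫ b, β b / (q1 b ^ 2 + κ ^ 2)
      ≤ ∫ b, c⁻¹ * (β b * (q11 b / (q1 b ^ 2 + κ ^ 2)) + β b) := by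
        refine integral_mono i3 ((i1.add i2).const_mul _) fun b => ?_
        by_cases hb : β b = 0
        · simp [hb]
        have hN := hN b hb
        have := hβ0 b
        simp only
        rw [inv_mul_eq_div, div_le_div_iff₀ (hd b) hc]
        have e : (β b * (q11 b / (q1 b ^ 2 + κ ^ 2)) + β b) * (q1 b ^ 2 + κ ^ 2)
          = β b * (q11 b + (q1 b ^ 2 + κ ^ 2)) := by
          field_simp [hd' b]
        rw [e]
        gcongr
        nlinarith [sq_nonneg κ]
    _ = c⁻¹ * ((∫ b, β b * (q11 b / (q1 b ^ 2 + κ ^ 2))) + ∫ b, β b) := by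
        rw [integral_const_mul, integral_add i1 i2]
    _ ≤ c⁻¹ * ((M * (2 / κ)) * V + M * V) := by gcongr
    _ ≤ c⁻¹ * ((M * (2 / κ)) * V + M * V * (1 / κ)) := by
        have : 1 ≤ 1 / κ := by rw [le_div_iff₀ hκ]; linarith
        have : M * V * 1 ≤ M * V * (1 / κ) := by gcongr
        rw [mul_one] at this
        gcongr
    _ = 3 * M * V / (c * κ) := by field_simp; ring

/-- The estimate of van der Corput type `∫ exp(-iτq) B = O(τ^{-1/2})`, with an explicit
constant. -/
lemma norm_integral_cexp_le {q q1 q11 β β1 : Plane → ℝ} {B B1 : Plane → ℂ} {v : Plane}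
    {M c V τ : ℝ} {S : Set Plane} (hq : Continuous q)
    (hq1 : Continuous q1) (hq11 : Continuous q11) (hβ : Continuous β) (hβ1 : Continuous β1)
    (hB : Continuous B) (hB1 : Continuous B1)
    (hcβ : HasCompactSupport β) (hcβ1 : HasCompactSupport β1)
    (hcB : HasCompactSupport B) (hcB1 : HasCompactSupport B1)
    (hqd : ∀ b, HasLineDerivAt ℝ q (q1 b) b v)
    (hq1d : ∀ b, HasLineDerivAt ℝ q1 (q11 b) b v) (hβd : ∀ b, HasLineDerivAt ℝ β (β1 b) b v)
    (hBd : ∀ b, HasLineDerivAt ℝ B (B1 b) b v)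
    (hS : MeasurableSet S) (hV : volume S ≤ ENNReal.ofReal V) (hV0 : 0 ≤ V)
    (hβS : ∀ b, b ∉ S → β b = 0) (hβ1S : ∀ b, b ∉ S → β1 b = 0) (hB1S : ∀ b, b ∉ S → B1 b = 0)
    (hβ0 : ∀ b, 0 ≤ β b) (hβM : ∀ b, β b ≤ M) (hβ1M : ∀ b, |β1 b| ≤ M)
    (hBM : ∀ b, ‖B b‖ ≤ M * β b) (hB1M : ∀ b, ‖B1 b‖ ≤ M) (hq11M : ∀ b, β b ≠ 0 → |q11 b| ≤ M)
    (hc : 0 < c) (hN : ∀ b, β b ≠ 0 → c ≤ q11 b + q1 b ^ 2) (hτ : 1 ≤ τ) :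
    ‖∫ b, Complex.exp (-Complex.I * τ * q b) * B b‖
      ≤ (M * V + 3 * M ^ 3 * V / c + 3 * M ^ 2 * V / c) * τ ^ (-(1 / 2) : ℝ) := by
  have hM : 0 ≤ M := (abs_nonneg _).trans (hβ1M 0)
  have hτ0 : 0 < τ := by linarith
  -- The width of the neighbourhood of `q1 = 0` that is not integrated by parts. With `κ² = 1/τ`,
  -- both contributions below are `O(κ)`.
  set κ : ℝ := τ ^ (-(1 / 2) : ℝ) with hκdef
  have hκ : 0 < κ := Real.rpow_pos_of_pos hτ0 _
  have hκ1 : κ ≤ 1 := Real.rpow_le_one_of_one_le_of_nonpos hτ (by norm_num)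
  have hκ2 : κ ^ 2 = τ⁻¹ := by
    rw [hκdef, ← Real.rpow_natCast, ← Real.rpow_mul hτ0.le]
    norm_num [Real.rpow_neg_one]
  have hJ := integral_div_sq_add_sq_le hq1 hq11 hβ hβ1 hcβ hcβ1 hq1d hβd hV hV0 hβS hβ1S hβ0
    hβM hβ1M hc hN hκ hκ1
  have hd : ∀ b, 0 < q1 b ^ 2 + κ ^ 2 := fun b => by positivity
  have hd' : ∀ b, q1 b ^ 2 + κ ^ 2 ≠ 0 := fun b => (hd b).ne'
  have hSfin : volume S < ⊤ := hV.trans_lt ENNReal.ofReal_lt_top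
  have hSV : (volume S).toReal ≤ V := ENNReal.toReal_le_of_le_ofReal hV0 hV
  -- A regularized inverse of `q1`: `1 = q1 * w + κ² / (q1² + κ²)`. The first part has the factor
  -- `q1` needed for the integration by parts; the second is already small in `L¹` by the previous
  -- lemma.
  set w : Plane → ℝ := fun b => q1 b / (q1 b ^ 2 + κ ^ 2) with hw
  set w1 : Plane → ℝ := fun b => q11 b * (κ ^ 2 - q1 b ^ 2) / (q1 b ^ 2 + κ ^ 2) ^ 2 with hw1
  have hwc : Continuous w := by rw [hw]; fun_prop (disch := exact hd')
  have hw1c : Continuous w1 := by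
    rw [hw1]; fun_prop (disch := exact fun b => pow_ne_zero _ (hd' b))
  have hwd : ∀ b, HasLineDerivAt ℝ w (w1 b) b v := by
    intro b
    have h := hq1d b
    unfold HasLineDerivAt at h ⊢
    have h1 := h.div ((h.pow 2).add_const (κ ^ 2)) (by simpa using hd' b)
    refine h1.congr_deriv ?_
    simp only [hw1, zero_smul, add_zero, Pi.pow_apply]
    push_cast
    ring
  have hBw : ∀ b, HasLineDerivAt ℝ (fun b => (w b : ℂ) * B b)
      ((w1 b : ℂ) * B b + (w b : ℂ) * B1 b) b v := by
    intro b
    have h := hwd b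
    have h' := hBd b
    unfold HasLineDerivAt at h h' ⊢
    have h2 := h.ofReal_comp.mul h'
    simp only [zero_smul, add_zero] at h2
    exact h2
  have ibp := integral_cexp_mul_lineDeriv hq hq1 (B := fun b => (w b : ℂ) * B b)
    (B' := fun b => (w1 b : ℂ) * B b + (w b : ℂ) * B1 b) (by fun_prop) (by fun_prop)
    hcB.mul_left (hcB.mul_left.add hcB1.mul_left) hqd hBw τ
  have hdinv : Continuous fun b => (q1 b ^ 2 + κ ^ 2)⁻¹ := by fun_prop (disch := exact hd')
  have i3 : Integrable fun b => β b / (q1 b ^ 2 + κ ^ 2) := by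
    simp only [div_eq_mul_inv]
    exact Continuous.integrable_of_hasCompactSupport (by fun_prop) hcβ.mul_right
  have hwle : ∀ b, |w b| ≤ 1 / κ := by
    intro b
    rw [hw]; simp only
    rw [abs_div, abs_of_pos (hd b), div_le_div_iff₀ (hd b) hκ, one_mul]
    nlinarith [sq_nonneg (|q1 b| - κ), sq_abs (q1 b), abs_nonneg (q1 b)]
  have hw1le : ∀ b, β b ≠ 0 → |w1 b| ≤ M / (q1 b ^ 2 + κ ^ 2) := by
    intro b hb
    rw [hw1]; simp only
    rw [abs_div, abs_mul, abs_of_pos (pow_pos (hd b) 2), div_le_div_iff₀ (pow_pos (hd b) 2) (hd b)]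
    have h1 : |κ ^ 2 - q1 b ^ 2| ≤ q1 b ^ 2 + κ ^ 2 :=
      abs_le.2 ⟨by nlinarith [sq_nonneg κ], by nlinarith [sq_nonneg (q1 b)]⟩
    calc |q11 b| * |κ ^ 2 - q1 b ^ 2| * (q1 b ^ 2 + κ ^ 2)
        ≤ M * (q1 b ^ 2 + κ ^ 2) * (q1 b ^ 2 + κ ^ 2) := by
          gcongr
          exact hq11M b hb
      _ = _ := by ring
  have e1 : ∀ b, ‖Complex.exp (-Complex.I * τ * q b)‖ = 1 := by
    intro b
    rw [show -Complex.I * τ * q b = ((-(τ * q b) : ℝ) : ℂ) * Complex.I by push_cast; ring]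
    exact Complex.norm_exp_ofReal_mul_I _
  have iS : Integrable (S.indicator fun _ : Plane => M / κ) :=
    (integrable_indicator_iff hS).2 (integrableOn_const hSfin.ne)
  have t1 : ‖∫ b, Complex.exp (-Complex.I * τ * q b) *
      ((w1 b : ℂ) * B b + (w b : ℂ) * B1 b)‖ ≤ M ^ 2 * (3 * M * V / (c * κ)) + M / κ * V := by
    calc _ ≤ ∫ b, (M ^ 2 * (β b / (q1 b ^ 2 + κ ^ 2)) + S.indicator (fun _ => M / κ) b) := by
          refine norm_integral_le_of_norm_le ((i3.const_mul _).add iS) (Eventually.of_forall fun b => ?_)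
          rw [norm_mul, e1, one_mul]
          refine (norm_add_le _ _).trans (add_le_add ?_ ?_)
          · rw [norm_mul, Complex.norm_real, Real.norm_eq_abs]
            by_cases hb : β b = 0
            · have := hBM b
              rw [hb, mul_zero] at this
              simp [hb, norm_le_zero_iff.1 this]
            · calc |w1 b| * ‖B b‖ ≤ M / (q1 b ^ 2 + κ ^ 2) * (M * β b) := by
                    have := hd b
                    gcongr
                    · exact hw1le b hb
                    · exact hBM b
                _ = _ := by ring
          · by_cases hb : b ∈ S
            · rw [Set.indicator_of_mem hb, norm_mul, Complex.norm_real, Real.norm_eq_abs]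
              calc |w b| * ‖B1 b‖ ≤ 1 / κ * M := by
                    gcongr
                    · exact hwle b
                    · exact hB1M b
                _ = _ := by ring
            · simp [hb, hB1S b hb]
      _ = M ^ 2 * (∫ b, β b / (q1 b ^ 2 + κ ^ 2)) + M / κ * volume.real S := by
          rw [integral_add (i3.const_mul _) iS, integral_const_mul, integral_indicator_const _ hS]
          simp [mul_comm]
      _ ≤ _ := by
          unfold Measure.real
          gcongr
  have t2 : ‖∫ b, Complex.exp (-Complex.I * τ * q b) *
      (((κ ^ 2 / (q1 b ^ 2 + κ ^ 2) : ℝ) : ℂ) * B b)‖ ≤ κ ^ 2 * M * (3 * M * V / (c * κ)) := by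
    calc _ ≤ ∫ b, (κ ^ 2 * M * (β b / (q1 b ^ 2 + κ ^ 2))) := by
          refine norm_integral_le_of_norm_le (i3.const_mul _) (Eventually.of_forall fun b => ?_)
          rw [norm_mul, e1, one_mul, norm_mul, Complex.norm_real, Real.norm_eq_abs,
            abs_of_nonneg (by have := hd b; positivity)]
          calc κ ^ 2 / (q1 b ^ 2 + κ ^ 2) * ‖B b‖ ≤ κ ^ 2 / (q1 b ^ 2 + κ ^ 2) * (M * β b) := by
                have := hd b
                gcongr
                exact hBM b
            _ = _ := by ring
      _ ≤ _ := by
          rw [integral_const_mul]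
          gcongr
  have hI1 : Integrable fun b => Complex.exp (-Complex.I * τ * q b) * (q1 b * ((w b : ℂ) * B b)) :=
    Continuous.integrable_of_hasCompactSupport (by fun_prop) hcB.mul_left.mul_left.mul_left
  have hI2 : Integrable fun b => Complex.exp (-Complex.I * τ * q b) *
      (((κ ^ 2 / (q1 b ^ 2 + κ ^ 2) : ℝ) : ℂ) * B b) :=
    Continuous.integrable_of_hasCompactSupport (by
      have : Continuous fun b => κ ^ 2 / (q1 b ^ 2 + κ ^ 2) := by fun_prop (disch := exact hd')
      fun_prop) hcB.mul_left.mul_left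
  have split : ∫ b, Complex.exp (-Complex.I * τ * q b) * B b
      = (∫ b, Complex.exp (-Complex.I * τ * q b) * (q1 b * ((w b : ℂ) * B b)))
        + ∫ b, Complex.exp (-Complex.I * τ * q b) *
          (((κ ^ 2 / (q1 b ^ 2 + κ ^ 2) : ℝ) : ℂ) * B b) := by
    rw [← integral_add hI1 hI2]
    congr 1; ext b
    have hdb : ((q1 b : ℂ) ^ 2 + (κ : ℂ) ^ 2) ≠ 0 := by exact_mod_cast hd' b
    rw [hw]; push_cast
    field_simp
  have t1' : ‖∫ b, Complex.exp (-Complex.I * τ * q b) * (q1 b * ((w b : ℂ) * B b))‖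
      ≤ κ ^ 2 * (M ^ 2 * (3 * M * V / (c * κ)) + M / κ * V) := by
    rw [← ibp, norm_mul, norm_mul, Complex.norm_I, one_mul, Complex.norm_real, Real.norm_eq_abs,
      abs_of_pos hτ0] at t1
    rw [hκ2]
    rw [inv_mul_eq_div, le_div_iff₀ hτ0]
    linarith
  rw [split]
  refine (norm_add_le _ _).trans ((add_le_add t1' t2).trans (le_of_eq ?_))
  field_simp
  ring

/-! ### Phases depending on parameters: decay and convergence of time integrals -/

open scoped Topology Manifold

/-- The parameters of the families of phases. -/
abbrev Param : Type := ℝ × ℝ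

/-- The derivative in the direction `v` of the plane, for a function which also depends on
parameters. -/
def sliceDeriv {F : Type*} [NormedAddCommGroup F] [NormedSpace ℝ F] (v : Plane)
    (f : Param × Plane → F) : Param × Plane → F := fun x => fderiv ℝ f x (0, v)

section sliceDeriv

variable {F : Type*} [NormedAddCommGroup F] [NormedSpace ℝ F] {f : Param × Plane → F} {v : Plane}

lemma contDiff_sliceDeriv (hf : ContDiff ℝ ∞ f) : ContDiff ℝ ∞ (sliceDeriv v f) :=
  (hf.fderiv_right (m := ∞) (by simp)).clm_apply contDiff_const

lemma hasLineDerivAt_slice (hf : ContDiff ℝ ∞ f) (p : Param) (b : Plane) :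
    HasLineDerivAt ℝ (fun b => f (p, b)) (sliceDeriv v f (p, b)) b v := by
  have h1 : HasFDerivAt f (fderiv ℝ f (p, b)) (p, b) :=
    (hf.differentiable (by simp) _).hasFDerivAt
  have h2 : HasFDerivAt (fun b : Plane => (p, b)) (ContinuousLinearMap.inr ℝ Param Plane) b :=
    hasFDerivAt_prodMk_right p b
  have h3 := (h1.comp b h2).hasLineDerivAt v
  simp only [ContinuousLinearMap.comp_apply, ContinuousLinearMap.inr_apply] at h3
  exact h3

/-- The set `β ≠ 1` is open, so vanishing there is inherited by derivatives. This is why amplitudes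
are required to vanish where `β ≠ 1` and not merely where `β = 0`: it makes them stable under
integration by parts and gives `‖B‖ ≤ M β`. -/
lemma sliceDeriv_eq_zero {β : Plane → ℝ} (hβ : Continuous β)
    (hf : ∀ x : Param × Plane, β x.2 ≠ 1 → f x = 0) (x : Param × Plane) (hx : β x.2 ≠ 1) :
    sliceDeriv v f x = 0 := by
  have hU : IsOpen {x : Param × Plane | β x.2 ≠ 1} :=
    isOpen_ne_fun (by fun_prop) continuous_const
  have : f =ᶠ[𝓝 x] fun _ => 0 := by
    filter_upwards [hU.mem_nhds hx] with y hy using hf y hy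
  simp [sliceDeriv, this.fderiv_eq]

end sliceDeriv

/-- A smooth function that does not vanish on a closed set has a smooth inverse on that set. -/
lemma exists_contDiff_inv {X : Type*} [NormedAddCommGroup X] [NormedSpace ℝ X]
    [FiniteDimensional ℝ X] {W : X → ℝ} (hW : ContDiff ℝ ∞ W) {Z : Set X} (hZ : IsClosed Z)
    (h : ∀ x ∈ Z, W x ≠ 0) :
    ∃ g : X → ℝ, ContDiff ℝ ∞ g ∧ ∀ x ∈ Z, g x * W x = 1 := by
  have hs : IsClosed {x | W x = 0} := isClosed_eq hW.continuous continuous_const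
  obtain ⟨η, h0, h1, hη⟩ := exists_contMDiffMap_zero_one_of_isClosed (n := ⊤) 𝓘(ℝ, X) hs hZ
    (Set.disjoint_left.2 fun x hx hxZ => h x hxZ hx)
  have hηs : ContDiff ℝ ∞ η := η.contMDiff.contDiff
  have hpos : ∀ x, W x ^ 2 + (1 - η x) ≠ 0 := by
    intro x
    by_cases hx : W x = 0
    · have : η x = 0 := h0 hx
      simp [hx, this]
    · have := (hη x).2
      have := sq_pos_of_ne_zero hx
      linarith
  -- The function `η` is `0` on the zeros of `W` and `1` on `Z`, so the denominator never vanishes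
  -- and equals `W²` on `Z`.
  refine ⟨fun x => W x / (W x ^ 2 + (1 - η x)), ?_, fun x hx => ?_⟩
  · exact hW.div ((hW.pow 2).add (contDiff_const.sub hηs)) hpos
  · have : η x = 1 := h1 hx
    have := h x hx
    simp only [*, sub_self, add_zero]
    field_simp

/-- A family of real phases `q(p, ·)`, for `p` in a compact set `K`, such that on the support of
the cutoff `β` the phase has no critical zeros and its critical points in the direction `v` are
nondegenerate minima. -/
structure IsPhaseFamily (K : Set Param) (β : Plane → ℝ) (q : Param × Plane → ℝ) (v w : Plane) :
    Prop where
  compact : IsCompact K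
  smooth_cutoff : ContDiff ℝ ∞ β
  cutoff_compact : HasCompactSupport β
  cutoff_nonneg : ∀ b, 0 ≤ β b
  smooth : ContDiff ℝ ∞ q
  noncritical : ∀ p ∈ K, ∀ b ∈ tsupport β,
    q (p, b) ≠ 0 ∨ sliceDeriv v q (p, b) ≠ 0 ∨ sliceDeriv w q (p, b) ≠ 0
  convex : ∀ p ∈ K, ∀ b ∈ tsupport β,
    0 < sliceDeriv v (sliceDeriv v q) (p, b) + sliceDeriv v q (p, b) ^ 2

/-- Smooth amplitudes which vanish where the cutoff `β` is not `1`. -/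
structure IsAmplitude (β : Plane → ℝ) (B : Param × Plane → ℂ) : Prop where
  smooth : ContDiff ℝ ∞ B
  eq_zero : ∀ x : Param × Plane, β x.2 ≠ 1 → B x = 0

/-- The oscillatory integral `∫ exp(-iτ q(p, b)) B(p, b) db`. -/
def oscInt (q : Param × Plane → ℝ) (B : Param × Plane → ℂ) (p : Param) (τ : ℝ) : ℂ :=
  ∫ b : Plane, Complex.exp (-Complex.I * τ * q (p, b)) * B (p, b)

lemma norm_cexp_neg_I_mul (τ x : ℝ) : ‖Complex.exp (-Complex.I * τ * x)‖ = 1 := by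
  rw [show -Complex.I * τ * x = ((-(τ * x) : ℝ) : ℂ) * Complex.I by push_cast; ring]
  exact Complex.norm_exp_ofReal_mul_I _

section

variable {K : Set Param} {β : Plane → ℝ} {q : Param × Plane → ℝ} {v w : Plane}
  {B B₁ B₂ : Param × Plane → ℂ}

lemma IsAmplitude.sliceDeriv (hβ : Continuous β) (hB : IsAmplitude β B) (u : Plane) :
    IsAmplitude β (sliceDeriv u B) :=
  ⟨contDiff_sliceDeriv hB.smooth, fun x hx => sliceDeriv_eq_zero hβ hB.eq_zero x hx⟩

lemma IsAmplitude.smul (hB : IsAmplitude β B) {g : Param × Plane → ℝ} (hg : ContDiff ℝ ∞ g) :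
    IsAmplitude β (fun x => (g x : ℂ) * B x) :=
  ⟨(Complex.ofRealCLM.contDiff.comp hg).mul hB.smooth, fun x hx => by simp [hB.eq_zero x hx]⟩

lemma IsAmplitude.add (hB₁ : IsAmplitude β B₁) (hB₂ : IsAmplitude β B₂) :
    IsAmplitude β (fun x => B₁ x + B₂ x) :=
  ⟨hB₁.smooth.add hB₂.smooth, fun x hx => by simp [hB₁.eq_zero x hx, hB₂.eq_zero x hx]⟩

lemma IsAmplitude.eq_zero_of_notMem (hB : IsAmplitude β B) (p : Param) {b : Plane}
    (hb : b ∉ tsupport β) : B (p, b) = 0 :=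
  hB.eq_zero _ (by simp [image_eq_zero_of_notMem_tsupport hb])

lemma IsAmplitude.hasCompactSupport (hβ : HasCompactSupport β) (hB : IsAmplitude β B) (p : Param) :
    HasCompactSupport fun b => B (p, b) :=
  HasCompactSupport.intro hβ fun _ hb => hB.eq_zero_of_notMem p hb

lemma IsAmplitude.continuous_slice (hB : IsAmplitude β B) (p : Param) :
    Continuous fun b => B (p, b) := hB.smooth.continuous.comp (by fun_prop)

lemma IsAmplitude.exists_bound (hβ : HasCompactSupport β) (hK : IsCompact K)
    (hB : IsAmplitude β B) : ∃ M : ℝ, 0 ≤ M ∧ ∀ p ∈ K, ∀ b, ‖B (p, b)‖ ≤ M := by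
  obtain ⟨M, hM⟩ := (hK.prod hβ.isCompact).exists_bound_of_continuousOn
    hB.smooth.continuous.continuousOn
  refine ⟨max M 0, le_max_right _ _, fun p hp b => ?_⟩
  by_cases hb : b ∈ tsupport β
  · exact (hM (p, b) ⟨hp, hb⟩).trans (le_max_left _ _)
  · rw [hB.eq_zero_of_notMem p hb, norm_zero]
    exact le_max_right _ _

lemma IsPhaseFamily.continuous_slice (h : IsPhaseFamily K β q v w) (p : Param) :
    Continuous fun b => q (p, b) := h.smooth.continuous.comp (by fun_prop)

lemma IsAmplitude.integrable (h : IsPhaseFamily K β q v w) (hB : IsAmplitude β B) (p : Param)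
    (τ : ℝ) : Integrable fun b => Complex.exp (-Complex.I * τ * q (p, b)) * B (p, b) := by
  have h1 := hB.smooth.continuous
  have h2 := h.smooth.continuous
  exact Continuous.integrable_of_hasCompactSupport (by fun_prop)
    (hB.hasCompactSupport h.cutoff_compact p).mul_left

/-- An oscillatory integral of an amplitude is bounded. -/
lemma IsPhaseFamily.exists_bound (h : IsPhaseFamily K β q v w) (hB : IsAmplitude β B) :
    ∃ C : ℝ, 0 ≤ C ∧ ∀ p ∈ K, ∀ τ, ‖oscInt q B p τ‖ ≤ C := by
  obtain ⟨M, hM0, hM⟩ := hB.exists_bound h.cutoff_compact h.compact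
  refine ⟨M * volume.real (tsupport β), by positivity, fun p hp τ => ?_⟩
  unfold oscInt
  rw [← setIntegral_eq_integral_of_forall_compl_eq_zero (s := tsupport β)
    (fun b hb => by simp [hB.eq_zero_of_notMem p hb])]
  refine norm_setIntegral_le_of_norm_le_const h.cutoff_compact.isCompact.measure_lt_top
    fun b _ => ?_
  rw [norm_mul, norm_cexp_neg_I_mul, one_mul]
  exact hM p hp b

/-- An oscillatory integral of an amplitude is `O(τ^{-1/2})`. -/
lemma IsPhaseFamily.exists_decay (h : IsPhaseFamily K β q v w) (hB : IsAmplitude β B) :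
    ∃ C : ℝ, 0 ≤ C ∧ ∀ p ∈ K, ∀ τ, 1 ≤ τ → ‖oscInt q B p τ‖ ≤ C * τ ^ (-(1 / 2) : ℝ) := by
  have hcβ := h.cutoff_compact
  have hβc : Continuous β := h.smooth_cutoff.continuous
  have hB1 := hB.sliceDeriv hβc v
  set q1 := KleinGordon.sliceDeriv v q
  set q11 := KleinGordon.sliceDeriv v q1
  have hq1 : ContDiff ℝ ∞ q1 := contDiff_sliceDeriv h.smooth
  have hq11 : ContDiff ℝ ∞ q11 := contDiff_sliceDeriv hq1
  set β' : Param × Plane → ℝ := fun x => β x.2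
  have hβ' : ContDiff ℝ ∞ β' := h.smooth_cutoff.comp contDiff_snd
  set β1 : Plane → ℝ := fun b => lineDeriv ℝ β b v with hβ1def
  have hβdiff : ∀ b, LineDifferentiableAt ℝ β b v := fun b =>
    (h.smooth_cutoff.differentiable (by simp) b).lineDifferentiableAt
  have hβ1c : Continuous β1 := by
    have : β1 = fun b => fderiv ℝ β b v := by
      ext b
      exact (h.smooth_cutoff.differentiable (by simp) b).lineDeriv_eq_fderiv
    rw [this]
    exact ((h.smooth_cutoff.fderiv_right (m := ∞) (by simp)).clm_apply contDiff_const).continuous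
  have hβ1S : ∀ b, b ∉ tsupport β → β1 b = 0 := by
    intro b hb
    have h1 : β =ᶠ[𝓝 b] fun _ => 0 := notMem_tsupport_iff_eventuallyEq.1 hb
    have h2 : fderiv ℝ β b = 0 := by rw [h1.fderiv_eq]; simp
    rw [hβ1def]; simp only
    rw [(h.smooth_cutoff.differentiable (by simp) b).lineDeriv_eq_fderiv, h2]; simp
  have hcβ1 : HasCompactSupport β1 := HasCompactSupport.intro hcβ hβ1S
  obtain ⟨M1, -, hM1⟩ := hB.exists_bound hcβ h.compact
  obtain ⟨M2, -, hM2⟩ := hB1.exists_bound hcβ h.compact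
  obtain ⟨M3, hM3⟩ := hβc.bounded_above_of_compact_support hcβ
  obtain ⟨M4, hM4⟩ := hβ1c.bounded_above_of_compact_support hcβ1
  obtain ⟨M5, hM5⟩ := (h.compact.prod hcβ.isCompact).exists_bound_of_continuousOn
    hq11.continuous.continuousOn
  -- Compactness turns the pointwise convexity condition into a lower bound uniform in the
  -- parameters.
  obtain ⟨c, hc, hcN⟩ : ∃ c : ℝ, 0 < c ∧ ∀ p ∈ K, ∀ b ∈ tsupport β,
      c ≤ q11 (p, b) + q1 (p, b) ^ 2 := by
    rcases (K ×ˢ tsupport β).eq_empty_or_nonempty with he | hne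
    · exact ⟨1, one_pos, fun p hp b hb => absurd (Set.mk_mem_prod hp hb) (by simp [he])⟩
    · obtain ⟨x, hx, hmin⟩ := (h.compact.prod hcβ.isCompact).exists_isMinOn hne
        (f := fun x => q11 x + q1 x ^ 2)
        (hq11.continuous.add (hq1.continuous.pow 2)).continuousOn
      exact ⟨_, h.convex x.1 hx.1 x.2 hx.2, fun p hp b hb => hmin (Set.mk_mem_prod hp hb)⟩
  set M := max (max M1 M2) (max M3 (max M4 (max M5 0))) with hMdef
  have hMM1 : M1 ≤ M := (le_max_left _ _).trans (le_max_left _ _)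
  have hMM2 : M2 ≤ M := (le_max_right _ _).trans (le_max_left _ _)
  have hMM3 : M3 ≤ M := (le_max_left _ _).trans (le_max_right _ _)
  have hMM4 : M4 ≤ M := ((le_max_left _ _).trans (le_max_right _ _)).trans (le_max_right _ _)
  have hMM5 : M5 ≤ M := (((le_max_left _ _).trans (le_max_right _ _)).trans
    (le_max_right _ _)).trans (le_max_right _ _)
  have hM0 : 0 ≤ M := (((le_max_right _ _).trans (le_max_right _ _)).trans
    (le_max_right _ _)).trans (le_max_right _ _)
  set V := volume.real (tsupport β)
  refine ⟨M * V + 3 * M ^ 3 * V / c + 3 * M ^ 2 * V / c, by positivity, fun p hp τ hτ => ?_⟩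
  have hsl : Continuous fun b : Plane => (p, b) := by fun_prop
  refine norm_integral_cexp_le (q := fun b => q (p, b)) (q1 := fun b => q1 (p, b))
    (q11 := fun b => q11 (p, b)) (β := β) (β1 := β1) (B := fun b => B (p, b))
    (B1 := fun b => KleinGordon.sliceDeriv v B (p, b)) (v := v) (S := tsupport β)
    (h.continuous_slice p) (hq1.continuous.comp hsl) (hq11.continuous.comp hsl) hβc hβ1c
    (hB.continuous_slice p) (hB1.continuous_slice p) hcβ hcβ1 (hB.hasCompactSupport hcβ p)
    (hB1.hasCompactSupport hcβ p) (hasLineDerivAt_slice h.smooth p) (hasLineDerivAt_slice hq1 p)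
    (fun b => (hβdiff b).hasLineDerivAt) (hasLineDerivAt_slice hB.smooth p)
    (isClosed_tsupport β).measurableSet ?_ (by positivity)
    (fun b hb => image_eq_zero_of_notMem_tsupport hb) hβ1S
    (fun b hb => hB1.eq_zero_of_notMem p hb) h.cutoff_nonneg
    (fun b => (le_abs_self _).trans ((hM3 b).trans hMM3)) (fun b => (hM4 b).trans hMM4) ?_
    (fun b => (hM2 p hp b).trans hMM2) ?_ hc ?_ hτ
  · rw [show V = (volume (tsupport β)).toReal from rfl,
      ENNReal.ofReal_toReal hcβ.isCompact.measure_lt_top.ne]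
  · intro b
    by_cases hb : β b = 1
    · rw [hb, mul_one]; exact (hM1 p hp b).trans hMM1
    · simp only [hB.eq_zero (p, b) hb, norm_zero]
      exact mul_nonneg hM0 (h.cutoff_nonneg b)
  · intro b hb
    exact (hM5 (p, b) ⟨hp, subset_tsupport _ hb⟩).trans hMM5
  · intro b hb
    exact hcN p hp b (subset_tsupport _ hb)

lemma oscInt_sliceDeriv_mul (h : IsPhaseFamily K β q v w) (hB : IsAmplitude β B) (u : Plane)
    (p : Param) (τ : ℝ) :
    Complex.I * τ * oscInt q (fun x => ((sliceDeriv u q x : ℝ) : ℂ) * B x) p τ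
      = oscInt q (sliceDeriv u B) p τ := by
  have hB1 := hB.sliceDeriv h.smooth_cutoff.continuous u
  have hsl : Continuous fun b : Plane => (p, b) := by fun_prop
  exact integral_cexp_mul_lineDeriv (h.continuous_slice p)
    ((contDiff_sliceDeriv h.smooth).continuous.comp hsl) (hB.continuous_slice p)
    (hB1.continuous_slice p) (hB.hasCompactSupport h.cutoff_compact p)
    (hB1.hasCompactSupport h.cutoff_compact p) (hasLineDerivAt_slice h.smooth p)
    (hasLineDerivAt_slice hB.smooth p) τ

lemma oscInt_add (h : IsPhaseFamily K β q v w) (h₁ : IsAmplitude β B₁) (h₂ : IsAmplitude β B₂)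
    (p : Param) (τ : ℝ) :
    oscInt q (fun x => B₁ x + B₂ x) p τ = oscInt q B₁ p τ + oscInt q B₂ p τ := by
  unfold oscInt
  rw [← integral_add (h₁.integrable h p τ) (h₂.integrable h p τ)]
  congr 1; ext b; ring

/-- An amplitude is split into a part which gains a factor `1/τ` and a part divisible by the
phase. -/
lemma IsPhaseFamily.exists_split (h : IsPhaseFamily K β q v w) (hB : IsAmplitude β B) :
    ∃ B' B₀ : Param × Plane → ℂ, IsAmplitude β B' ∧ IsAmplitude β B₀ ∧ ∀ p ∈ K, ∀ τ : ℝ, 0 < τ →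
      oscInt q B p τ = (Complex.I * τ)⁻¹ * oscInt q B' p τ
        + oscInt q (fun x => (q x : ℂ) * B₀ x) p τ := by
  have hqv : ContDiff ℝ ∞ (sliceDeriv v q) := contDiff_sliceDeriv h.smooth
  have hqw : ContDiff ℝ ∞ (sliceDeriv w q) := contDiff_sliceDeriv h.smooth
  have hβc : Continuous β := h.smooth_cutoff.continuous
  -- On the support, `1 = g (q² + q_v² + q_w²)`. The terms with `q_v` and `q_w` are integrated by
  -- parts and gain `1/τ`; the term with `q` is left as the part divisible by the phase.
  obtain ⟨g, hg, hgW⟩ := exists_contDiff_inv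
    (W := fun x => q x ^ 2 + sliceDeriv v q x ^ 2 + sliceDeriv w q x ^ 2)
    (((h.smooth.pow 2).add (hqv.pow 2)).add (hqw.pow 2))
    (h.compact.prod h.cutoff_compact.isCompact).isClosed (by
      rintro ⟨p, b⟩ ⟨hp, hb⟩
      have h1 := sq_nonneg (q (p, b))
      have h2 := sq_nonneg (sliceDeriv v q (p, b))
      have h3 := sq_nonneg (sliceDeriv w q (p, b))
      rcases h.noncritical p hp b hb with h0 | h0 | h0 <;>
        have := sq_pos_of_ne_zero h0 <;> positivity)
  have hBv := hB.smul (hg.mul hqv)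
  have hBw := hB.smul (hg.mul hqw)
  have hB0 := hB.smul (hg.mul h.smooth)
  refine ⟨_, _, (hBv.sliceDeriv hβc v).add (hBw.sliceDeriv hβc w), hB0, fun p hp τ hτ => ?_⟩
  have hτ' : Complex.I * τ ≠ 0 := by simp [hτ.ne']
  rw [oscInt_add h (hBv.sliceDeriv hβc v) (hBw.sliceDeriv hβc w), ← oscInt_sliceDeriv_mul h hBv,
    ← oscInt_sliceDeriv_mul h hBw, ← mul_add, inv_mul_cancel_left₀ hτ',
    ← oscInt_add h (hBv.smul hqv) (hBw.smul hqw),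
    ← oscInt_add h ((hBv.smul hqv).add (hBw.smul hqw)) (hB0.smul h.smooth)]
  unfold oscInt
  congr 1; ext b
  by_cases hb : b ∈ tsupport β
  · have h1 := hgW (p, b) ⟨hp, hb⟩
    have h2 : (g (p, b) : ℂ) * (q (p, b) ^ 2 + sliceDeriv v q (p, b) ^ 2
      + sliceDeriv w q (p, b) ^ 2) = 1 := by exact_mod_cast h1
    push_cast
    linear_combination (-Complex.exp (-Complex.I * τ * q (p, b)) * B (p, b)) * h2
  · simp [hB.eq_zero_of_notMem p hb]

/-- Each time derivative brings down a factor `q`. Read backwards, an oscillatory integral whose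
amplitude is divisible by the phase is an exact derivative in time. -/
lemma hasDerivAt_oscInt (h : IsPhaseFamily K β q v w) (hB : IsAmplitude β B) (p : Param) (τ : ℝ) :
    HasDerivAt (fun τ => oscInt q B p τ)
      (-Complex.I * oscInt q (fun x => (q x : ℂ) * B x) p τ) τ := by
  have h1 := hB.smooth.continuous
  have h2 := h.smooth.continuous
  have key := hasDerivAt_integral_of_dominated_loc_of_deriv_le (μ := (volume : Measure Plane))
    (F := fun (τ : ℝ) b => Complex.exp (-Complex.I * τ * q (p, b)) * B (p, b))
    (F' := fun (τ : ℝ) b => Complex.exp (-Complex.I * τ * q (p, b)) * (-Complex.I * q (p, b)) * B (p, b))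
    (bound := fun b => ‖q (p, b) * B (p, b)‖) (x₀ := τ) (s := Set.univ) univ_mem ?_ ?_ ?_ ?_ ?_ ?_
  · have := key.2
    unfold oscInt
    rw [← integral_const_mul]
    refine this.congr_deriv ?_
    congr 1; ext b; ring
  · exact Eventually.of_forall fun τ => (hB.integrable h p τ).aestronglyMeasurable
  · exact hB.integrable h p τ
  · exact Continuous.aestronglyMeasurable (by fun_prop)
  · refine Eventually.of_forall fun b τ _ => ?_
    rw [norm_mul, norm_mul, norm_cexp_neg_I_mul, norm_mul, norm_mul]
    simp
  · exact (Continuous.integrable_of_hasCompactSupport (by fun_prop)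
      (hB.hasCompactSupport h.cutoff_compact p).mul_left).norm
  · refine Eventually.of_forall fun b τ _ => ?_
    have h3 : HasDerivAt (fun τ : ℝ => -Complex.I * τ * q (p, b)) (-Complex.I * q (p, b)) τ := by
      simpa using ((Complex.ofRealCLM.hasDerivAt (x := τ)).const_mul (-Complex.I)).mul_const
        (q (p, b) : ℂ)
    exact h3.cexp.mul_const _

/-- `∫₀^Θ ∫ exp(-iτ q(p, b)) B(p, b) db dτ`. -/
def timeInt (q : Param × Plane → ℝ) (B : Param × Plane → ℂ) (p : Param) (Θ : ℝ) : ℂ :=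
  ∫ τ in (0 : ℝ)..Θ, oscInt q B p τ

lemma continuous_oscInt (h : IsPhaseFamily K β q v w) (hB : IsAmplitude β B) :
    Continuous fun x : Param × ℝ => oscInt q B x.1 x.2 := by
  have : (fun x : Param × ℝ => oscInt q B x.1 x.2) = fun x : Param × ℝ => ∫ b in tsupport β,
      Complex.exp (-Complex.I * x.2 * q (x.1, b)) * B (x.1, b) := by
    ext x
    exact (setIntegral_eq_integral_of_forall_compl_eq_zero (s := tsupport β)
      (fun b hb => by simp [hB.eq_zero_of_notMem x.1 hb])).symm
  rw [this]
  refine continuous_parametric_integral_of_continuous ?_ h.cutoff_compact.isCompact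
  have h1 := hB.smooth.continuous
  have h2 := h.smooth.continuous
  unfold Function.uncurry
  fun_prop

lemma continuous_timeInt (h : IsPhaseFamily K β q v w) (hB : IsAmplitude β B) (Θ : ℝ) :
    Continuous fun p => timeInt q B p Θ :=
  intervalIntegral.continuous_parametric_intervalIntegral_of_continuous'
    (f := fun p τ => oscInt q B p τ) (continuous_oscInt h hB) 0 Θ

lemma intervalIntegrable_oscInt (h : IsPhaseFamily K β q v w) (hB : IsAmplitude β B) (p : Param)
    (a b : ℝ) : IntervalIntegrable (fun τ => oscInt q B p τ) volume a b :=
  ((continuous_oscInt h hB).comp (by fun_prop : Continuous fun τ : ℝ => (p, τ))).intervalIntegrable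
    a b

lemma timeInt_sub (h : IsPhaseFamily K β q v w) (hB : IsAmplitude β B) (p : Param) (a b : ℝ) :
    timeInt q B p b - timeInt q B p a = ∫ τ in a..b, oscInt q B p τ :=
  intervalIntegral.integral_interval_sub_left (intervalIntegrable_oscInt h hB p _ _)
    (intervalIntegrable_oscInt h hB p _ _)

/-- The time integrals of an oscillatory integral converge with the rate `Θ^{-1/2}`. -/
lemma IsPhaseFamily.exists_timeInt_cauchy (h : IsPhaseFamily K β q v w) (hB : IsAmplitude β B) :
    ∃ C : ℝ, 0 ≤ C ∧ ∀ p ∈ K, ∀ a b, 1 ≤ a → a ≤ b →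
      ‖timeInt q B p b - timeInt q B p a‖ ≤ C * a ^ (-(1 / 2) : ℝ) := by
  -- The decay `τ^(-1/2)` alone is not integrable. After the splitting, the first part is
  -- `O(τ^(-3/2))`, and the second integrates exactly to boundary terms of size `a^(-1/2)`.
  obtain ⟨B', B₀, hB', hB₀, hsplit⟩ := h.exists_split hB
  obtain ⟨C', hC'0, hC'⟩ := h.exists_decay hB'
  obtain ⟨C₀, hC₀0, hC₀⟩ := h.exists_decay hB₀
  refine ⟨2 * C' + 2 * C₀, by positivity, fun p hp a b ha hab => ?_⟩
  have ha0 : 0 < a := by linarith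
  have hc' : Continuous fun τ => oscInt q B' p τ :=
    (continuous_oscInt h hB').comp (by fun_prop : Continuous fun τ : ℝ => (p, τ))
  have hcq : Continuous fun τ => oscInt q (fun x => (q x : ℂ) * B₀ x) p τ :=
    (continuous_oscInt h (hB₀.smul h.smooth)).comp (by fun_prop : Continuous fun τ : ℝ => (p, τ))
  have hpos : ∀ τ ∈ Set.uIcc a b, 0 < τ := by
    intro τ hτ
    rw [Set.uIcc_of_le hab] at hτ
    linarith [hτ.1]
  have i1 : IntervalIntegrable (fun τ : ℝ => (Complex.I * τ)⁻¹ * oscInt q B' p τ) volume a b := by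
    apply ContinuousOn.intervalIntegrable
    refine ContinuousOn.mul (ContinuousOn.inv₀ (by fun_prop) fun τ hτ => ?_) hc'.continuousOn
    have := hpos τ hτ
    simp [this.ne']
  have i2 := hcq.intervalIntegrable (μ := volume) a b
  rw [timeInt_sub h hB, intervalIntegral.integral_congr
    (g := fun τ : ℝ => (Complex.I * τ)⁻¹ * oscInt q B' p τ
      + oscInt q (fun x => (q x : ℂ) * B₀ x) p τ)
    (fun τ hτ => hsplit p hp τ (hpos τ hτ)), intervalIntegral.integral_add i1 i2]
  have t1 : ‖∫ τ in a..b, (Complex.I * τ)⁻¹ * oscInt q B' p τ‖ ≤ 2 * C' * a ^ (-(1 / 2) : ℝ) := by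
    have i3 : IntervalIntegrable (fun τ : ℝ => C' * τ ^ (-(3 / 2) : ℝ)) volume a b := by
      apply ContinuousOn.intervalIntegrable
      exact continuousOn_const.mul
        (continuousOn_id.rpow_const fun τ hτ => Or.inl (hpos τ hτ).ne')
    calc _ ≤ ∫ τ in a..b, C' * τ ^ (-(3 / 2) : ℝ) := by
          refine intervalIntegral.norm_integral_le_of_norm_le hab (Eventually.of_forall ?_) i3
          intro τ hτ
          have hτ1 : 1 ≤ τ := by linarith [hτ.1]
          have hτ0 : 0 < τ := by linarith
          rw [norm_mul, norm_inv, norm_mul, Complex.norm_I, one_mul, Complex.norm_real,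
            Real.norm_eq_abs, abs_of_pos hτ0]
          calc τ⁻¹ * ‖oscInt q B' p τ‖ ≤ τ⁻¹ * (C' * τ ^ (-(1 / 2) : ℝ)) := by
                gcongr; exact hC' p hp τ hτ1
            _ = C' * (τ ^ (-1 : ℝ) * τ ^ (-(1 / 2) : ℝ)) := by rw [Real.rpow_neg_one]; ring
            _ = _ := by rw [← Real.rpow_add hτ0]; norm_num
      _ = C' * (2 * (a ^ (-(1 / 2) : ℝ) - b ^ (-(1 / 2) : ℝ))) := by
          rw [intervalIntegral.integral_const_mul, integral_rpow]
          · norm_num; ring_nf; simp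
          · right
            refine ⟨by norm_num, fun h0 => ?_⟩
            exact (hpos 0 h0).ne' rfl
      _ ≤ _ := by
          have : 0 ≤ b ^ (-(1 / 2) : ℝ) := Real.rpow_nonneg (by linarith) _
          have : C' * (2 * (a ^ (-(1 / 2) : ℝ) - b ^ (-(1 / 2) : ℝ)))
            = 2 * C' * a ^ (-(1 / 2) : ℝ) - 2 * C' * b ^ (-(1 / 2) : ℝ) := by ring
          rw [this]
          have : 0 ≤ 2 * C' * b ^ (-(1 / 2) : ℝ) := by positivity
          linarith
  have t2 : ∫ τ in a..b, oscInt q (fun x => (q x : ℂ) * B₀ x) p τ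
      = Complex.I * oscInt q B₀ p b - Complex.I * oscInt q B₀ p a := by
    refine intervalIntegral.integral_eq_sub_of_hasDerivAt (f := fun τ => Complex.I * oscInt q B₀ p τ)
      (fun τ _ => ?_) i2
    have := (hasDerivAt_oscInt h hB₀ p τ).const_mul Complex.I
    refine this.congr_deriv ?_
    rw [← mul_assoc]; simp
  rw [t2]
  have hba : b ^ (-(1 / 2) : ℝ) ≤ a ^ (-(1 / 2) : ℝ) :=
    Real.rpow_le_rpow_of_nonpos ha0 hab (by norm_num)
  have t3 : ‖Complex.I * oscInt q B₀ p b - Complex.I * oscInt q B₀ p a‖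
      ≤ 2 * C₀ * a ^ (-(1 / 2) : ℝ) := by
    refine (norm_sub_le _ _).trans ?_
    simp only [norm_mul, Complex.norm_I, one_mul]
    have h1 := hC₀ p hp b (ha.trans hab)
    have h2 := hC₀ p hp a ha
    have h3 : C₀ * b ^ (-(1 / 2) : ℝ) ≤ C₀ * a ^ (-(1 / 2) : ℝ) := by gcongr
    linarith
  refine (norm_add_le _ _).trans ?_
  linarith

/-- The time integrals are bounded and converge with the rate `Θ^{-1/4}`. -/
lemma IsPhaseFamily.exists_timeInt_bounds (h : IsPhaseFamily K β q v w) (hB : IsAmplitude β B) :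
    ∃ C : ℝ, 0 ≤ C ∧ (∀ p ∈ K, ∀ a, 0 ≤ a → ‖timeInt q B p a‖ ≤ C) ∧
      ∀ p ∈ K, ∀ a b, 0 < a → a ≤ b →
        ‖timeInt q B p b - timeInt q B p a‖ ≤ C * a ^ (-(1 / 4) : ℝ) := by
  obtain ⟨C₁, hC₁0, hC₁⟩ := h.exists_bound hB
  obtain ⟨C₂, hC₂0, hC₂⟩ := h.exists_timeInt_cauchy hB
  have small : ∀ p ∈ K, ∀ a, 0 ≤ a → a ≤ 1 → ‖timeInt q B p a‖ ≤ C₁ := by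
    intro p hp a ha ha1
    have := intervalIntegral.norm_integral_le_of_norm_le_const (a := 0) (b := a)
      (f := fun τ => oscInt q B p τ) (C := C₁) (fun τ _ => hC₁ p hp τ)
    refine this.trans ?_
    rw [sub_zero, abs_of_nonneg ha]
    nlinarith
  have bdd : ∀ p ∈ K, ∀ a, 0 ≤ a → ‖timeInt q B p a‖ ≤ C₁ + C₂ := by
    intro p hp a ha
    rcases le_total a 1 with ha1 | ha1
    · linarith [small p hp a ha ha1]
    · have h1 := hC₂ p hp 1 a le_rfl ha1
      have h2 := small p hp 1 zero_le_one le_rfl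
      rw [Real.one_rpow, mul_one] at h1
      have := norm_add_le (timeInt q B p a - timeInt q B p 1) (timeInt q B p 1)
      rw [sub_add_cancel] at this
      linarith
  -- The rate is deliberately lowered from `1/2` to `1/4`: in the unscaled variables a faster rate
  -- in time costs a stronger singularity at zero frequency. Together with boundedness, the lower
  -- rate holds for all `a > 0`.
  refine ⟨2 * (C₁ + C₂), by positivity, fun p hp a ha => ?_, fun p hp a b ha hab => ?_⟩
  · linarith [bdd p hp a ha]
  · rcases le_total a 1 with ha1 | ha1
    · have h1 := bdd p hp a ha.le
      have h2 := bdd p hp b (ha.le.trans hab)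
      have h3 : 1 ≤ a ^ (-(1 / 4) : ℝ) := Real.one_le_rpow_of_pos_of_le_one_of_nonpos ha ha1
        (by norm_num)
      calc _ ≤ ‖timeInt q B p b‖ + ‖timeInt q B p a‖ := norm_sub_le _ _
        _ ≤ 2 * (C₁ + C₂) * 1 := by linarith
        _ ≤ _ := by gcongr
    · calc _ ≤ C₂ * a ^ (-(1 / 2) : ℝ) := hC₂ p hp a b ha1 hab
        _ ≤ C₂ * a ^ (-(1 / 4) : ℝ) := by
          exact mul_le_mul_of_nonneg_left
            (Real.rpow_le_rpow_of_exponent_le ha1 (by norm_num)) hC₂0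
        _ ≤ _ := by
          gcongr
          linarith

/-- The time integrals converge as the parameters converge and time tends to infinity. -/
lemma IsPhaseFamily.exists_timeInt_limit (h : IsPhaseFamily K β q v w) (hB : IsAmplitude β B)
    {p₀ : Param} (hp₀ : p₀ ∈ K) :
    ∃ L : ℂ, ∀ {ι : Type} (l : Filter ι) (p : ι → Param) (Θ : ι → ℝ), (∀ᶠ i in l, p i ∈ K) →
      Tendsto p l (𝓝 p₀) → Tendsto Θ l atTop →
        Tendsto (fun i => timeInt q B (p i) (Θ i)) l (𝓝 L) := by
  obtain ⟨C, hC0, -, hC⟩ := h.exists_timeInt_bounds hB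
  have hlim : Tendsto (fun T : ℝ => C * T ^ (-(1 / 4) : ℝ)) atTop (𝓝 0) := by
    simpa using (tendsto_rpow_neg_atTop (y := 1 / 4) (by norm_num)).const_mul C
  have hcau : CauchySeq fun T : ℝ => timeInt q B p₀ T := by
    rw [Metric.cauchySeq_iff']
    intro ε hε
    obtain ⟨T, hT1, hT⟩ := ((eventually_gt_atTop 0).and (hlim.eventually_lt_const hε)).exists
    exact ⟨T, fun b hb => by rw [dist_eq_norm]; exact (hC p₀ hp₀ T b hT1 hb).trans_lt hT⟩
  obtain ⟨L, hL⟩ := cauchySeq_tendsto_of_complete hcau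
  refine ⟨L, fun {ι} l p Θ hpK hp hΘ => ?_⟩
  rw [Metric.tendsto_nhds]
  intro ε hε
  -- A fixed cutoff time `T`: the tail beyond `T` is small uniformly in the parameter, while up to
  -- `T` the integral is continuous in the parameter.
  obtain ⟨T, hT1, hT, hTL⟩ := ((eventually_gt_atTop 0).and
    ((hlim.eventually_lt_const (by positivity : 0 < ε / 3)).and
      (hL.eventually (Metric.ball_mem_nhds L (by positivity : 0 < ε / 3))))).exists
  have hcont := ((continuous_timeInt h hB T).tendsto p₀).comp hp
  filter_upwards [hpK, hΘ.eventually_ge_atTop T,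
    hcont.eventually (Metric.ball_mem_nhds _ (by positivity : 0 < ε / 3))] with i hi1 hi2 hi3
  have h1 := hC (p i) hi1 T (Θ i) hT1 hi2
  rw [← dist_eq_norm] at h1
  have hi3' : dist (timeInt q B (p i) T) (timeInt q B p₀ T) < ε / 3 := hi3
  have hTL' : dist (timeInt q B p₀ T) L < ε / 3 := hTL
  calc _ ≤ dist (timeInt q B (p i) (Θ i)) (timeInt q B (p i) T)
        + dist (timeInt q B (p i) T) (timeInt q B p₀ T) + dist (timeInt q B p₀ T) L :=
        dist_triangle4 _ _ _ _
    _ < ε := by linarith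

end

/-! ### The resonant phase and its scaling limit -/

open scoped Topology RealInnerProductSpace

/-- `√(1 + k|x|²)`. -/
def jap (k : ℝ) (x : Plane) : ℝ := Real.sqrt (1 + k * ‖x‖ ^ 2)

/-- The phase `2√(1 + (k/2)|ξ + μ|²) - √(1 + k|ξ|²) - √(1 + k|μ|²)`. -/
def phase (k : ℝ) (ξ μ : Plane) : ℝ := 2 * jap (k / 2) (ξ + μ) - jap k ξ - jap k μ

/-- The phase at `(l³a, lb)`, divided by `l⁴`. -/
def scaledPhase (k l : ℝ) (a b : Plane) : ℝ :=
  (k ^ 2 * (l ^ 4 * ‖a‖ ^ 2 - ‖b‖ ^ 2) ^ 2 / (jap k (l ^ 3 • a) + jap k (l • b)) ^ 2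
    + 4 * k * ⟪a, b⟫) / (2 * jap (k / 2) (l ^ 3 • a + l • b) + jap k (l ^ 3 • a) + jap k (l • b))

section phase

variable {k : ℝ}

lemma one_le_jap (hk : 0 ≤ k) (x : Plane) : 1 ≤ jap k x := by
  unfold jap
  have : 0 ≤ k * ‖x‖ ^ 2 := by positivity
  rw [Real.one_le_sqrt]
  linarith

lemma jap_pos (hk : 0 ≤ k) (x : Plane) : 0 < jap k x := zero_lt_one.trans_le (one_le_jap hk x)

lemma jap_sq (hk : 0 ≤ k) (x : Plane) : jap k x ^ 2 = 1 + k * ‖x‖ ^ 2 :=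
  Real.sq_sqrt (by positivity)

lemma contDiff_jap (hk : 0 ≤ k) : ContDiff ℝ ∞ (jap k) := by
  unfold jap
  refine ContDiff.sqrt (contDiff_const.add (contDiff_const.mul (contDiff_norm_sq ℝ))) fun x => ?_
  positivity

lemma continuous_jap (k : ℝ) : Continuous (jap k) := by
  unfold jap; fun_prop

lemma continuous_phase (k : ℝ) : Continuous fun x : Plane × Plane => phase k x.1 x.2 := by
  have := continuous_jap k
  have := continuous_jap (k / 2)
  unfold phase; fun_prop

/-- A factorization of the phase. -/
lemma phase_mul (hk : 0 ≤ k) (ξ μ : Plane) :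
    phase k ξ μ * (2 * jap (k / 2) (ξ + μ) + jap k ξ + jap k μ)
      = k ^ 2 * (‖ξ‖ ^ 2 - ‖μ‖ ^ 2) ^ 2 / (jap k ξ + jap k μ) ^ 2 + 4 * k * ⟪ξ, μ⟫ := by
  have h1 := jap_sq hk ξ
  have h2 := jap_sq hk μ
  have h3 := jap_sq (by positivity : 0 ≤ k / 2) (ξ + μ)
  have h4 := norm_add_sq_real ξ μ
  have h5 := jap_pos hk ξ
  have h6 := jap_pos hk μ
  have h7 : k * (‖ξ‖ ^ 2 - ‖μ‖ ^ 2) = (jap k ξ - jap k μ) * (jap k ξ + jap k μ) := by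
    linear_combination h2 - h1
  have h8 : k ^ 2 * (‖ξ‖ ^ 2 - ‖μ‖ ^ 2) ^ 2 / (jap k ξ + jap k μ) ^ 2
      = (jap k ξ - jap k μ) ^ 2 := by
    rw [← mul_pow, h7]
    field_simp
  rw [h8]
  unfold phase
  rw [h4] at h3
  linear_combination 4 * h3 - 2 * h1 - 2 * h2

/-- The weights `l³` and `l` are those for which `|μ|⁴` and `⟪ξ, μ⟫` have the same homogeneity `l⁴`.
-/
lemma phase_scaled (hk : 0 ≤ k) (l : ℝ) (a b : Plane) :
    phase k (l ^ 3 • a) (l • b) = l ^ 4 * scaledPhase k l a b := by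
  have h := phase_mul hk (l ^ 3 • a) (l • b)
  have h1 := jap_pos hk (l ^ 3 • a)
  have h2 := jap_pos hk (l • b)
  have h3 := jap_pos (by positivity : 0 ≤ k / 2) (l ^ 3 • a + l • b)
  have h4 : 0 < 2 * jap (k / 2) (l ^ 3 • a + l • b) + jap k (l ^ 3 • a) + jap k (l • b) := by
    positivity
  unfold scaledPhase
  rw [mul_div_assoc', eq_div_iff h4.ne', h]
  simp only [norm_smul, inner_smul_left, inner_smul_right, Real.norm_eq_abs, mul_pow, sq_abs]
  simp
  field_simp

/-- Smoothness across `l = 0` is the reason for defining `scaledPhase` by the factorized formula and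
not as a quotient by `l⁴`. It lets the limit problem belong to the same compact family. -/
lemma contDiff_scaledPhase (hk : 0 ≤ k) :
    ContDiff ℝ ∞ fun x : ℝ × Plane × Plane => scaledPhase k x.1 x.2.1 x.2.2 := by
  have hl : ContDiff ℝ ∞ fun x : ℝ × Plane × Plane => x.1 := contDiff_fst
  have ha : ContDiff ℝ ∞ fun x : ℝ × Plane × Plane => x.2.1 := contDiff_fst.comp contDiff_snd
  have hb : ContDiff ℝ ∞ fun x : ℝ × Plane × Plane => x.2.2 := contDiff_snd.comp contDiff_snd
  have hla := (hl.pow 3).smul ha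
  have hlb := hl.smul hb
  have j1 := (contDiff_jap hk).comp hla
  have j2 := (contDiff_jap hk).comp hlb
  have j3 := (contDiff_jap (by positivity : 0 ≤ k / 2)).comp (hla.add hlb)
  unfold scaledPhase
  refine ContDiff.div (ContDiff.add (ContDiff.div ?_ ((j1.add j2).pow 2) ?_) ?_)
    (((contDiff_const.mul j3).add j1).add j2) ?_
  · exact contDiff_const.mul ((((hl.pow 4).mul (ha.norm_sq ℝ)).sub (hb.norm_sq ℝ)).pow 2)
  · intro x
    have := jap_pos hk (x.1 ^ 3 • x.2.1)
    have := jap_pos hk (x.1 • x.2.2)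
    positivity
  · exact contDiff_const.mul (ha.inner ℝ hb)
  · intro x
    have := jap_pos hk (x.1 ^ 3 • x.2.1)
    have := jap_pos hk (x.1 • x.2.2)
    have := jap_pos (by positivity : 0 ≤ k / 2) (x.1 ^ 3 • x.2.1 + x.1 • x.2.2)
    positivity

lemma scaledPhase_zero (k : ℝ) (a b : Plane) :
    scaledPhase k 0 a b = k ^ 2 / 16 * ‖b‖ ^ 4 + k * ⟪a, b⟫ := by
  simp [scaledPhase, jap]
  ring

end phase

/-- The first basis vector. -/
def e₀ : Plane := EuclideanSpace.single 0 1

/-- The second basis vector. -/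
def e₁ : Plane := EuclideanSpace.single 1 1

lemma inner_e₀ (b : Plane) : ⟪b, e₀⟫ = b 0 := by
  simp [e₀, PiLp.inner_apply]

lemma inner_e₁ (b : Plane) : ⟪b, e₁⟫ = b 1 := by
  simp [e₁, PiLp.inner_apply]

@[simp] lemma norm_e₀ : ‖e₀‖ = 1 := by simp [e₀]

lemma plane_norm_sq (b : Plane) : ‖b‖ ^ 2 = b 0 ^ 2 + b 1 ^ 2 := by
  rw [EuclideanSpace.norm_sq_eq]; simp

/-- The family of scaled phases at `a = h e₀`, with the parameters `(l, h)`. -/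
def phaseFamily (k : ℝ) : Param × Plane → ℝ := fun x => scaledPhase k x.1.1 (x.1.2 • e₀) x.2

lemma contDiff_phaseFamily {k : ℝ} (hk : 0 ≤ k) : ContDiff ℝ ∞ (phaseFamily k) := by
  have h : ContDiff ℝ ∞ fun x : Param × Plane => (x.1.1, x.1.2 • e₀, x.2) :=
    (contDiff_fst.comp contDiff_fst).prodMk
      (((contDiff_snd.comp contDiff_fst).smul contDiff_const).prodMk contDiff_snd)
  have h1 : phaseFamily k = (fun x : ℝ × Plane × Plane => scaledPhase k x.1 x.2.1 x.2.2) ∘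
      fun x : Param × Plane => (x.1.1, x.1.2 • e₀, x.2) := rfl
  rw [h1]
  exact (contDiff_scaledPhase hk).comp h

lemma phaseFamily_zero (k h : ℝ) (b : Plane) :
    phaseFamily k ((0, h), b) = k ^ 2 / 16 * ‖b‖ ^ 4 + k * h * b 0 := by
  rw [phaseFamily, scaledPhase_zero, real_inner_smul_left, real_inner_comm, inner_e₀]
  ring

lemma hasDerivAt_norm_add_smul_sq (b v : Plane) :
    HasDerivAt (fun t : ℝ => ‖b + t • v‖ ^ 2) (2 * ⟪b, v⟫) 0 := by
  have h : HasDerivAt (fun t : ℝ => b + t • v) v 0 := by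
    simpa using ((hasDerivAt_id (0 : ℝ)).smul_const v).const_add b
  simpa using h.norm_sq

lemma hasDerivAt_add_smul_apply (b v : Plane) (i : Fin 2) :
    HasDerivAt (fun t : ℝ => (b + t • v) i) (v i) 0 := by
  simpa using ((hasDerivAt_id (0 : ℝ)).mul_const (v i)).const_add (b i)

lemma sliceDeriv_phaseFamily_zero {k : ℝ} (hk : 0 ≤ k) (h : ℝ) (b v : Plane) :
    sliceDeriv v (phaseFamily k) ((0, h), b) = k ^ 2 / 4 * ‖b‖ ^ 2 * ⟪b, v⟫ + k * h * v 0 := by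
  have h1 := hasLineDerivAt_slice (v := v) (contDiff_phaseFamily hk) (0, h) b
  unfold HasLineDerivAt at h1
  simp only [phaseFamily_zero] at h1
  have h2 := ((((hasDerivAt_norm_add_smul_sq b v).pow 2).const_mul (k ^ 2 / 16)).add
    ((hasDerivAt_add_smul_apply b v 0).const_mul (k * h)))
  have h3 : (fun t : ℝ => k ^ 2 / 16 * ‖b + t • v‖ ^ 4 + k * h * (b + t • v) 0)
      = (fun t : ℝ => k ^ 2 / 16 * ((fun t : ℝ => ‖b + t • v‖ ^ 2) ^ 2) t)
        + fun t : ℝ => k * h * (b + t • v) 0 := by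
    ext t
    simp only [Pi.add_apply, Pi.pow_apply]
    ring
  rw [h3] at h1
  rw [h1.unique h2]
  simp; ring

lemma sliceDeriv_sliceDeriv_phaseFamily_zero {k : ℝ} (hk : 0 ≤ k) (h : ℝ) (b v : Plane) :
    sliceDeriv v (sliceDeriv v (phaseFamily k)) ((0, h), b)
      = k ^ 2 / 4 * (2 * ⟪b, v⟫ ^ 2 + ‖b‖ ^ 2 * ‖v‖ ^ 2) := by
  have h1 := hasLineDerivAt_slice (v := v) (contDiff_sliceDeriv (v := v)
    (contDiff_phaseFamily hk)) (0, h) b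
  unfold HasLineDerivAt at h1
  simp only [sliceDeriv_phaseFamily_zero hk] at h1
  have h0 : HasDerivAt (fun t : ℝ => ⟪b + t • v, v⟫) (‖v‖ ^ 2) 0 := by
    have := ((hasDerivAt_id (0 : ℝ)).mul_const ⟪v, v⟫).const_add ⟪b, v⟫
    rw [one_mul, real_inner_self_eq_norm_sq] at this
    simpa [inner_add_left, inner_smul_left] using this
  have h2 := ((((hasDerivAt_norm_add_smul_sq b v).const_mul (k ^ 2 / 4)).mul h0).add_const
    (k * h * v 0))
  have h3 := h1.unique h2
  rw [h3]
  simp; ring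

/-- The set where the scaled phases are nondegenerate. -/
def goodSet : Set (ℝ × Plane) :=
  (Set.Icc 0 1 ×ˢ Metric.closedBall 0 4) ∩ {x | x.1 = 1 ∨ 1 / 4 ≤ ‖x.2‖}

lemma isCompact_goodSet : IsCompact goodSet := by
  refine (isCompact_Icc.prod (isCompact_closedBall _ _)).inter_right ?_
  exact (isClosed_eq continuous_fst continuous_const).union
    (isClosed_le continuous_const (continuous_norm.comp continuous_snd))

/-- Euler's identity: with `q = (k²/16)|b|⁴ + k h b₀`, one has `b · ∇q - q = (3k²/16)|b|⁴`. A
critical zero thus forces `b = 0`, and then `∂₀q = k h = 0` forces `h = 0`, which the hypothesis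
excludes. -/
lemma noncritical_zero {k : ℝ} (hk : 0 < k) {h : ℝ} {b : Plane} (hhb : h = 1 ∨ 1 / 4 ≤ ‖b‖) :
    0 < phaseFamily k ((0, h), b) ^ 2 + sliceDeriv e₀ (phaseFamily k) ((0, h), b) ^ 2
      + sliceDeriv e₁ (phaseFamily k) ((0, h), b) ^ 2 := by
  by_contra hcon
  have h1 := sq_nonneg (phaseFamily k ((0, h), b))
  have h2 := sq_nonneg (sliceDeriv e₀ (phaseFamily k) ((0, h), b))
  have h3 := sq_nonneg (sliceDeriv e₁ (phaseFamily k) ((0, h), b))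
  have q0 : phaseFamily k ((0, h), b) = 0 := by
    apply pow_eq_zero_iff (two_ne_zero) |>.1; linarith
  have q1 : sliceDeriv e₀ (phaseFamily k) ((0, h), b) = 0 := by
    apply pow_eq_zero_iff (two_ne_zero) |>.1; linarith
  have q2 : sliceDeriv e₁ (phaseFamily k) ((0, h), b) = 0 := by
    apply pow_eq_zero_iff (two_ne_zero) |>.1; linarith
  rw [phaseFamily_zero] at q0
  rw [sliceDeriv_phaseFamily_zero hk.le] at q1 q2
  rw [inner_e₀, show e₀ 0 = 1 by simp [e₀], mul_one] at q1
  rw [inner_e₁, show e₁ 0 = 0 by simp [e₁], mul_zero, add_zero] at q2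
  have hb : ‖b‖ ^ 4 = 0 := by
    have e : ‖b‖ ^ 4 = ‖b‖ ^ 2 * (b 0 ^ 2 + b 1 ^ 2) := by rw [← plane_norm_sq]; ring
    have q1' := congrArg (· * b 0) q1
    have q2'' := congrArg (· * b 1) q2
    simp only [zero_mul] at q1' q2''
    have : k ^ 2 * (3 * ‖b‖ ^ 4) = 0 := by
      linear_combination 16 * q1' + 16 * q2'' - 16 * q0 + 4 * k ^ 2 * e
    have hk2 : k ^ 2 ≠ 0 := by positivity
    have := (mul_eq_zero.1 this).resolve_left hk2
    linarith
  have hb0 : b = 0 := by simpa using hb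
  subst hb0
  simp [hk.ne'] at q1
  rcases hhb with h0 | h0
  · rw [q1] at h0; norm_num at h0
  · norm_num at h0

/-- The quartic is strictly convex along `e₀` except at `b = 0`, where its Hessian degenerates.
There `h = 1`, and the first derivative `k h` supplies positivity. -/
lemma convex_zero {k : ℝ} (hk : 0 < k) {h : ℝ} {b : Plane} (hhb : h = 1 ∨ 1 / 4 ≤ ‖b‖) :
    0 < sliceDeriv e₀ (sliceDeriv e₀ (phaseFamily k)) ((0, h), b)
      + sliceDeriv e₀ (phaseFamily k) ((0, h), b) ^ 2 := by
  rw [sliceDeriv_sliceDeriv_phaseFamily_zero hk.le, norm_e₀]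
  by_cases hb : b = 0
  · subst hb
    rcases hhb with h0 | h0
    · rw [sliceDeriv_phaseFamily_zero hk.le, h0]
      simp [e₀]
      positivity
    · norm_num at h0
  · have : 0 < ‖b‖ := norm_pos_iff.2 hb
    positivity

/-- The scaled phases are nondegenerate for small `l`. -/
lemma exists_nondegenerate {k : ℝ} (hk : 0 < k) :
    ∃ l₀ : ℝ, 0 < l₀ ∧ l₀ ≤ 1 ∧ ∀ l ∈ Set.Icc 0 l₀, ∀ x ∈ goodSet,
      0 < phaseFamily k ((l, x.1), x.2) ^ 2 + sliceDeriv e₀ (phaseFamily k) ((l, x.1), x.2) ^ 2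
        + sliceDeriv e₁ (phaseFamily k) ((l, x.1), x.2) ^ 2 ∧
      0 < sliceDeriv e₀ (sliceDeriv e₀ (phaseFamily k)) ((l, x.1), x.2)
        + sliceDeriv e₀ (phaseFamily k) ((l, x.1), x.2) ^ 2 := by
  have c0 : Continuous (phaseFamily k) := (contDiff_phaseFamily hk.le).continuous
  have c1 : Continuous (sliceDeriv e₀ (phaseFamily k)) :=
    (contDiff_sliceDeriv (contDiff_phaseFamily hk.le)).continuous
  have c2 : Continuous (sliceDeriv e₁ (phaseFamily k)) :=
    (contDiff_sliceDeriv (contDiff_phaseFamily hk.le)).continuous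
  have c3 : Continuous (sliceDeriv e₀ (sliceDeriv e₀ (phaseFamily k))) :=
    (contDiff_sliceDeriv (contDiff_sliceDeriv (contDiff_phaseFamily hk.le))).continuous
  -- Tube lemma: the strict inequalities hold at `l = 0` on a compact set, hence for all small `l`.
  have ev := isCompact_goodSet.eventually_forall_of_forall_eventually (x₀ := (0 : ℝ))
    (P := fun l x => 0 < phaseFamily k ((l, x.1), x.2) ^ 2
        + sliceDeriv e₀ (phaseFamily k) ((l, x.1), x.2) ^ 2
        + sliceDeriv e₁ (phaseFamily k) ((l, x.1), x.2) ^ 2 ∧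
      0 < sliceDeriv e₀ (sliceDeriv e₀ (phaseFamily k)) ((l, x.1), x.2)
        + sliceDeriv e₀ (phaseFamily k) ((l, x.1), x.2) ^ 2) (by
      intro x hx
      refine Filter.Eventually.and ?_ ?_
      · refine ContinuousAt.eventually_lt continuousAt_const
          (Continuous.continuousAt (by fun_prop)) (noncritical_zero hk hx.2)
      · refine ContinuousAt.eventually_lt continuousAt_const
          (Continuous.continuousAt (by fun_prop)) (convex_zero hk hx.2))
  obtain ⟨r, hr, hball⟩ := Metric.eventually_nhds_iff.1 ev
  refine ⟨min (r / 2) 1, by positivity, min_le_right _ _, fun l hl x hx => hball ?_ x hx⟩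
  rw [Real.dist_eq, sub_zero, abs_of_nonneg hl.1]
  linarith [hl.2, min_le_left (r / 2) 1]

/-! ### Cutoffs to a ball and to an annulus -/

/-- A radial cutoff, which is `1` on `|b| ≤ 1` and vanishes on `|b| ≥ √2`. -/
def cut (b : Plane) : ℝ := Real.smoothTransition (2 - ‖b‖ ^ 2)

lemma contDiff_cut : ContDiff ℝ ∞ cut :=
  Real.smoothTransition.contDiff.comp (contDiff_const.sub (contDiff_norm_sq ℝ))

lemma cut_eq_one {b : Plane} (hb : ‖b‖ ≤ 1) : cut b = 1 :=
  Real.smoothTransition.one_of_one_le (by nlinarith [norm_nonneg b])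

lemma cut_eq_zero {b : Plane} (hb : 2 ≤ ‖b‖ ^ 2) : cut b = 0 :=
  Real.smoothTransition.zero_of_nonpos (by linarith)

lemma cut_nonneg (b : Plane) : 0 ≤ cut b := Real.smoothTransition.nonneg _

lemma cut_le_one (b : Plane) : cut b ≤ 1 := Real.smoothTransition.le_one _

/-- A cutoff to an annulus. -/
def cutAnn (b : Plane) : ℝ := cut b - cut ((2 : ℝ) • b)

/-- A cutoff to a larger ball. -/
def wideCut (b : Plane) : ℝ := cut ((1 / 2 : ℝ) • b)

/-- A cutoff to a larger annulus. -/
def wideCutAnn (b : Plane) : ℝ := cut ((1 / 2 : ℝ) • b) * (1 - cut ((4 : ℝ) • b))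

lemma contDiff_cut_smul (c : ℝ) : ContDiff ℝ ∞ fun b : Plane => cut (c • b) :=
  contDiff_cut.comp (contDiff_const_smul c)

lemma contDiff_cutAnn : ContDiff ℝ ∞ cutAnn := contDiff_cut.sub (contDiff_cut_smul 2)

lemma contDiff_wideCut : ContDiff ℝ ∞ wideCut := contDiff_cut_smul _

lemma contDiff_wideCutAnn : ContDiff ℝ ∞ wideCutAnn :=
  (contDiff_cut_smul _).mul (contDiff_const.sub (contDiff_cut_smul _))

/-- `wideCut` plays the role of `β` for amplitudes cut off by `cut`; similarly `wideCutAnn` for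
`cutAnn`. -/
lemma wideCut_eq_one {b : Plane} (hb : cut b ≠ 0) : wideCut b = 1 := by
  apply cut_eq_one
  have h : ‖b‖ ^ 2 < 2 := by
    by_contra hcon
    exact hb (cut_eq_zero (not_lt.1 hcon))
  rw [norm_smul]; norm_num
  nlinarith [norm_nonneg b]

lemma wideCutAnn_eq_one {b : Plane} (hb : cutAnn b ≠ 0) : wideCutAnn b = 1 := by
  by_cases h1 : ‖b‖ ≤ 1 / 2
  · exfalso
    apply hb
    unfold cutAnn
    rw [cut_eq_one (by linarith), cut_eq_one (by rw [norm_smul]; norm_num; linarith), sub_self]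
  · have h0 : cut b ≠ 0 := by
      intro h0
      apply hb
      unfold cutAnn
      rw [h0, zero_sub, neg_eq_zero]
      apply cut_eq_zero
      by_contra hcon
      have h2 : ‖b‖ ≤ 1 := by
        rw [norm_smul] at hcon; norm_num at hcon
        nlinarith [norm_nonneg b]
      rw [cut_eq_one h2] at h0
      exact one_ne_zero h0
    have h2 : cut ((4 : ℝ) • b) = 0 := by
      apply cut_eq_zero
      rw [norm_smul]; norm_num
      nlinarith [norm_nonneg b]
    have h3 := wideCut_eq_one h0
    unfold wideCut at h3
    unfold wideCutAnn
    rw [h2, h3]; norm_num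

lemma tsupport_wideCut : tsupport wideCut ⊆ Metric.closedBall 0 4 := by
  refine closure_minimal (fun b hb => ?_) Metric.isClosed_closedBall
  rw [mem_closedBall_zero_iff]
  by_contra hcon
  apply hb
  apply cut_eq_zero
  rw [norm_smul]; norm_num
  nlinarith

lemma tsupport_wideCutAnn :
    tsupport wideCutAnn ⊆ Metric.closedBall 0 4 ∩ {b | 1 / 4 ≤ ‖b‖} := by
  refine closure_minimal (fun b hb => ⟨?_, ?_⟩) (Metric.isClosed_closedBall.inter
    (isClosed_le continuous_const continuous_norm))
  · exact tsupport_wideCut (subset_tsupport _ fun h => hb (by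
      unfold wideCut at h; simp only [wideCutAnn, h, zero_mul]))
  · by_contra hcon
    apply hb
    unfold wideCutAnn
    rw [cut_eq_one (b := (4 : ℝ) • b), sub_self, mul_zero]
    rw [norm_smul]; norm_num
    simp only [Set.mem_ofPred_eq, not_le] at hcon
    linarith

/-- Two families of nondegenerate phases, on a ball and on an annulus. -/
lemma exists_phaseFamily {k : ℝ} (hk : 0 < k) :
    ∃ l₀ : ℝ, 0 < l₀ ∧ l₀ ≤ 1 ∧
      IsPhaseFamily (Set.Icc 0 l₀ ×ˢ {1}) wideCut (phaseFamily k) e₀ e₁ ∧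
      IsPhaseFamily (Set.Icc 0 l₀ ×ˢ Set.Icc 0 1) wideCutAnn (phaseFamily k) e₀ e₁ := by
  obtain ⟨l₀, h0, h1, hnd⟩ := exists_nondegenerate hk
  have key : ∀ l h b, l ∈ Set.Icc 0 l₀ → (h, b) ∈ goodSet →
      (phaseFamily k ((l, h), b) ≠ 0 ∨ sliceDeriv e₀ (phaseFamily k) ((l, h), b) ≠ 0 ∨
        sliceDeriv e₁ (phaseFamily k) ((l, h), b) ≠ 0) ∧
      0 < sliceDeriv e₀ (sliceDeriv e₀ (phaseFamily k)) ((l, h), b)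
        + sliceDeriv e₀ (phaseFamily k) ((l, h), b) ^ 2 := by
    intro l h b hl hx
    refine ⟨?_, (hnd l hl (h, b) hx).2⟩
    by_contra hcon
    push Not at hcon
    have := (hnd l hl (h, b) hx).1
    simp [hcon.1, hcon.2.1, hcon.2.2] at this
  have g1 : ∀ b ∈ tsupport wideCut, ((1 : ℝ), b) ∈ goodSet := fun b hb =>
    ⟨⟨⟨zero_le_one, le_rfl⟩, tsupport_wideCut hb⟩, Or.inl rfl⟩
  have g2 : ∀ h ∈ Set.Icc (0 : ℝ) 1, ∀ b ∈ tsupport wideCutAnn, (h, b) ∈ goodSet := fun h hh b hb =>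
    ⟨⟨hh, (tsupport_wideCutAnn hb).1⟩, Or.inr (tsupport_wideCutAnn hb).2⟩
  refine ⟨l₀, h0, h1, ⟨isCompact_Icc.prod isCompact_singleton, contDiff_wideCut, ?_,
    fun b => cut_nonneg _, contDiff_phaseFamily hk.le, ?_, ?_⟩,
    ⟨isCompact_Icc.prod isCompact_Icc, contDiff_wideCutAnn, ?_, fun b => ?_,
    contDiff_phaseFamily hk.le, ?_, ?_⟩⟩
  · exact HasCompactSupport.of_support_subset_isCompact (isCompact_closedBall 0 4)
      ((subset_tsupport _).trans tsupport_wideCut)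
  · rintro ⟨l, h⟩ ⟨hl, hh⟩ b hb
    simp only [Set.mem_singleton_iff] at hh
    subst hh
    exact (key l 1 b hl (g1 b hb)).1
  · rintro ⟨l, h⟩ ⟨hl, hh⟩ b hb
    simp only [Set.mem_singleton_iff] at hh
    subst hh
    exact (key l 1 b hl (g1 b hb)).2
  · exact HasCompactSupport.of_support_subset_isCompact (isCompact_closedBall 0 4)
      ((subset_tsupport _).trans (tsupport_wideCutAnn.trans Set.inter_subset_left))
  · exact mul_nonneg (cut_nonneg _) (sub_nonneg.2 (cut_le_one _))
  · rintro ⟨l, h⟩ ⟨hl, hh⟩ b hb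
    exact (key l h b hl (g2 h hh b hb)).1
  · rintro ⟨l, h⟩ ⟨hl, hh⟩ b hb
    exact (key l h b hl (g2 h hh b hb)).2

/-! ### First-generation profiles: dyadic decomposition and uniform bounds -/

/-- Smooth radial nonnegative functions which are positive at the origin and vanish outside the
ball of radius `δ`. -/
structure IsProfile (δ : ℝ) (a : Plane → ℝ) : Prop where
  smooth : ContDiff ℝ ∞ a
  radial : ∀ x y, ‖x‖ = ‖y‖ → a x = a y
  nonneg : ∀ x, 0 ≤ a x
  pos : 0 < a 0
  eq_zero : ∀ x, δ ≤ ‖x‖ → a x = 0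

/-- `∫ exp(-iτ phase(ξ, μ)) a(ξ + μ) b(μ) dμ`. -/
def source (k : ℝ) (a b : Plane → ℝ) (τ : ℝ) (ξ : Plane) : ℂ :=
  ∫ μ : Plane, Complex.exp (-Complex.I * τ * phase k ξ μ) * ((a (ξ + μ) * b μ : ℝ) : ℂ)

/-- The profile produced by the source up to the time `s`. -/
def prof (k : ℝ) (a b : Plane → ℝ) (s : ℝ) (ξ : Plane) : ℂ :=
  ∫ τ in (0 : ℝ)..s, source k a b τ ξ

/-- The scaled amplitude with the cutoff `χ`. -/
def ampl (a b χ : Plane → ℝ) : Param × Plane → ℂ := fun x =>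
  ((χ x.2 * (a ((x.1.1 ^ 3 * x.1.2) • e₀ + x.1.1 • x.2) * b (x.1.1 • x.2)) : ℝ) : ℂ)

section

variable {k δ l₀ : ℝ} {a b χ β : Plane → ℝ}

lemma IsProfile.hasCompactSupport (hb : IsProfile δ b) : HasCompactSupport b :=
  HasCompactSupport.intro (isCompact_closedBall 0 δ) fun x hx =>
    hb.eq_zero x (by simp at hx; exact hx.le)

lemma contDiff_ampl (ha : ContDiff ℝ ∞ a) (hb : ContDiff ℝ ∞ b) (hχ : ContDiff ℝ ∞ χ) :
    ContDiff ℝ ∞ (ampl a b χ) := by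
  have h1 : ContDiff ℝ ∞ fun x : Param × Plane => x.1.1 := contDiff_fst.comp contDiff_fst
  have h2 : ContDiff ℝ ∞ fun x : Param × Plane => x.1.2 := contDiff_snd.comp contDiff_fst
  have h3 : ContDiff ℝ ∞ fun x : Param × Plane => x.2 := contDiff_snd
  have h4 : ContDiff ℝ ∞ fun x : Param × Plane => (x.1.1 ^ 3 * x.1.2) • e₀ + x.1.1 • x.2 :=
    (((h1.pow 3).mul h2).smul contDiff_const).add (h1.smul h3)
  exact Complex.ofRealCLM.contDiff.comp
    ((hχ.comp h3).mul ((ha.comp h4).mul (hb.comp (h1.smul h3))))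

lemma isAmplitude_ampl (ha : ContDiff ℝ ∞ a) (hb : ContDiff ℝ ∞ b) (hχ : ContDiff ℝ ∞ χ)
    (hβ : ∀ x, χ x ≠ 0 → β x = 1) : IsAmplitude β (ampl a b χ) :=
  ⟨contDiff_ampl ha hb hχ, fun x hx => by
    have : χ x.2 = 0 := by by_contra h; exact hx (hβ _ h)
    simp [ampl, this]⟩

/-- The substitution `μ = l b`: the Jacobian gives `l²`, and the phase gives the slow time `τ l⁴`.
-/
lemma integral_scaled (hk : 0 ≤ k) (a b χ : Plane → ℝ) {l : ℝ} (hl : 0 < l) (h τ : ℝ) :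
    ∫ μ : Plane, Complex.exp (-Complex.I * τ * phase k ((l ^ 3 * h) • e₀) μ) *
      ((χ (l⁻¹ • μ) * (a ((l ^ 3 * h) • e₀ + μ) * b μ) : ℝ) : ℂ)
      = (l ^ 2 : ℝ) * oscInt (phaseFamily k) (ampl a b χ) (l, h) (τ * l ^ 4) := by
  have key := Measure.integral_comp_smul (volume : Measure Plane) (fun μ : Plane =>
    Complex.exp (-Complex.I * τ * phase k ((l ^ 3 * h) • e₀) μ) *
      ((χ (l⁻¹ • μ) * (a ((l ^ 3 * h) • e₀ + μ) * b μ) : ℝ) : ℂ)) l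
  rw [finrank_euclideanSpace_fin, abs_of_pos (by positivity)] at key
  have h2 : ∀ μ : Plane, Complex.exp (-Complex.I * τ * phase k ((l ^ 3 * h) • e₀) (l • μ)) *
      ((χ (l⁻¹ • l • μ) * (a ((l ^ 3 * h) • e₀ + l • μ) * b (l • μ)) : ℝ) : ℂ)
      = Complex.exp (-Complex.I * (τ * l ^ 4 : ℝ) * phaseFamily k ((l, h), μ)) *
        ampl a b χ ((l, h), μ) := by
    intro μ
    rw [smul_smul l⁻¹ l μ, inv_mul_cancel₀ hl.ne', one_smul, ampl, mul_smul, phase_scaled hk,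
      phaseFamily]
    push_cast
    congr 2
    ring
  simp only [h2] at key
  unfold oscInt
  rw [key, Complex.real_smul, ← mul_assoc, ← Complex.ofReal_mul, mul_inv_cancel₀ (by positivity)]
  simp

lemma integrable_source (ha : Continuous a) (hb : Continuous b) (hcb : HasCompactSupport b)
    (hχ : Continuous χ) (l τ : ℝ) (ξ : Plane) :
    Integrable fun μ : Plane => Complex.exp (-Complex.I * τ * phase k ξ μ) *
      ((χ (l • μ) * (a (ξ + μ) * b μ) : ℝ) : ℂ) := by
  have h1 := continuous_phase k
  refine Continuous.integrable_of_hasCompactSupport (by fun_prop) ?_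
  refine HasCompactSupport.mul_left (HasCompactSupport.comp_left (g := fun x : ℝ => (x : ℂ)) ?_
    Complex.ofReal_zero)
  exact hcb.mul_left.mul_left

/-- Dyadic decomposition of the source. -/
lemma source_dyadic (hk : 0 ≤ k) (ha : IsProfile δ a) (hb : IsProfile δ b) {l : ℝ} (hl : 0 < l)
    {N : ℕ} (hN : δ ≤ 2 ^ N * l) (τ : ℝ) :
    source k a b τ (l ^ 3 • e₀)
      = (l ^ 2 : ℝ) * oscInt (phaseFamily k) (ampl a b cut) (l, 1) (τ * l ^ 4)
        + ∑ j ∈ Finset.range N, (((2 ^ (j + 1) * l) ^ 2 : ℝ) : ℂ) *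
          oscInt (phaseFamily k) (ampl a b cutAnn) (2 ^ (j + 1) * l, (8⁻¹) ^ (j + 1))
            (τ * (2 ^ (j + 1) * l) ^ 4) := by
  have hac := ha.smooth.continuous
  have hbc := hb.smooth.continuous
  -- On the annulus of scale `2^(j+1) l` the output frequency is still `l³`, which in the units of
  -- that scale is `h = 8^(-(j+1))`. This explains the range `h ∈ [0, 1]` in the annular family.
  have hr : ∀ j : ℕ, (2 ^ (j + 1) * l) ^ 3 * (8⁻¹ : ℝ) ^ (j + 1) = l ^ 3 := by
    intro j
    rw [mul_pow, ← pow_mul, mul_comm (j + 1) 3, pow_mul, inv_pow]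
    norm_num
    field_simp
  rw [← integral_scaled hk a b cut hl 1 τ]
  have e1 : ∀ j ∈ Finset.range N, (((2 ^ (j + 1) * l) ^ 2 : ℝ) : ℂ) *
          oscInt (phaseFamily k) (ampl a b cutAnn) (2 ^ (j + 1) * l, (8⁻¹) ^ (j + 1))
            (τ * (2 ^ (j + 1) * l) ^ 4)
      = ∫ μ : Plane, Complex.exp (-Complex.I * τ * phase k (l ^ 3 • e₀) μ) *
      ((cutAnn ((2 ^ (j + 1) * l)⁻¹ • μ) * (a (l ^ 3 • e₀ + μ) * b μ) : ℝ) : ℂ) := by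
    intro j _
    rw [← integral_scaled hk a b cutAnn (by positivity) _ τ, hr]
  rw [Finset.sum_congr rfl e1, mul_one, ← integral_finsetSum _ (fun j _ =>
    integrable_source hac hbc hb.hasCompactSupport contDiff_cutAnn.continuous _ τ _),
    ← integral_add (integrable_source hac hbc hb.hasCompactSupport contDiff_cut.continuous _ τ _)
    (integrable_finsetSum _ fun j _ =>
      integrable_source hac hbc hb.hasCompactSupport contDiff_cutAnn.continuous _ τ _)]
  unfold source
  congr 1; ext μ
  rw [← Finset.mul_sum, ← mul_add]
  congr 1
  rw [← Complex.ofReal_sum, ← Complex.ofReal_add]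
  congr 1
  rw [← Finset.sum_mul, ← add_mul]
  -- The annular cutoffs telescope; with the ball they sum to a cutoff at scale `2^N l`, which is
  -- `1` on the support of `b`.
  have tel : ∑ j ∈ Finset.range N, cutAnn ((2 ^ (j + 1) * l)⁻¹ • μ)
      = cut ((2 ^ N * l)⁻¹ • μ) - cut (l⁻¹ • μ) := by
    have : ∀ j : ℕ, cutAnn ((2 ^ (j + 1) * l)⁻¹ • μ)
        = cut ((2 ^ (j + 1) * l)⁻¹ • μ) - cut ((2 ^ j * l)⁻¹ • μ) := by
      intro j
      unfold cutAnn
      rw [smul_smul]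
      congr 3
      field_simp
      ring
    simp only [this]
    rw [Finset.sum_range_sub (fun j => cut ((2 ^ j * l)⁻¹ • μ))]
    simp
  rw [tel, add_sub_cancel]
  by_cases hμ : δ ≤ ‖μ‖
  · simp [hb.eq_zero μ hμ]
  · rw [cut_eq_one, one_mul]
    rw [norm_smul, norm_inv, Real.norm_of_nonneg (by positivity), inv_mul_le_iff₀ (by positivity)]
    linarith

/-- The profile in scaled variables. -/
def scaledProf (k : ℝ) (a b : Plane → ℝ) (l Θ : ℝ) : ℂ :=
  timeInt (phaseFamily k) (ampl a b cut) (l, 1) Θ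
    + ∑' j : ℕ, (((4 : ℝ)⁻¹ ^ (j + 1) : ℝ) : ℂ) * timeInt (phaseFamily k) (ampl a b cutAnn)
      (2 ^ (j + 1) * l, (8⁻¹) ^ (j + 1)) (16 ^ (j + 1) * Θ)

/-- `cutAnn` vanishes on `|x| ≤ 1/2`, so at scales `l ≥ 2δ` the annulus misses the support of `b`.
-/
lemma ampl_cutAnn_eq_zero (hb : IsProfile δ b) {l : ℝ} (hl : 0 < l) (hl' : 2 * δ ≤ l) (h : ℝ)
    (x : Plane) : ampl a b cutAnn ((l, h), x) = 0 := by
  by_cases hx : ‖x‖ ≤ 1 / 2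
  · have : cutAnn x = 0 := by
      unfold cutAnn
      rw [cut_eq_one (by linarith), cut_eq_one (by rw [norm_smul]; norm_num; linarith), sub_self]
    simp [ampl, this]
  · have : b (l • x) = 0 := by
      apply hb.eq_zero
      rw [norm_smul, Real.norm_of_nonneg hl.le]
      nlinarith
    simp [ampl, this]

lemma timeInt_cutAnn_eq_zero (hb : IsProfile δ b) {l : ℝ} (hl : 0 < l) (hl' : 2 * δ ≤ l)
    (h Θ : ℝ) : timeInt (phaseFamily k) (ampl a b cutAnn) (l, h) Θ = 0 := by
  simp [timeInt, oscInt, ampl_cutAnn_eq_zero hb hl hl']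

/-- A scale `r` contributes `r²` from the area and `r⁻⁴` from the change of time, hence `r⁻²` in
total. Relative to the ball, the annulus of scale `2^(j+1) l` has the weight `4^(-(j+1))`. The
series is a finite sum, since large annuli miss the support of `b`. -/
lemma prof_eq_scaledProf (hk : 0 < k) (ha : IsProfile δ a) (hb : IsProfile δ b) {l : ℝ}
    (hl : 0 < l) (s : ℝ) :
    prof k a b s (l ^ 3 • e₀) = ((l ^ 2)⁻¹ : ℝ) * scaledProf k a b l (s * l ^ 4) := by
  obtain ⟨l₀, -, -, hF, hFA⟩ := exists_phaseFamily hk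
  have hA := isAmplitude_ampl ha.smooth hb.smooth contDiff_cut (β := wideCut)
    (fun _ => wideCut_eq_one)
  have hAA := isAmplitude_ampl ha.smooth hb.smooth contDiff_cutAnn (β := wideCutAnn)
    (fun _ => wideCutAnn_eq_one)
  obtain ⟨N, hN⟩ : ∃ N : ℕ, 2 * δ ≤ 2 ^ N * l := by
    obtain ⟨N, hN⟩ := pow_unbounded_of_one_lt (2 * δ / l) (one_lt_two (α := ℝ))
    exact ⟨N, by rw [div_lt_iff₀ hl] at hN; linarith⟩
  have hδ : 0 ≤ δ := by
    by_contra h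
    have := hb.eq_zero 0 (by simp; linarith)
    exact hb.pos.ne' this
  have tsum_eq : ∑' j : ℕ, (((4 : ℝ)⁻¹ ^ (j + 1) : ℝ) : ℂ) *
      timeInt (phaseFamily k) (ampl a b cutAnn) (2 ^ (j + 1) * l, (8⁻¹) ^ (j + 1))
        (16 ^ (j + 1) * (s * l ^ 4))
      = ∑ j ∈ Finset.range N, (((4 : ℝ)⁻¹ ^ (j + 1) : ℝ) : ℂ) *
      timeInt (phaseFamily k) (ampl a b cutAnn) (2 ^ (j + 1) * l, (8⁻¹) ^ (j + 1))
        (16 ^ (j + 1) * (s * l ^ 4)) := by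
    refine tsum_eq_sum fun j hj => ?_
    rw [timeInt_cutAnn_eq_zero hb (by positivity), mul_zero]
    simp at hj
    refine hN.trans ?_
    gcongr
    · norm_num
    · omega
  have scale : ∀ (B : Param × Plane → ℂ) (p : Param) (r : ℝ), 0 < r →
      ∫ τ in (0 : ℝ)..s, ((r ^ 2 : ℝ) : ℂ) * oscInt (phaseFamily k) B p (τ * r ^ 4)
        = ((r ^ 2)⁻¹ : ℝ) * timeInt (phaseFamily k) B p (s * r ^ 4) := by
    intro B p r hr
    rw [intervalIntegral.integral_const_mul, intervalIntegral.integral_comp_mul_right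
      (fun τ => oscInt (phaseFamily k) B p τ) (by positivity : r ^ 4 ≠ 0), zero_mul,
      Complex.real_smul, ← mul_assoc, ← Complex.ofReal_mul, timeInt]
    congr 2
    field_simp
  have hIntg : ∀ (B : Param × Plane → ℂ) (p : Param) (r : ℝ),
      (Continuous fun x : Param × ℝ => oscInt (phaseFamily k) B x.1 x.2) →
      IntervalIntegrable (fun τ => ((r ^ 2 : ℝ) : ℂ) * oscInt (phaseFamily k) B p (τ * r ^ 4))
        volume 0 s := by
    intro B p r hB
    apply Continuous.intervalIntegrable
    have : Continuous fun τ : ℝ => oscInt (phaseFamily k) B p (τ * r ^ 4) :=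
      hB.comp (by fun_prop : Continuous fun τ : ℝ => (p, τ * r ^ 4))
    fun_prop
  have hsum : IntervalIntegrable (fun τ => ∑ j ∈ Finset.range N, (((2 ^ (j + 1) * l) ^ 2 : ℝ) : ℂ) *
      oscInt (phaseFamily k) (ampl a b cutAnn) (2 ^ (j + 1) * l, (8⁻¹) ^ (j + 1))
        (τ * (2 ^ (j + 1) * l) ^ 4)) volume 0 s := by
    simp only [← Finset.sum_fn]
    exact IntervalIntegrable.sum _ fun j _ => hIntg _ _ _ (continuous_oscInt hFA hAA)
  unfold prof scaledProf
  simp only [source_dyadic hk.le ha hb hl (N := N) (by linarith)]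
  rw [tsum_eq, intervalIntegral.integral_add (hIntg _ _ _ (continuous_oscInt hF hA))
    hsum,
    intervalIntegral.integral_finsetSum fun j _ => hIntg _ _ _ (continuous_oscInt hFA hAA),
    scale _ _ _ hl, mul_add, Finset.mul_sum]
  congr 1
  refine Finset.sum_congr rfl fun j _ => ?_
  rw [scale _ _ _ (by positivity), ← mul_assoc, ← Complex.ofReal_mul]
  have e1 : (2 : ℝ) ^ (j + 1) = 2 ^ (j + 1) := rfl
  have e4 : (4 : ℝ) ^ (j + 1) = (2 ^ (j + 1)) ^ 2 := by
    rw [← pow_mul, mul_comm, pow_mul]; norm_num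
  have e16 : (16 : ℝ) ^ (j + 1) = (2 ^ (j + 1)) ^ 4 := by
    rw [← pow_mul, mul_comm, pow_mul]; norm_num
  rw [inv_pow (4 : ℝ), e4, e16]
  congr 2
  · rw [mul_pow, mul_inv, mul_comm]
  · ring

/-- Each scale obeys estimates uniform in its parameters, and the weights `4^(-(j+1))` are summable;
the limit passes through the series by dominated convergence. The condition `2δ ≤ l₀` makes every
annulus of scale at least `l₀` contribute zero, so the phase families are used only for scales up to
`l₀`. The threshold `l₀` depends on `k` alone, which leaves the amplitude of the data free. -/
lemma scaledProf_bounds (hk : 0 < k) : ∃ l₀ : ℝ, 0 < l₀ ∧ l₀ ≤ 1 ∧ ∀ δ a b, 2 * δ ≤ l₀ →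
    IsProfile δ a → IsProfile δ b →
    ∃ (C : ℝ) (L : ℂ), 0 ≤ C ∧ (∀ l Θ, 0 < l → l ≤ l₀ → 0 ≤ Θ → ‖scaledProf k a b l Θ‖ ≤ C) ∧
      (∀ l Θ Θ', 0 < l → l ≤ l₀ → 0 < Θ → Θ ≤ Θ' →
        ‖scaledProf k a b l Θ' - scaledProf k a b l Θ‖ ≤ C * Θ ^ (-(1 / 4) : ℝ)) ∧
      ∀ {ι : Type} (F : Filter ι) (l Θ : ι → ℝ), (∀ᶠ i in F, 0 < l i) → Tendsto l F (𝓝 0) →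
        Tendsto Θ F atTop → Tendsto (fun i => scaledProf k a b (l i) (Θ i)) F (𝓝 L) := by
  obtain ⟨l₀, hl₀, hl₀1, hF, hFA⟩ := exists_phaseFamily hk
  refine ⟨l₀, hl₀, hl₀1, fun δ a b hδ ha hb => ?_⟩
  have hA := isAmplitude_ampl ha.smooth hb.smooth contDiff_cut (β := wideCut)
    (fun _ => wideCut_eq_one)
  have hAA := isAmplitude_ampl ha.smooth hb.smooth contDiff_cutAnn (β := wideCutAnn)
    (fun _ => wideCutAnn_eq_one)
  obtain ⟨C₁, hC₁, hb₁, hc₁⟩ := hF.exists_timeInt_bounds hA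
  obtain ⟨C₂, hC₂, hb₂, hc₂⟩ := hFA.exists_timeInt_bounds hAA
  have hh : ∀ j : ℕ, (8⁻¹ : ℝ) ^ (j + 1) ∈ Set.Icc (0 : ℝ) 1 := fun j =>
    ⟨by positivity, pow_le_one₀ (by norm_num) (by norm_num)⟩
  have hb₂' : ∀ (j : ℕ) (l Θ : ℝ), 0 < l → 0 ≤ Θ → ‖timeInt (phaseFamily k) (ampl a b cutAnn)
      (2 ^ (j + 1) * l, (8⁻¹) ^ (j + 1)) Θ‖ ≤ C₂ := by
    intro j l Θ hl hΘ
    rcases le_total (2 ^ (j + 1) * l) l₀ with h | h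
    · exact hb₂ _ ⟨⟨by positivity, h⟩, hh j⟩ Θ hΘ
    · rw [timeInt_cutAnn_eq_zero hb (by positivity) (hδ.trans h), norm_zero]
      exact hC₂
  have hc₂' : ∀ (j : ℕ) (l Θ Θ' : ℝ), 0 < l → 0 < Θ → Θ ≤ Θ' →
      ‖timeInt (phaseFamily k) (ampl a b cutAnn) (2 ^ (j + 1) * l, (8⁻¹) ^ (j + 1)) Θ'
        - timeInt (phaseFamily k) (ampl a b cutAnn) (2 ^ (j + 1) * l, (8⁻¹) ^ (j + 1)) Θ‖
      ≤ C₂ * Θ ^ (-(1 / 4) : ℝ) := by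
    intro j l Θ Θ' hl hΘ hΘ'
    rcases le_total (2 ^ (j + 1) * l) l₀ with h | h
    · exact hc₂ _ ⟨⟨by positivity, h⟩, hh j⟩ Θ Θ' hΘ hΘ'
    · rw [timeInt_cutAnn_eq_zero hb (by positivity) (hδ.trans h),
        timeInt_cutAnn_eq_zero hb (by positivity) (hδ.trans h), sub_zero, norm_zero]
      positivity
  have hgeo : HasSum (fun j : ℕ => (4 : ℝ)⁻¹ ^ (j + 1)) (1 / 3) := by
    have := (hasSum_geometric_of_lt_one (r := (4 : ℝ)⁻¹) (by norm_num) (by norm_num)).mul_left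
      (4 : ℝ)⁻¹
    simp only [← pow_succ'] at this
    norm_num at this
    simpa using this
  have hnorm : ∀ j : ℕ, ‖(((4 : ℝ)⁻¹ ^ (j + 1) : ℝ) : ℂ)‖ = (4 : ℝ)⁻¹ ^ (j + 1) := fun j => by
    rw [Complex.norm_real, Real.norm_of_nonneg (by positivity)]
  have tb : ∀ (f : ℕ → ℂ) (D : ℝ), 0 ≤ D → (∀ j, ‖f j‖ ≤ D) →
      Summable (fun j : ℕ => (((4 : ℝ)⁻¹ ^ (j + 1) : ℝ) : ℂ) * f j) ∧
      ‖∑' j : ℕ, (((4 : ℝ)⁻¹ ^ (j + 1) : ℝ) : ℂ) * f j‖ ≤ D := by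
    intro f D hD hf
    have hle : ∀ j : ℕ, ‖(((4 : ℝ)⁻¹ ^ (j + 1) : ℝ) : ℂ) * f j‖ ≤ (4 : ℝ)⁻¹ ^ (j + 1) * D := by
      intro j
      rw [norm_mul, hnorm]
      gcongr
      exact hf j
    refine ⟨Summable.of_norm_bounded (hgeo.summable.mul_right D) hle, ?_⟩
    refine (tsum_of_norm_bounded (hgeo.mul_right D) hle).trans ?_
    linarith
  have hlim₁ : ∃ L₁ : ℂ, ∀ {ι : Type} (F : Filter ι) (p : ι → Param) (Θ : ι → ℝ),
      (∀ᶠ i in F, p i ∈ Set.Icc 0 l₀ ×ˢ {1}) → Tendsto p F (𝓝 (0, 1)) → Tendsto Θ F atTop →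
        Tendsto (fun i => timeInt (phaseFamily k) (ampl a b cut) (p i) (Θ i)) F (𝓝 L₁) :=
    hF.exists_timeInt_limit hA ⟨⟨le_rfl, hl₀.le⟩, rfl⟩
  have hlim₂ := fun j : ℕ => hFA.exists_timeInt_limit hAA (p₀ := (0, (8⁻¹) ^ (j + 1)))
    ⟨⟨le_rfl, hl₀.le⟩, hh j⟩
  obtain ⟨L₁, hL₁⟩ := hlim₁
  choose L₂ hL₂ using hlim₂
  refine ⟨C₁ + C₂, L₁ + ∑' j : ℕ, (((4 : ℝ)⁻¹ ^ (j + 1) : ℝ) : ℂ) * L₂ j, by positivity,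
    fun l Θ hl hll hΘ => ?_, fun l Θ Θ' hl hll hΘ hΘ' => ?_, fun {ι} F l Θ hl0 hl hΘ => ?_⟩
  · unfold scaledProf
    refine (norm_add_le _ _).trans (add_le_add (hb₁ (l, 1) ⟨⟨hl.le, hll⟩, rfl⟩ Θ hΘ) ?_)
    exact (tb _ C₂ hC₂ fun j => hb₂' j l _ hl (by positivity)).2
  · unfold scaledProf
    rw [add_sub_add_comm]
    have s1 := (tb _ C₂ hC₂ fun j => hb₂' j l (16 ^ (j + 1) * Θ') hl
      (by have := hΘ.le.trans hΘ'; positivity)).1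
    have s2 := (tb _ C₂ hC₂ fun j => hb₂' j l (16 ^ (j + 1) * Θ) hl (by positivity)).1
    rw [← s1.tsum_sub s2, add_mul]
    refine (norm_add_le _ _).trans (add_le_add (hc₁ (l, 1) ⟨⟨hl.le, hll⟩, rfl⟩ Θ Θ' hΘ hΘ') ?_)
    simp only [← mul_sub]
    refine (tb _ _ (by positivity) fun j => ?_).2
    refine (hc₂' j l (16 ^ (j + 1) * Θ) (16 ^ (j + 1) * Θ') hl (by positivity) (by gcongr)).trans ?_
    refine mul_le_mul_of_nonneg_left (Real.rpow_le_rpow_of_nonpos hΘ ?_ (by norm_num)) hC₂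
    have : (1 : ℝ) ≤ 16 ^ (j + 1) := one_le_pow₀ (by norm_num)
    nlinarith
  · have hll : ∀ r : ℝ, 0 < r → ∀ᶠ i in F, r * l i ∈ Set.Icc 0 l₀ := by
      intro r hr
      have h1 : Tendsto (fun i => r * l i) F (𝓝 0) := by simpa using hl.const_mul r
      filter_upwards [hl0, h1.eventually_lt_const hl₀] with i h2 h3
      exact ⟨by positivity, h3.le⟩
    unfold scaledProf
    refine Tendsto.add ?_ ?_
    · refine hL₁ F (fun i => (l i, 1)) Θ ?_ (hl.prodMk_nhds tendsto_const_nhds) hΘ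
      filter_upwards [hll 1 one_pos] with i hi
      rw [one_mul] at hi
      exact ⟨hi, rfl⟩
    · refine tendsto_tsum_of_dominated_convergence (bound := fun j : ℕ => (4 : ℝ)⁻¹ ^ (j + 1) * C₂)
        (hgeo.summable.mul_right C₂) (fun j => ?_) ?_
      · refine Tendsto.const_mul _ (hL₂ j F (fun i => (2 ^ (j + 1) * l i, (8⁻¹) ^ (j + 1)))
          (fun i => 16 ^ (j + 1) * Θ i) ?_ ?_ (hΘ.const_mul_atTop (by positivity)))
        · filter_upwards [hll (2 ^ (j + 1)) (by positivity)] with i hi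
          exact ⟨hi, hh j⟩
        · refine Tendsto.prodMk_nhds ?_ tendsto_const_nhds
          simpa using hl.const_mul (2 ^ (j + 1))
      · filter_upwards [hl0, hΘ.eventually_ge_atTop 0] with i h1 h2 j
        rw [norm_mul, hnorm]
        gcongr
        exact hb₂' j (l i) _ h1 (by positivity)

end

/-! ### Fejér means and the lower bound for the limit -/

lemma intervalIntegral_integral_comm {E : Type*} [NormedAddCommGroup E] [NormedSpace ℝ E]
    {F : ℝ → Plane → E} (hF : Continuous (Function.uncurry F))
    {K : Set Plane} (hK : IsCompact K) (hF0 : ∀ τ, ∀ b ∉ K, F τ b = 0) {s t : ℝ} (hst : s ≤ t) :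
    ∫ τ in s..t, ∫ b, F τ b = ∫ b, ∫ τ in s..t, F τ b := by
  have h1 : ∀ τ, ∫ b, F τ b = ∫ b in K, F τ b := fun τ =>
    (setIntegral_eq_integral_of_forall_compl_eq_zero (hF0 τ)).symm
  have h2 : ∫ b, ∫ τ in s..t, F τ b = ∫ b in K, ∫ τ in s..t, F τ b :=
    (setIntegral_eq_integral_of_forall_compl_eq_zero fun b hb => by simp [hF0 _ b hb]).symm
  rw [h2]
  simp only [h1, intervalIntegral.integral_of_le hst]
  refine integral_integral_swap ?_
  rw [Measure.prod_restrict]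
  exact (hF.continuousOn.integrableOn_compact (isCompact_Icc.prod hK)).mono_set
    (Set.prod_mono Set.Ioc_subset_Icc_self subset_rfl)

/-- The Fejér kernel at the frequency `q` in integrated form. -/
def fejer (T q : ℝ) : ℝ := ∫ Θ in (0 : ℝ)..T, ∫ τ in (0 : ℝ)..Θ, Real.cos (τ * q)

lemma fejer_eq {T q : ℝ} (hq : q ≠ 0) : fejer T q = (1 - Real.cos (T * q)) / q ^ 2 := by
  unfold fejer
  have h1 : ∀ Θ : ℝ, ∫ τ in (0 : ℝ)..Θ, Real.cos (τ * q) = q⁻¹ * Real.sin (Θ * q) := by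
    intro Θ
    rw [intervalIntegral.integral_comp_mul_right _ hq, integral_cos]
    simp
  simp only [h1]
  rw [intervalIntegral.integral_const_mul, intervalIntegral.integral_comp_mul_right _ hq,
    integral_sin]
  simp
  field_simp

lemma fejer_zero (T : ℝ) : fejer T 0 = T ^ 2 / 2 := by
  simp [fejer]

lemma fejer_nonneg (T q : ℝ) : 0 ≤ fejer T q := by
  by_cases hq : q = 0
  · rw [hq, fejer_zero]; positivity
  · rw [fejer_eq hq]
    have := Real.cos_le_one (T * q)
    apply div_nonneg <;> [linarith; positivity]

lemma le_fejer {T q : ℝ} (h : |T * q| ≤ 1) : T ^ 2 / 8 ≤ fejer T q := by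
  by_cases hq : q = 0
  · rw [hq, fejer_zero]; nlinarith [sq_nonneg T]
  · rw [fejer_eq hq, le_div_iff₀ (by positivity)]
    -- `1 - cos x ≥ (2/π²) x²` on `[-π, π]`, and `2/π² ≥ 1/8` because `π < 4`.
    have h1 := Real.cos_le_one_sub_mul_cos_sq (h.trans (by linarith [Real.pi_gt_three]))
    have h2 : (1 : ℝ) / 8 ≤ 2 / Real.pi ^ 2 := by
      rw [div_le_div_iff₀ (by norm_num) (by positivity)]
      nlinarith [Real.pi_lt_four, Real.pi_pos]
    nlinarith [sq_nonneg (T * q)]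

lemma continuous_cos_integral :
    Continuous fun x : ℝ × ℝ => ∫ τ in (0 : ℝ)..x.1, Real.cos (τ * x.2) :=
  intervalIntegral.continuous_parametric_intervalIntegral_of_continuous
    (f := fun (x : ℝ × ℝ) τ => Real.cos (τ * x.2)) (by fun_prop) continuous_fst

lemma continuous_fejer (T : ℝ) : Continuous (fejer T) :=
  intervalIntegral.continuous_parametric_intervalIntegral_of_continuous'
    (f := fun q Θ => ∫ τ in (0 : ℝ)..Θ, Real.cos (τ * q))
    (continuous_cos_integral.comp continuous_swap) 0 T

/-- The mean of an integrated oscillatory integral with nonnegative amplitude is bounded below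
by the mass of the amplitude where the phase is small. -/
lemma integral_re_oscillatory_ge {A q : Plane → ℝ} (hA : Continuous A) (hAc : HasCompactSupport A)
    (hA0 : ∀ b, 0 ≤ A b) (hq : Continuous q) {T : ℝ} (hT : 0 ≤ T) :
    T ^ 2 / 8 * ∫ b in {b | |T * q b| ≤ 1}, A b ≤ ∫ Θ in (0 : ℝ)..T,
      (∫ τ in (0 : ℝ)..Θ, ∫ b, Complex.exp (-Complex.I * τ * q b) * (A b : ℂ)).re := by
  have hA' : ∀ b ∉ tsupport A, A b = 0 := fun b hb => image_eq_zero_of_notMem_tsupport hb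
  have h1 : ∀ τ : ℝ, (∫ b, Complex.exp (-Complex.I * τ * q b) * (A b : ℂ)).re
      = ∫ b, A b * Real.cos (τ * q b) := by
    intro τ
    have : Integrable fun b => Complex.exp (-Complex.I * τ * q b) * (A b : ℂ) := by
      refine Continuous.integrable_of_hasCompactSupport (by fun_prop)
        (HasCompactSupport.intro hAc.isCompact fun b hb => by simp [hA' b hb])
    refine (integral_re this).symm.trans (integral_congr_ae (Eventually.of_forall fun b => ?_))
    simp only [RCLike.re_eq_complex_re]
    rw [Complex.re_mul_ofReal, show -Complex.I * τ * q b = ((-(τ * q b) : ℝ) : ℂ) * Complex.I by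
      push_cast; ring, Complex.exp_ofReal_mul_I_re, Real.cos_neg, mul_comm]
  have hcont : Continuous fun τ : ℝ => ∫ b, Complex.exp (-Complex.I * τ * q b) * (A b : ℂ) := by
    have : (fun τ : ℝ => ∫ b, Complex.exp (-Complex.I * τ * q b) * (A b : ℂ))
        = fun τ : ℝ => ∫ b in tsupport A, Complex.exp (-Complex.I * τ * q b) * (A b : ℂ) := by
      ext τ
      exact (setIntegral_eq_integral_of_forall_compl_eq_zero fun b hb => by simp [hA' b hb]).symm
    rw [this]
    exact continuous_parametric_integral_of_continuous (by fun_prop) hAc.isCompact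
  have h2 : ∀ Θ : ℝ, 0 ≤ Θ → (∫ τ in (0 : ℝ)..Θ, ∫ b, Complex.exp (-Complex.I * τ * q b) *
      (A b : ℂ)).re = ∫ b, A b * ∫ τ in (0 : ℝ)..Θ, Real.cos (τ * q b) := by
    intro Θ hΘ
    have := Complex.reCLM.intervalIntegral_comp_comm (hcont.intervalIntegrable (μ := volume) 0 Θ)
    simp only [Complex.reCLM_apply, h1] at this
    rw [← this, intervalIntegral_integral_comm (F := fun τ b => A b * Real.cos (τ * q b))
      (by fun_prop) hAc.isCompact (fun τ b hb => by simp [hA' b hb]) hΘ]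
    simp only [intervalIntegral.integral_const_mul]
  -- After the second integration in time the cosine has become a nonnegative kernel, so everything
  -- outside the sublevel set of the phase can be discarded.
  have h3 : ∫ Θ in (0 : ℝ)..T, (∫ τ in (0 : ℝ)..Θ, ∫ b, Complex.exp (-Complex.I * τ * q b) *
      (A b : ℂ)).re = ∫ b, A b * fejer T (q b) := by
    rw [intervalIntegral.integral_congr (g := fun Θ => ∫ b, A b * ∫ τ in (0 : ℝ)..Θ,
      Real.cos (τ * q b)) (fun Θ hΘ => h2 Θ (by rw [Set.uIcc_of_le hT] at hΘ; exact hΘ.1)),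
      intervalIntegral_integral_comm (F := fun Θ b => A b * ∫ τ in (0 : ℝ)..Θ,
      Real.cos (τ * q b)) ?_ hAc.isCompact (fun τ b hb => by simp [hA' b hb]) hT]
    · simp only [intervalIntegral.integral_const_mul, fejer]
    · exact (hA.comp continuous_snd).mul (continuous_cos_integral.comp
        (continuous_fst.prodMk (hq.comp continuous_snd)))
  rw [h3, ← integral_const_mul]
  have hms : MeasurableSet {b | |T * q b| ≤ 1} :=
    (isClosed_le (by fun_prop) continuous_const).measurableSet
  have hIntg : Integrable fun b => A b * fejer T (q b) :=
    (hA.mul ((continuous_fejer T).comp hq)).integrable_of_hasCompactSupport hAc.mul_right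
  refine (setIntegral_mono_on ((hA.integrable_of_hasCompactSupport hAc).integrableOn.const_mul _)
    hIntg.integrableOn hms fun b hb => ?_).trans (setIntegral_le_integral hIntg
      (Eventually.of_forall fun b => mul_nonneg (hA0 b) (fejer_nonneg _ _)))
  rw [mul_comm]
  exact mul_le_mul_of_nonneg_left (le_fejer hb) (hA0 b)

/-- The plane as a product. -/
def planeEquiv : Plane ≃ᵐ ℝ × ℝ :=
  (MeasurableEquiv.toLp 2 (Fin 2 → ℝ)).symm.trans MeasurableEquiv.finTwoArrow

lemma planeEquiv_apply (b : Plane) : planeEquiv b = (b 0, b 1) := rfl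

lemma measurePreserving_planeEquiv : MeasurePreserving planeEquiv :=
  (EuclideanSpace.volume_preserving_symm_measurableEquiv_toLp (Fin 2)).trans
    (volume_preserving_finTwoArrow ℝ)

/-- The limit phase `g` changes sign transversally to the second axis: for each height `y ∈ [0, r]`,
`g(·, y)` is nonpositive at `-r` and nonnegative at `0`, so it has a zero `x₀` between. As
difference quotients from `x₀` are bounded by `M`, the slice contains an interval of length `1/(T
M)`. Integration over `y` gives `(r/M)/T`. The choice `r = 1/(4 + k)` provides both `r ≤ 1/4` and `k
r ≤ 1`, used for the sign at `-r`. -/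
lemma exists_sublevel_area {k : ℝ} (hk : 0 < k) : ∃ c T₀ : ℝ, 0 < c ∧ 0 < T₀ ∧ ∀ T, T₀ ≤ T →
    c / T ≤ volume.real {b : Plane | ‖b‖ ≤ 1 ∧ |k ^ 2 / 16 * ‖b‖ ^ 4 + k * b 0| ≤ 1 / (2 * T)} := by
  set M : ℝ := k ^ 2 / 2 + k with hM
  have hM0 : 0 < M := by positivity
  set r : ℝ := 1 / (4 + k) with hr
  have hr0 : 0 < r := by positivity
  have hr4 : r ≤ 1 / 4 := by rw [hr]; gcongr; linarith
  have hrk : k * r ≤ 1 := by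
    rw [hr, mul_one_div, div_le_one (by positivity)]; linarith
  refine ⟨r / M, 2 / M, by positivity, by positivity, fun T hT => ?_⟩
  have hT0 : 0 < T := lt_of_lt_of_le (by positivity) hT
  set g : ℝ → ℝ → ℝ := fun x y => k ^ 2 / 16 * (x ^ 2 + y ^ 2) ^ 2 + k * x with hg
  set S : Set (ℝ × ℝ) := {p | p.1 ^ 2 + p.2 ^ 2 ≤ 1 ∧ |g p.1 p.2| ≤ 1 / (2 * T)} with hS
  have hSm : MeasurableSet S := by
    have h1 : IsClosed {p : ℝ × ℝ | p.1 ^ 2 + p.2 ^ 2 ≤ 1} :=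
      isClosed_le (by fun_prop) continuous_const
    have h2 : IsClosed {p : ℝ × ℝ | |g p.1 p.2| ≤ 1 / (2 * T)} :=
      isClosed_le (by simp only [hg]; fun_prop) continuous_const
    exact (h1.inter h2).measurableSet
  have hpre : {b : Plane | ‖b‖ ≤ 1 ∧ |k ^ 2 / 16 * ‖b‖ ^ 4 + k * b 0| ≤ 1 / (2 * T)}
      = planeEquiv ⁻¹' S := by
    ext b
    simp only [Set.mem_ofPred_eq, Set.mem_preimage, planeEquiv_apply, hS, hg, ← plane_norm_sq]
    rw [sq_le_one_iff₀ (norm_nonneg b), ← pow_mul]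
  rw [hpre, Measure.real, measurePreserving_planeEquiv.measure_preimage hSm.nullMeasurableSet]
  have hfin : volume S ≠ ⊤ := by
    refine ne_top_of_le_ne_top ?_ (measure_mono (t := Set.Icc (-1) 1 ×ˢ Set.Icc (-1) 1) ?_)
    · exact (isCompact_Icc.prod isCompact_Icc).measure_lt_top.ne
    · rintro ⟨x, y⟩ ⟨h1, -⟩
      simp only at h1
      exact ⟨⟨by nlinarith [sq_nonneg y], by nlinarith [sq_nonneg y]⟩,
        ⟨by nlinarith [sq_nonneg x], by nlinarith [sq_nonneg x]⟩⟩
  rw [← ENNReal.ofReal_le_iff_le_toReal hfin]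
  have slice : ∀ y ∈ Set.Icc 0 r, ENNReal.ofReal (1 / (T * M)) ≤ volume ((fun x => (x, y)) ⁻¹' S) := by
    intro y hy
    obtain ⟨x₀, hx₀, hx₀z⟩ : ∃ x₀ ∈ Set.Icc (-r) 0, g x₀ y = 0 := by
      have hc : ContinuousOn (fun x => g x y) (Set.Icc (-r) 0) := by
        simp only [hg]; fun_prop
      have := intermediate_value_Icc (by linarith) hc
      refine this ⟨?_, ?_⟩
      · simp only [hg]
        have h1 : ((-r) ^ 2 + y ^ 2) ≤ 2 * r ^ 2 := by nlinarith [hy.1, hy.2]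
        have h2 : ((-r) ^ 2 + y ^ 2) ^ 2 ≤ (2 * r ^ 2) ^ 2 := by gcongr
        have h3 : k ^ 2 / 16 * (2 * r ^ 2) ^ 2 ≤ k * r := by
          have : k ^ 2 / 16 * (2 * r ^ 2) ^ 2 = (k * r) * ((k * r) * (r ^ 2 / 4)) := by ring
          rw [this]
          have h5 : r ^ 2 / 4 ≤ 1 := by nlinarith
          have : (k * r) * (r ^ 2 / 4) ≤ 1 := mul_le_one₀ hrk (by positivity) h5
          have h6 : 0 < k * r := by positivity
          nlinarith
        have h4 : k ^ 2 / 16 * ((-r) ^ 2 + y ^ 2) ^ 2 ≤ k ^ 2 / 16 * (2 * r ^ 2) ^ 2 := by gcongr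
        linarith
      · simp only [hg]
        have : 0 ≤ k ^ 2 / 16 * (0 ^ 2 + y ^ 2) ^ 2 := by positivity
        linarith
    set w : ℝ := 1 / (2 * T * M) with hw
    have hw0 : 0 < w := by positivity
    have hTM : 2 ≤ T * M := by rwa [div_le_iff₀ hM0] at hT
    have hw4 : w ≤ 1 / 4 := by
      rw [hw]; gcongr; nlinarith
    have hsub : Set.Icc (x₀ - w) (x₀ + w) ⊆ (fun x => (x, y)) ⁻¹' S := by
      intro x hx
      have hd : |x - x₀| ≤ w := by rw [abs_le]; constructor <;> linarith [hx.1, hx.2]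
      have hx1 : |x| ≤ 1 / 2 := by
        rw [abs_le]; constructor <;> linarith [hx.1, hx.2, hx₀.1, hx₀.2]
      have hx1s : x ^ 2 ≤ 1 / 4 := by
        have := pow_le_pow_left₀ (abs_nonneg x) hx1 2
        rw [sq_abs] at this; linarith
      have hx0s : x₀ ^ 2 ≤ 1 / 4 := by nlinarith [hx₀.1, hx₀.2]
      have hys : y ^ 2 ≤ 1 / 4 := by nlinarith [hy.1, hy.2]
      refine ⟨by simp only; linarith, ?_⟩
      simp only
      have e : g x y = (x - x₀) * (k ^ 2 / 16 * ((x + x₀) * (x ^ 2 + x₀ ^ 2 + 2 * y ^ 2)) + k) := by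
        have : g x y = g x y - g x₀ y := by rw [hx₀z, sub_zero]
        rw [this]
        simp only [hg]; ring
      rw [e, abs_mul]
      have b1 : |(x + x₀) * (x ^ 2 + x₀ ^ 2 + 2 * y ^ 2)| ≤ 1 := by
        rw [abs_mul]
        refine mul_le_one₀ ?_ (abs_nonneg _) ?_
        · rw [abs_le] at hx1 ⊢; constructor <;> linarith [hx₀.1, hx₀.2]
        · rw [abs_of_nonneg (by positivity)]; linarith
      have b2 : |k ^ 2 / 16 * ((x + x₀) * (x ^ 2 + x₀ ^ 2 + 2 * y ^ 2)) + k| ≤ M := by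
        refine (abs_add_le _ _).trans ?_
        rw [abs_mul, abs_of_pos hk, abs_of_nonneg (by positivity : 0 ≤ k ^ 2 / 16)]
        have : k ^ 2 / 16 * |(x + x₀) * (x ^ 2 + x₀ ^ 2 + 2 * y ^ 2)| ≤ k ^ 2 / 16 * 1 := by gcongr
        rw [hM]; nlinarith [sq_nonneg k]
      calc _ ≤ w * M := mul_le_mul hd b2 (abs_nonneg _) hw0.le
        _ = 1 / (2 * T) := by rw [hw]; field_simp
    calc _ = volume (Set.Icc (x₀ - w) (x₀ + w)) := by
          rw [Real.volume_Icc]; congr 1; rw [hw]; field_simp; ring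
      _ ≤ _ := measure_mono hsub
  rw [Measure.volume_eq_prod, Measure.prod_apply_symm hSm]
  calc ENNReal.ofReal (r / M / T) = ∫⁻ y in Set.Icc 0 r, ENNReal.ofReal (1 / (T * M)) := by
        rw [setLIntegral_const, Real.volume_Icc, ← ENNReal.ofReal_mul (by positivity)]
        congr 1; field_simp; ring
    _ ≤ ∫⁻ y in Set.Icc 0 r, volume ((fun x => (x, y)) ⁻¹' S) :=
        setLIntegral_mono' measurableSet_Icc slice
    _ ≤ _ := setLIntegral_le_lintegral _ _

section

variable {k δ : ℝ} {a b : Plane → ℝ}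

lemma phase_isometry (k : ℝ) (g : Plane ≃ₗᵢ[ℝ] Plane) (ξ μ : Plane) :
    phase k (g ξ) (g μ) = phase k ξ μ := by
  simp [phase, jap, ← map_add]

lemma source_isometry (ha : IsProfile δ a) (hb : IsProfile δ b) (g : Plane ≃ₗᵢ[ℝ] Plane) (τ : ℝ)
    (ξ : Plane) : source k a b τ (g ξ) = source k a b τ ξ := by
  unfold source
  rw [← g.measurePreserving.integral_comp g.toHomeomorph.measurableEmbedding]
  refine integral_congr_ae (Eventually.of_forall fun μ => ?_)
  simp only
  rw [phase_isometry, ← map_add, ha.radial _ (ξ + μ) (g.norm_map _), hb.radial _ μ (g.norm_map _)]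

/-- A reflection maps one frequency to the other and leaves phase and data invariant. Radial data
thus reduce everything to frequencies on the ray of `e₀`. -/
lemma prof_eq_of_norm_eq (ha : IsProfile δ a) (hb : IsProfile δ b) (s : ℝ) {ξ η : Plane}
    (h : ‖ξ‖ = ‖η‖) : prof k a b s ξ = prof k a b s η := by
  have := Submodule.reflection_sub h
  unfold prof
  refine intervalIntegral.integral_congr fun τ _ => ?_
  rw [← source_isometry ha hb, this]

lemma prof_eq_zero (ha : IsProfile δ a) (hb : IsProfile δ b) (s : ℝ) {ξ : Plane}
    (h : 2 * δ ≤ ‖ξ‖) : prof k a b s ξ = 0 := by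
  have : ∀ τ, source k a b τ ξ = 0 := by
    intro τ
    unfold source
    rw [integral_eq_zero_of_ae]
    refine Eventually.of_forall fun μ => ?_
    have h0 : a (ξ + μ) * b μ = 0 := by
      by_cases hμ : δ ≤ ‖μ‖
      · rw [hb.eq_zero μ hμ, mul_zero]
      · rw [ha.eq_zero, zero_mul]
        have := norm_sub_le (ξ + μ) μ
        rw [add_sub_cancel_right] at this
        linarith
    simp [h0]
  simp [prof, this]

/-- The profile in scaled variables without cutoffs. -/
lemma scaledProf_eq_timeInt (hk : 0 < k) (ha : IsProfile δ a) (hb : IsProfile δ b) {l : ℝ}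
    (hl : 0 < l) (Θ : ℝ) : scaledProf k a b l Θ
      = timeInt (phaseFamily k) (ampl a b fun _ => 1) (l, 1) Θ := by
  have h := prof_eq_scaledProf hk ha hb hl (Θ / l ^ 4)
  rw [div_mul_cancel₀ _ (by positivity : l ^ 4 ≠ 0)] at h
  have h1 : ∀ τ, source k a b τ (l ^ 3 • e₀)
      = (l ^ 2 : ℝ) * oscInt (phaseFamily k) (ampl a b fun _ => 1) (l, 1) (τ * l ^ 4) := by
    intro τ
    rw [← integral_scaled hk.le a b (fun _ => 1) hl 1 τ, source]
    simp
  unfold prof at h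
  simp only [h1] at h
  rw [intervalIntegral.integral_const_mul, intervalIntegral.integral_comp_mul_right
      (fun τ => oscInt (phaseFamily k) (ampl a b fun _ => 1) (l, 1) τ) (by positivity : l ^ 4 ≠ 0),
      zero_mul, Complex.real_smul, div_mul_cancel₀ _ (by positivity : l ^ 4 ≠ 0)] at h
  have hl' : (l : ℂ) ≠ 0 := by exact_mod_cast hl.ne'
  rw [timeInt]
  push_cast at h
  field_simp at h
  exact h.symm

/-- As `l → 0` the amplitude on the unit disc tends to `a 0 * b 0 > 0` and the phase to the quartic
model, whose sublevel set has area at least `c/T`. The Fejér bound `T²/8` times this area is linear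
in `T`. How small `l` must be depends on `T`, since the phase has to be accurate to `1/(2T)`. -/
lemma exists_integral_scaledProf_ge (hk : 0 < k) (ha : IsProfile δ a) (hb : IsProfile δ b) :
    ∃ c T₀ : ℝ, 0 < c ∧ 0 < T₀ ∧ ∀ T, T₀ ≤ T → ∃ l₁ : ℝ, 0 < l₁ ∧ ∀ l, 0 < l → l ≤ l₁ →
      c * T ≤ ∫ Θ in (0 : ℝ)..T, (scaledProf k a b l Θ).re := by
  obtain ⟨c, T₀, hc, hT₀, hcT⟩ := exists_sublevel_area hk
  have hab : 0 < a 0 * b 0 := mul_pos ha.pos hb.pos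
  refine ⟨c * (a 0 * b 0) / 16, T₀, by positivity, hT₀, fun T hT => ?_⟩
  have hT0 : 0 < T := hT₀.trans_le hT
  have hq := (contDiff_phaseFamily hk.le).continuous
  have hA : Continuous fun x : ℝ × Plane => a ((x.1 ^ 3 * 1) • e₀ + x.1 • x.2) * b (x.1 • x.2) := by
    have := ha.smooth.continuous
    have := hb.smooth.continuous
    fun_prop
  have hnear : ∀ᶠ l in 𝓝 (0 : ℝ), ∀ x ∈ Metric.closedBall (0 : Plane) 1,
      a 0 * b 0 / 2 < a ((l ^ 3 * 1) • e₀ + l • x) * b (l • x) ∧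
      |phaseFamily k ((l, 1), x) - phaseFamily k ((0, 1), x)| < 1 / (2 * T) := by
    refine (isCompact_closedBall (0 : Plane) 1).eventually_forall_of_forall_eventually fun x _ => ?_
    have h0 : ∀ᶠ z : ℝ × Plane in 𝓝 (0, x), a 0 * b 0 / 2 <
        a ((z.1 ^ 3 * 1) • e₀ + z.1 • z.2) * b (z.1 • z.2) :=
      (hA.tendsto (0, x)).eventually (lt_mem_nhds (by simp; linarith))
    have h1 : Continuous fun z : ℝ × Plane =>
        |phaseFamily k ((z.1, 1), z.2) - phaseFamily k ((0, 1), z.2)| :=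
      ((hq.comp (by fun_prop : Continuous fun z : ℝ × Plane => (((z.1, 1) : Param), z.2))).sub
        (hq.comp (by fun_prop : Continuous fun z : ℝ × Plane => (((0, 1) : Param), z.2)))).abs
    have h2 : ∀ᶠ z : ℝ × Plane in 𝓝 (0, x),
        |phaseFamily k ((z.1, 1), z.2) - phaseFamily k ((0, 1), z.2)| < 1 / (2 * T) :=
      (h1.tendsto (0, x)).eventually (gt_mem_nhds (by simp; positivity))
    exact h0.and h2
  obtain ⟨l₁, hl₁, hl₁'⟩ := Metric.eventually_nhds_iff.1 hnear
  refine ⟨l₁ / 2, by positivity, fun l hl hll => ?_⟩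
  have hP := hl₁' (y := l) (by rw [dist_zero_right, Real.norm_of_nonneg hl.le]; linarith)
  simp only [scaledProf_eq_timeInt hk ha hb hl]
  obtain ⟨A, hAdef⟩ : ∃ A : Plane → ℝ, ∀ x, A x = a ((l ^ 3 * 1) • e₀ + l • x) * b (l • x) :=
    ⟨_, fun _ => rfl⟩
  have hA_eq := funext hAdef
  have hAc : Continuous A := by
    have := ha.smooth.continuous
    have := hb.smooth.continuous
    rw [hA_eq]; fun_prop
  have hAs : HasCompactSupport A := by
    have : HasCompactSupport fun x : Plane => b (l • x) := hb.hasCompactSupport.comp_smul hl.ne'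
    rw [hA_eq]
    exact HasCompactSupport.mul_left (f := fun x => a ((l ^ 3 * 1) • e₀ + l • x)) this
  have hA0 : ∀ x, 0 ≤ A x := fun x => by
    rw [hAdef]; exact mul_nonneg (ha.nonneg _) (hb.nonneg _)
  have hql : Continuous fun x : Plane => phaseFamily k ((l, 1), x) :=
    hq.comp (by fun_prop : Continuous fun x : Plane => (((l, 1) : Param), x))
  have key := integral_re_oscillatory_ge hAc hAs hA0 hql hT0.le
  have e : ∀ Θ, timeInt (phaseFamily k) (ampl a b fun _ => 1) (l, 1) Θ
      = ∫ τ in (0 : ℝ)..Θ, ∫ x, Complex.exp (-Complex.I * τ * phaseFamily k ((l, 1), x)) *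
        (A x : ℂ) := by
    intro Θ
    simp [timeInt, oscInt, ampl, hAdef]
  simp only [e]
  refine le_trans ?_ key
  have hS := hcT T hT
  set S : Set Plane := {x : Plane | ‖x‖ ≤ 1 ∧ |k ^ 2 / 16 * ‖x‖ ^ 4 + k * x 0| ≤ 1 / (2 * T)} with hSdef
  have hSc : IsClosed S := by
    have h1 : IsClosed {x : Plane | ‖x‖ ≤ 1} := isClosed_le (by fun_prop) continuous_const
    have h2 : IsClosed {x : Plane | |k ^ 2 / 16 * ‖x‖ ^ 4 + k * x 0| ≤ 1 / (2 * T)} :=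
      isClosed_le (by fun_prop) continuous_const
    exact h1.inter h2
  have hSfin : volume S ≠ ⊤ := by
    refine ne_top_of_le_ne_top (isCompact_closedBall (0 : Plane) 1).measure_lt_top.ne
      (measure_mono fun x hx => ?_)
    rw [mem_closedBall_zero_iff]; exact hx.1
  have hsub : S ⊆ {x | |T * phaseFamily k ((l, 1), x)| ≤ 1} := by
    intro x hx
    have h1 := (hP x (by rw [mem_closedBall_zero_iff]; exact hx.1)).2
    have h2 := hx.2
    rw [phaseFamily_zero, mul_one] at h1
    have h3 : |phaseFamily k ((l, 1), x)| ≤ 1 / T := by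
      have := abs_sub_abs_le_abs_sub (phaseFamily k ((l, 1), x))
        (k ^ 2 / 16 * ‖x‖ ^ 4 + k * x.ofLp 0)
      have h4 : 1 / (2 * T) + 1 / (2 * T) = 1 / T := by field_simp; ring
      linarith
    show |T * phaseFamily k ((l, 1), x)| ≤ 1
    rw [abs_mul, abs_of_pos hT0]
    calc _ ≤ T * (1 / T) := by gcongr
      _ = 1 := by field_simp
  have hAi := hAc.integrable_of_hasCompactSupport hAs (μ := volume)
  have i1 : a 0 * b 0 / 2 * volume.real S ≤ ∫ x in S, A x :=
    (setIntegral_ge_of_const_le_real hSc.measurableSet hSfin (fun x hx => by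
      rw [hAdef]
      exact (hP x (by rw [mem_closedBall_zero_iff]; exact hx.1)).1.le) hAi.integrableOn)
  have i2 : ∫ x in S, A x ≤ ∫ x in {x | |T * phaseFamily k ((l, 1), x)| ≤ 1}, A x :=
    setIntegral_mono_set hAi.integrableOn (Eventually.of_forall hA0) hsub.eventuallyLE
  calc _ = T ^ 2 / 8 * (a 0 * b 0 / 2 * (c / T)) := by field_simp; ring
    _ ≤ T ^ 2 / 8 * (a 0 * b 0 / 2 * volume.real S) := by gcongr
    _ ≤ _ := by gcongr; exact i1.trans i2

end

/-! ### Asymptotics of the profiles in the original variables -/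

section

variable {k δ : ℝ} {a b : Plane → ℝ}

lemma continuous_phase_comp {X : Type*} [TopologicalSpace X] {f g : X → Plane} (hf : Continuous f)
    (hg : Continuous g) : Continuous fun x => phase k (f x) (g x) := by
  have := continuous_jap k
  have := continuous_jap (k / 2)
  unfold phase
  fun_prop

lemma continuous_source (ha : Continuous a) (hb : Continuous b) (hcb : HasCompactSupport b) :
    Continuous fun x : ℝ × Plane => source k a b x.1 x.2 := by
  have : (fun x : ℝ × Plane => source k a b x.1 x.2) = fun x : ℝ × Plane => ∫ μ in tsupport b,
      Complex.exp (-Complex.I * x.1 * phase k x.2 μ) * ((a (x.2 + μ) * b μ : ℝ) : ℂ) := by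
    ext x
    exact (setIntegral_eq_integral_of_forall_compl_eq_zero fun μ hμ => by
      simp [image_eq_zero_of_notMem_tsupport hμ]).symm
  rw [this]
  refine continuous_parametric_integral_of_continuous ?_ hcb.isCompact
  have h1 : Continuous fun z : (ℝ × Plane) × Plane => phase k z.1.2 z.2 :=
    continuous_phase_comp (by fun_prop) (by fun_prop)
  fun_prop

lemma continuous_prof (ha : Continuous a) (hb : Continuous b) (hcb : HasCompactSupport b) :
    Continuous fun x : ℝ × Plane => prof k a b x.1 x.2 :=
  intervalIntegral.continuous_parametric_intervalIntegral_of_continuous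
    (f := fun (x : ℝ × Plane) τ => source k a b τ x.2)
    ((continuous_source ha hb hcb).comp
      (by fun_prop : Continuous fun z : (ℝ × Plane) × ℝ => (z.2, z.1.2))) continuous_fst

lemma norm_cbrt_pow (ξ : Plane) : (‖ξ‖ ^ (1 / 3 : ℝ)) ^ 3 = ‖ξ‖ := by
  rw [← Real.rpow_natCast, ← Real.rpow_mul (norm_nonneg _)]
  norm_num

lemma prof_eq_scaledProf_norm (hk : 0 < k) (ha : IsProfile δ a) (hb : IsProfile δ b) {ξ : Plane}
    (hξ : ξ ≠ 0) (s : ℝ) : prof k a b s ξ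
      = ((‖ξ‖ ^ (-(2 / 3) : ℝ) : ℝ) : ℂ) *
        scaledProf k a b (‖ξ‖ ^ (1 / 3 : ℝ)) (s * ‖ξ‖ ^ (4 / 3 : ℝ)) := by
  have h0 : 0 < ‖ξ‖ := norm_pos_iff.2 hξ
  have hl : 0 < ‖ξ‖ ^ (1 / 3 : ℝ) := by positivity
  have h1 : ‖ξ‖ = ‖(‖ξ‖ ^ (1 / 3 : ℝ)) ^ 3 • e₀‖ := by
    rw [norm_smul, norm_cbrt_pow, norm_norm, norm_e₀, mul_one]
  rw [prof_eq_of_norm_eq ha hb s h1, prof_eq_scaledProf hk ha hb hl]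
  have h2 : ((‖ξ‖ ^ (1 / 3 : ℝ)) ^ 2)⁻¹ = ‖ξ‖ ^ (-(2 / 3) : ℝ) := by
    rw [← Real.rpow_natCast, ← Real.rpow_mul h0.le, ← Real.rpow_neg h0.le]
    norm_num
  have h3 : (‖ξ‖ ^ (1 / 3 : ℝ)) ^ 4 = ‖ξ‖ ^ (4 / 3 : ℝ) := by
    rw [← Real.rpow_natCast, ← Real.rpow_mul h0.le]
    norm_num
  rw [h2, h3]

/-- The limit of the scaled profile does not vanish. -/
lemma scaledProf_limit_ne_zero (hk : 0 < k) (ha : IsProfile δ a) (hb : IsProfile δ b) {l₀ C : ℝ}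
    (hl₀ : 0 < l₀) (hC : 0 ≤ C) {L : ℂ}
    (hc : ∀ l Θ Θ', 0 < l → l ≤ l₀ → 0 < Θ → Θ ≤ Θ' →
        ‖scaledProf k a b l Θ' - scaledProf k a b l Θ‖ ≤ C * Θ ^ (-(1 / 4) : ℝ))
    (hL : ∀ (F : Filter ℕ) (l Θ : ℕ → ℝ), (∀ᶠ i in F, 0 < l i) → Tendsto l F (𝓝 0) →
        Tendsto Θ F atTop → Tendsto (fun i => scaledProf k a b (l i) (Θ i)) F (𝓝 L)) :
    L ≠ 0 := by
  obtain ⟨c, T₀, hc0, hT₀, hcT⟩ := exists_integral_scaledProf_ge hk ha hb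
  -- The value at `Θ` exceeds the value at `T` by at most `C Θ^(-1/4)`, whose integral over `[0, T]`
  -- is `(4/3) C T^(3/4)`. A mean of at least `c` therefore bounds the value at `T` itself from
  -- below.
  have key : ∀ T, T₀ ≤ T → ∃ l₁, 0 < l₁ ∧ ∀ l, 0 < l → l ≤ l₁ → l ≤ l₀ →
      c ≤ ‖scaledProf k a b l T‖ + 2 * C * T ^ (-(1 / 4) : ℝ) := by
    intro T hT
    have hT0 : 0 < T := hT₀.trans_le hT
    obtain ⟨l₁, hl₁, h⟩ := hcT T hT
    refine ⟨l₁, hl₁, fun l hl hll hll₀ => ?_⟩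
    have h1 := h l hl hll
    have hcont : Continuous fun Θ => (scaledProf k a b l Θ).re := by
      have e : ∀ Θ, scaledProf k a b l Θ = (l ^ 2 : ℝ) * prof k a b (Θ / l ^ 4) (l ^ 3 • e₀) := by
        intro Θ
        rw [prof_eq_scaledProf hk ha hb hl, ← mul_assoc, ← Complex.ofReal_mul,
          mul_inv_cancel₀ (by positivity), div_mul_cancel₀ _ (by positivity)]
        simp
      simp only [e]
      have := (continuous_prof (k := k) ha.smooth.continuous hb.smooth.continuous
        hb.hasCompactSupport).comp (by fun_prop :
          Continuous fun Θ : ℝ => (Θ / l ^ 4, l ^ 3 • e₀))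
      exact Complex.continuous_re.comp (continuous_const.mul this)
    have hIntg : IntervalIntegrable (fun Θ : ℝ => Θ ^ (-(1 / 4) : ℝ)) volume 0 T :=
      intervalIntegral.intervalIntegrable_rpow' (by norm_num)
    have h2 : ∫ Θ in (0 : ℝ)..T, (scaledProf k a b l Θ).re ≤
        ∫ Θ in (0 : ℝ)..T, (‖scaledProf k a b l T‖ + C * Θ ^ (-(1 / 4) : ℝ)) := by
      refine intervalIntegral.integral_mono_on_of_le_Ioo hT0.le (hcont.intervalIntegrable _ _)
        (intervalIntegrable_const.add (hIntg.const_mul C)) fun Θ hΘ => ?_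
      have h3 := hc l Θ T hl hll₀ hΘ.1 hΘ.2.le
      have h4 := norm_sub_norm_le (scaledProf k a b l Θ) (scaledProf k a b l T)
      rw [norm_sub_rev] at h4
      have h5 := Complex.re_le_norm (scaledProf k a b l Θ)
      linarith
    rw [intervalIntegral.integral_add intervalIntegrable_const (hIntg.const_mul C),
      intervalIntegral.integral_const, intervalIntegral.integral_const_mul,
      integral_rpow (Or.inl (by norm_num))] at h2
    have h6 : T ^ (-(1 / 4) + 1 : ℝ) = T ^ (-(1 / 4) : ℝ) * T := by
      rw [Real.rpow_add_one hT0.ne']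
    rw [h6, Real.zero_rpow (by norm_num)] at h2
    have h7 : c * T ≤ (‖scaledProf k a b l T‖ + 2 * C * T ^ (-(1 / 4) : ℝ)) * T := by
      refine (h1.trans h2).trans ?_
      have : 0 ≤ C * (T ^ (-(1 / 4) : ℝ) * T) := by positivity
      simp only [smul_eq_mul, sub_zero]
      norm_num
      norm_num at this
      linarith
    exact le_of_mul_le_mul_right h7 hT0
  choose! l₁ hl₁ hl₁' using key
  have hseq : Tendsto (fun n : ℕ => T₀ + n) atTop atTop :=
    tendsto_atTop_add_const_left _ _ tendsto_natCast_atTop_atTop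
  -- The threshold for `l` depends on `T`, so the limit is tested along a diagonal sequence.
  set l : ℕ → ℝ := fun n => min (min (l₁ (T₀ + n)) l₀) (1 / ((n : ℝ) + 1)) with hl
  have hge : ∀ n : ℕ, T₀ ≤ T₀ + n := fun n => by simp
  have hl0 : ∀ n, 0 < l n := fun n => by
    have := hl₁ (T₀ + n) (hge n)
    simp only [hl]
    positivity
  have hlt : Tendsto l atTop (𝓝 0) :=
    squeeze_zero (fun n => (hl0 n).le) (fun n => min_le_right _ _)
      tendsto_one_div_add_atTop_nhds_zero_nat
  have hlim := hL atTop l (fun n => T₀ + n) (Eventually.of_forall hl0) hlt hseq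
  have hlim2 : Tendsto (fun n : ℕ => ‖scaledProf k a b (l n) (T₀ + n)‖ +
      2 * C * (T₀ + n) ^ (-(1 / 4) : ℝ)) atTop (𝓝 (‖L‖ + 2 * C * 0)) :=
    hlim.norm.add (((tendsto_rpow_neg_atTop (y := 1 / 4) (by norm_num)).comp hseq).const_mul _)
  have := ge_of_tendsto hlim2 (Eventually.of_forall fun n => hl₁' (T₀ + n) (hge n) (l n) (hl0 n)
    ((min_le_left _ _).trans (min_le_left _ _)) ((min_le_left _ _).trans (min_le_right _ _)))
  intro hL0
  rw [hL0] at this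
  simp at this
  linarith

/-- The asymptotic properties of the profiles. -/
structure ProfBounds (f : ℝ → Plane → ℂ) (C : ℝ) (L : ℂ) : Prop where
  nonneg : 0 ≤ C
  ne_zero : L ≠ 0
  bound : ∀ s ξ, 0 ≤ s → ξ ≠ 0 → ‖f s ξ‖ ≤ C * ‖ξ‖ ^ (-(2 / 3) : ℝ)
  cauchy : ∀ s s' ξ, 0 < s → s ≤ s' → ξ ≠ 0 →
    ‖f s' ξ - f s ξ‖ ≤ C * s ^ (-(1 / 4) : ℝ) * ‖ξ‖⁻¹
  limit : ∀ {ι : Type} (F : Filter ι) (s : ι → ℝ) (ξ : ι → Plane), (∀ᶠ i in F, ξ i ≠ 0) →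
    Tendsto ξ F (𝓝 0) → Tendsto (fun i => s i * ‖ξ i‖ ^ (4 / 3 : ℝ)) F atTop →
    Tendsto (fun i => ((‖ξ i‖ ^ (2 / 3 : ℝ) : ℝ) : ℂ) * f (s i) (ξ i)) F (𝓝 L)

/-- With `l = |ξ|^(1/3)` the prefactor `l⁻²` is `|ξ|^(-2/3)` and the scaled time is `s|ξ|^(4/3)`;
the rate `Θ^(-1/4)` contributes another `|ξ|^(-1/3)`, which gives the singularity `|ξ|⁻¹` in the
Cauchy bound. Profiles vanish for `|ξ| ≥ 2δ`, and `δ₀ = l₀³/2` places the rest in the range `l ≤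
l₀`. -/
lemma exists_profBounds (hk : 0 < k) : ∃ δ₀ : ℝ, 0 < δ₀ ∧ ∀ δ a b, δ ≤ δ₀ →
    IsProfile δ a → IsProfile δ b → ∃ C L, ProfBounds (prof k a b) C L := by
  obtain ⟨l₀, hl₀, hl₀1, H⟩ := scaledProf_bounds hk
  refine ⟨l₀ ^ 3 / 2, by positivity, fun δ a b hδ ha hb => ?_⟩
  have hl3 : l₀ ^ 3 ≤ l₀ := pow_le_of_le_one hl₀.le hl₀1 (by norm_num)
  obtain ⟨C, L, hC, h1, h2, h3⟩ := H δ a b (by linarith) ha hb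
  have hsmall : ∀ ξ : Plane, ‖ξ‖ < 2 * δ → ‖ξ‖ ^ (1 / 3 : ℝ) ≤ l₀ := by
    intro ξ hξ
    refine le_of_pow_le_pow_left₀ (n := 3) (by norm_num) hl₀.le ?_
    rw [norm_cbrt_pow]
    linarith
  refine ⟨C, L, hC, scaledProf_limit_ne_zero hk ha hb hl₀ hC h2 h3, fun s ξ hs hξ => ?_,
    fun s s' ξ hs hs' hξ => ?_, fun {ι} F s ξ hξ0 hξ hs => ?_⟩
  · have h0 : 0 < ‖ξ‖ := norm_pos_iff.2 hξ
    rcases le_or_gt (2 * δ) ‖ξ‖ with h | h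
    · rw [prof_eq_zero ha hb s h, norm_zero]; positivity
    · rw [prof_eq_scaledProf_norm hk ha hb hξ, norm_mul, Complex.norm_real,
        Real.norm_of_nonneg (by positivity), mul_comm]
      gcongr
      exact h1 _ _ (by positivity) (hsmall ξ h) (by positivity)
  · have h0 : 0 < ‖ξ‖ := norm_pos_iff.2 hξ
    rcases le_or_gt (2 * δ) ‖ξ‖ with h | h
    · rw [prof_eq_zero ha hb s h, prof_eq_zero ha hb s' h, sub_zero, norm_zero]; positivity
    · rw [prof_eq_scaledProf_norm hk ha hb hξ, prof_eq_scaledProf_norm hk ha hb hξ, ← mul_sub,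
        norm_mul, Complex.norm_real, Real.norm_of_nonneg (by positivity)]
      have := h2 _ (s * ‖ξ‖ ^ (4 / 3 : ℝ)) (s' * ‖ξ‖ ^ (4 / 3 : ℝ)) (by positivity) (hsmall ξ h)
        (by positivity) (by gcongr)
      refine (mul_le_mul_of_nonneg_left this (by positivity)).trans (le_of_eq ?_)
      rw [Real.mul_rpow hs.le (by positivity), ← Real.rpow_mul h0.le]
      have e : ‖ξ‖ ^ (-(2 / 3) : ℝ) * ‖ξ‖ ^ (4 / 3 * (-(1 / 4)) : ℝ) = ‖ξ‖⁻¹ := by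
        rw [← Real.rpow_add h0, ← Real.rpow_neg_one]; norm_num
      rw [← e]; ring
  · have hl : Tendsto (fun i => ‖ξ i‖ ^ (1 / 3 : ℝ)) F (𝓝 0) := by
      have := hξ.norm.rpow_const (p := 1 / 3) (Or.inr (by norm_num))
      simpa using this
    refine (h3 F _ _ ?_ hl hs).congr' ?_
    · filter_upwards [hξ0] with i hi
      have := norm_pos_iff.2 hi
      positivity
    · filter_upwards [hξ0] with i hi
      have := norm_pos_iff.2 hi
      rw [prof_eq_scaledProf_norm hk ha hb hi, ← mul_assoc, ← Complex.ofReal_mul,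
        ← Real.rpow_add this]
      norm_num

end

/-! ### Interaction of two singular profiles: freezing them at the final time -/

/-- `∫₀¹ exp(-isx) ds`. -/
def mker (x : ℝ) : ℂ := ∫ s in (0 : ℝ)..1, Complex.exp (-Complex.I * s * x)

lemma continuous_mker : Continuous mker :=
  intervalIntegral.continuous_parametric_intervalIntegral_of_continuous'
    (f := fun (x s : ℝ) => Complex.exp (-Complex.I * s * x)) (by fun_prop) 0 1

lemma norm_mker_le_one (x : ℝ) : ‖mker x‖ ≤ 1 := by
  have := intervalIntegral.norm_integral_le_of_norm_le_const (a := 0) (b := 1) (C := 1)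
    (f := fun s : ℝ => Complex.exp (-Complex.I * s * x))
    (fun s _ => (norm_cexp_neg_I_mul s x).le)
  simpa [mker] using this

lemma mker_eq {x : ℝ} (hx : x ≠ 0) :
    mker x = (Complex.exp (-Complex.I * x) - 1) / (-Complex.I * x) := by
  have h : -Complex.I * (x : ℂ) ≠ 0 := by simp [hx]
  have e : ∀ s : ℝ, Complex.exp (-Complex.I * s * x) = Complex.exp (-Complex.I * x * s) :=
    fun s => by congr 1; ring
  unfold mker
  simp only [e]
  rw [integral_exp_mul_complex h]
  simp

lemma norm_mker_le {x : ℝ} (hx : x ≠ 0) : ‖mker x‖ ≤ 2 / |x| := by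
  rw [mker_eq hx, norm_div]
  have h1 : ‖-Complex.I * (x : ℂ)‖ = |x| := by simp
  rw [h1]
  gcongr
  refine (norm_sub_le _ _).trans ?_
  have := norm_cexp_neg_I_mul 1 x
  simp only [Complex.ofReal_one, mul_one] at this
  rw [this, norm_one]
  norm_num

lemma mker_im {x : ℝ} (hx : x ≠ 0) : (mker x).im = -((1 - Real.cos x) / x) := by
  rw [mker_eq hx, show Complex.exp (-Complex.I * x) = Real.cos x - Real.sin x * Complex.I by
    rw [show -Complex.I * (x : ℂ) = ((-x : ℝ) : ℂ) * Complex.I by push_cast; ring,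
      Complex.exp_mul_I, ← Complex.ofReal_cos, ← Complex.ofReal_sin, Real.cos_neg, Real.sin_neg]
    push_cast; ring]
  have h2 : ((Real.cos x - Real.sin x * Complex.I - 1) / (-Complex.I * x) : ℂ)
      = ((Real.sin x / x : ℝ) : ℂ) + ((-((1 - Real.cos x) / x) : ℝ) : ℂ) * Complex.I := by
    have : (x : ℂ) ≠ 0 := by exact_mod_cast hx
    push_cast
    field_simp
    ring_nf
    simp only [Complex.I_sq]
    ring
  rw [h2, Complex.add_im, Complex.ofReal_im, Complex.im_ofReal_mul, Complex.I_im]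
  ring

lemma integral_cexp_eq_mker (t q : ℝ) :
    ∫ s in (0 : ℝ)..t, Complex.exp (-Complex.I * s * q) = t * mker (t * q) := by
  have := intervalIntegral.smul_integral_comp_mul_left (a := 0) (b := 1)
    (fun s : ℝ => Complex.exp (-Complex.I * s * q)) t
  simp only [mul_zero, mul_one] at this
  rw [← this, mker, Complex.real_smul]
  congr 2
  ext s
  push_cast
  congr 1
  ring

lemma integrableOn_norm_rpow {p : ℝ} (hp : p < 2) (R : ℝ) :
    IntegrableOn (fun x : Plane => ‖x‖ ^ (-p)) (Metric.closedBall 0 R) := by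
  rw [← integrable_indicator_iff Metric.isClosed_closedBall.measurableSet]
  have e : (Metric.closedBall (0 : Plane) R).indicator (fun x : Plane => ‖x‖ ^ (-p))
      = fun x => (Set.Iic R).indicator (fun r : ℝ => r ^ (-p)) ‖x‖ := by
    ext x
    by_cases h : ‖x‖ ≤ R
    · rw [Set.indicator_of_mem (by simpa using h), Set.indicator_of_mem (by simpa using h)]
    · rw [Set.indicator_of_notMem (by simpa using h), Set.indicator_of_notMem (by simpa using h)]
  rw [e, integrable_fun_norm_addHaar volume (f := (Set.Iic R).indicator fun r : ℝ => r ^ (-p))]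
  have h1 : IntegrableOn (fun r : ℝ => r ^ (1 - p)) (Set.Ioc 0 (max R 0)) := by
    rw [← intervalIntegrable_iff_integrableOn_Ioc_of_le (le_max_right _ _)]
    exact intervalIntegral.intervalIntegrable_rpow' (by linarith)
  have h2 : IntegrableOn ((Set.Ioc 0 (max R 0)).indicator fun r : ℝ => r ^ (1 - p)) (Set.Ioi 0) :=
    (h1.integrable_indicator measurableSet_Ioc).integrableOn
  refine h2.congr_fun (fun r hr => ?_) measurableSet_Ioi
  have hr0 : 0 < r := hr
  simp only [finrank_euclideanSpace_fin, smul_eq_mul]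
  by_cases h : r ≤ R
  · rw [Set.indicator_of_mem (by exact ⟨hr0, le_max_of_le_left h⟩), Set.indicator_of_mem (Set.mem_Iic.2 h),
      show (1 : ℝ) - p = 1 + -p by ring, Real.rpow_add hr0]
    simp
  · rw [Set.indicator_of_notMem, Set.indicator_of_notMem (fun h' => h (Set.mem_Iic.1 h')), mul_zero]
    rintro ⟨_, h'⟩
    rcases le_max_iff.1 h' with h' | h' <;> [exact h h'; linarith]

/-- The mass of the singularity `|x|^(-p)` in a ball. -/
def ballMass (p R : ℝ) : ℝ := ∫ x : Plane in Metric.closedBall 0 R, ‖x‖ ^ (-p)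

lemma ballMass_nonneg (p R : ℝ) : 0 ≤ ballMass p R :=
  setIntegral_nonneg Metric.isClosed_closedBall.measurableSet fun x _ => by positivity

lemma ballMass_mono {p : ℝ} (hp : p < 2) {R R' : ℝ} (h : R ≤ R') : ballMass p R ≤ ballMass p R' :=
  setIntegral_mono_set (integrableOn_norm_rpow hp R') (Eventually.of_forall fun x => by
    simp only [Pi.zero_apply]; positivity) (Metric.closedBall_subset_closedBall h).eventuallyLE

lemma ballMass_eq (p : ℝ) {R : ℝ} (hR : 0 < R) : ballMass p R = R ^ (2 - p) * ballMass p 1 := by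
  have := Measure.setIntegral_comp_smul_of_pos (volume : Measure Plane)
    (fun x : Plane => ‖x‖ ^ (-p)) (Metric.closedBall 0 1) hR
  rw [smul_closedBall _ _ zero_le_one, smul_zero, mul_one, Real.norm_of_nonneg hR.le] at this
  simp only [norm_smul, Real.norm_of_nonneg hR.le, finrank_euclideanSpace_fin,
    Real.mul_rpow hR.le (norm_nonneg _)] at this
  rw [integral_const_mul, smul_eq_mul] at this
  unfold ballMass
  rw [show (2 : ℝ) - p = 2 + -p by ring, Real.rpow_add hR, mul_assoc, this]
  norm_num
  field_simp

lemma tendsto_ballMass {p : ℝ} (hp : p < 2) {ι : Type*} {F : Filter ι} {ρ : ι → ℝ}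
    (hρ : Tendsto ρ F (𝓝 0)) : Tendsto (fun i => ballMass p (ρ i)) F (𝓝 0) := by
  have h1 : Tendsto (fun i => |ρ i| ^ (2 - p) * ballMass p 1) F (𝓝 0) := by
    have := (hρ.abs.rpow_const (p := 2 - p) (Or.inr (by linarith))).mul_const (ballMass p 1)
    simpa [Real.zero_rpow (by linarith : 2 - p ≠ 0)] using this
  refine squeeze_zero (fun i => ballMass_nonneg _ _) (fun i => ?_) h1
  rcases eq_or_ne (ρ i) 0 with h | h
  · rw [h]
    refine (le_of_eq ?_).trans (mul_nonneg (by positivity) (ballMass_nonneg p 1))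
    simp [ballMass]
  · exact (ballMass_mono hp (le_abs_self _)).trans (ballMass_eq p (abs_pos.2 h)).le

/-- Separates the singularities at `ζ + μ = 0` and `μ = 0`. The resulting estimate is uniform as `ζ
→ 0`, when they merge. -/
lemma rpow_mul_rpow_le {x y p q : ℝ} (hx : 0 < x) (hy : 0 < y) (hp : 0 ≤ p) (hq : 0 ≤ q) :
    x ^ (-p) * y ^ (-q) ≤ x ^ (-(p + q)) + y ^ (-(p + q)) := by
  rw [neg_add, Real.rpow_add hx, Real.rpow_add hy]
  have hx1 : 0 < x ^ (-p) := by positivity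
  have hx2 : 0 < x ^ (-q) := by positivity
  have hy1 : 0 < y ^ (-p) := by positivity
  have hy2 : 0 < y ^ (-q) := by positivity
  rcases le_total x y with h | h
  · have := Real.rpow_le_rpow_of_nonpos hx h (by linarith : -q ≤ 0)
    nlinarith
  · have := Real.rpow_le_rpow_of_nonpos hy h (by linarith : -p ≤ 0)
    nlinarith

lemma integrableOn_norm_add_rpow {p : ℝ} (hp : p < 2) (ζ : Plane) (R : ℝ) :
    IntegrableOn (fun μ : Plane => ‖ζ + μ‖ ^ (-p) + ‖μ‖ ^ (-p)) (Metric.closedBall 0 R) ∧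
    ∫ μ : Plane in Metric.closedBall 0 R, (‖ζ + μ‖ ^ (-p) + ‖μ‖ ^ (-p))
      ≤ 2 * ballMass p (R + ‖ζ‖) := by
  have hm : MeasurableSet (Metric.closedBall (0 : Plane) (R + ‖ζ‖)) :=
    Metric.isClosed_closedBall.measurableSet
  set H : Plane → ℝ := (Metric.closedBall 0 (R + ‖ζ‖)).indicator fun x => ‖x‖ ^ (-p) with hH
  have hHi : Integrable H := (integrableOn_norm_rpow hp _).integrable_indicator hm
  have hHi' : Integrable fun μ => H (ζ + μ) := hHi.comp_add_left ζ
  have e : ∀ μ ∈ Metric.closedBall (0 : Plane) R, H (ζ + μ) = ‖ζ + μ‖ ^ (-p) := by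
    intro μ hμ
    rw [hH, Set.indicator_of_mem]
    rw [mem_closedBall_zero_iff] at hμ ⊢
    linarith [norm_add_le ζ μ]
  have hR : MeasurableSet (Metric.closedBall (0 : Plane) R) :=
    Metric.isClosed_closedBall.measurableSet
  have h1 : IntegrableOn (fun μ : Plane => ‖ζ + μ‖ ^ (-p)) (Metric.closedBall 0 R) :=
    hHi'.integrableOn.congr_fun e hR
  refine ⟨h1.add (integrableOn_norm_rpow hp R), ?_⟩
  rw [integral_add h1 (integrableOn_norm_rpow hp R), two_mul]
  refine add_le_add ?_ (ballMass_mono hp (by linarith [norm_nonneg ζ]))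
  rw [← setIntegral_congr_fun hR e]
  refine (setIntegral_le_integral hHi' (Eventually.of_forall fun μ => ?_)).trans (le_of_eq ?_)
  · exact Set.indicator_nonneg (fun x _ => by positivity) _
  · rw [integral_add_left_eq_self H ζ, hH, integral_indicator hm, ballMass]

/-- `∫ exp(-is phase(ζ, μ)) f(s, ζ + μ) conj g(s, μ) dμ`. -/
def interaction (k : ℝ) (f g : ℝ → Plane → ℂ) (s : ℝ) (ζ : Plane) : ℂ :=
  ∫ μ : Plane, Complex.exp (-Complex.I * s * phase k ζ μ) * (f s (ζ + μ) * conj (g s μ))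

/-- The time integral of the interaction. -/
def duhamel (k : ℝ) (f g : ℝ → Plane → ℂ) (t : ℝ) (ζ : Plane) : ℂ :=
  ∫ s in (0 : ℝ)..t, interaction k f g s ζ

/-- Continuous functions of time and frequency which vanish for frequencies of length at least
`R`. -/
structure IsCompactFamily (R : ℝ) (f : ℝ → Plane → ℂ) : Prop where
  continuous : Continuous fun x : ℝ × Plane => f x.1 x.2
  eq_zero : ∀ s ξ, R ≤ ‖ξ‖ → f s ξ = 0

lemma IsCompactFamily.continuous_comp {R : ℝ} {f : ℝ → Plane → ℂ} (hf : IsCompactFamily R f)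
    {X : Type*} [TopologicalSpace X] {u : X → ℝ} {v : X → Plane} (hu : Continuous u)
    (hv : Continuous v) : Continuous fun x => f (u x) (v x) :=
  hf.continuous.comp (hu.prodMk hv)

lemma continuous_cexp_neg_I_mul {X : Type*} [TopologicalSpace X] {s q : X → ℝ} (hs : Continuous s)
    (hq : Continuous q) : Continuous fun x => Complex.exp (-Complex.I * s x * q x) := by
  fun_prop

section

variable {k R R' C C' : ℝ} {f g : ℝ → Plane → ℂ} {L L' : ℂ}

lemma continuous_interaction (hf : IsCompactFamily R f) (hg : IsCompactFamily R' g) :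
    Continuous fun x : ℝ × Plane => interaction k f g x.1 x.2 := by
  have : (fun x : ℝ × Plane => interaction k f g x.1 x.2)
      = fun x : ℝ × Plane => ∫ μ in Metric.closedBall (0 : Plane) R',
      Complex.exp (-Complex.I * x.1 * phase k x.2 μ) * (f x.1 (x.2 + μ) * conj (g x.1 μ)) := by
    ext x
    refine (setIntegral_eq_integral_of_forall_compl_eq_zero fun μ hμ => ?_).symm
    rw [mem_closedBall_zero_iff, not_le] at hμ
    simp [hg.eq_zero _ μ hμ.le]
  rw [this]
  refine continuous_parametric_integral_of_continuous ?_ (isCompact_closedBall _ _)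
  have h1 : Continuous fun z : (ℝ × Plane) × Plane => phase k z.1.2 z.2 :=
    continuous_phase_comp (by fun_prop) (by fun_prop)
  have h2 : Continuous fun z : (ℝ × Plane) × Plane => f z.1.1 (z.1.2 + z.2) :=
    hf.continuous_comp (by fun_prop) (by fun_prop)
  have h3 : Continuous fun z : (ℝ × Plane) × Plane => g z.1.1 z.2 :=
    hg.continuous_comp (by fun_prop) (by fun_prop)
  have h4 := Complex.continuous_conj.comp h3
  exact (continuous_cexp_neg_I_mul (by fun_prop) h1).mul (h2.mul h4)

lemma continuous_duhamel (hf : IsCompactFamily R f) (hg : IsCompactFamily R' g) :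
    Continuous fun x : ℝ × Plane => duhamel k f g x.1 x.2 :=
  intervalIntegral.continuous_parametric_intervalIntegral_of_continuous
    (f := fun (x : ℝ × Plane) τ => interaction k f g τ x.2)
    ((continuous_interaction hf hg).comp
      (by fun_prop : Continuous fun z : (ℝ × Plane) × ℝ => (z.2, z.1.2))) continuous_fst

lemma integrable_interaction (hf : IsCompactFamily R f) (hg : IsCompactFamily R' g) (s t : ℝ)
    (ζ : Plane) : Integrable fun μ : Plane =>
      Complex.exp (-Complex.I * s * phase k ζ μ) * (f t (ζ + μ) * conj (g t μ)) := by
  have h1 : Continuous fun z : Plane => phase k ζ z :=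
    continuous_phase_comp (by fun_prop) (by fun_prop)
  have h2 : Continuous fun z : Plane => f t (ζ + z) := hf.continuous_comp (by fun_prop) (by fun_prop)
  have h3 : Continuous fun z : Plane => g t z := hg.continuous_comp (by fun_prop) (by fun_prop)
  have h4 := Complex.continuous_conj.comp h3
  refine Continuous.integrable_of_hasCompactSupport
    ((continuous_cexp_neg_I_mul continuous_const h1).mul (h2.mul h4))
    (HasCompactSupport.intro (isCompact_closedBall 0 R') fun μ hμ => ?_)
  rw [mem_closedBall_zero_iff, not_le] at hμ
  simp [hg.eq_zero _ μ hμ.le]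

/-- The interaction with the profiles frozen at the final time. -/
def frozen (k : ℝ) (f g : ℝ → Plane → ℂ) (t : ℝ) (ζ : Plane) : ℂ :=
  ∫ μ : Plane, t * mker (t * phase k ζ μ) * (f t (ζ + μ) * conj (g t μ))

lemma frozen_eq (hf : IsCompactFamily R f) (hg : IsCompactFamily R' g) {t : ℝ} (ht : 0 ≤ t)
    (ζ : Plane) : frozen k f g t ζ = ∫ s in (0 : ℝ)..t, ∫ μ : Plane,
      Complex.exp (-Complex.I * s * phase k ζ μ) * (f t (ζ + μ) * conj (g t μ)) := by
  have h1 : Continuous fun z : ℝ × Plane => phase k ζ z.2 :=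
    continuous_phase_comp (by fun_prop) (by fun_prop)
  have h2 : Continuous fun z : ℝ × Plane => f t (ζ + z.2) :=
    hf.continuous_comp (by fun_prop) (by fun_prop)
  have h3 : Continuous fun z : ℝ × Plane => g t z.2 := hg.continuous_comp (by fun_prop) (by fun_prop)
  have h4 := Complex.continuous_conj.comp h3
  rw [intervalIntegral_integral_comm (F := fun s μ => Complex.exp (-Complex.I * s * phase k ζ μ) *
    (f t (ζ + μ) * conj (g t μ))) ((continuous_cexp_neg_I_mul continuous_fst h1).mul (h2.mul h4))
    (isCompact_closedBall 0 R') (fun s μ hμ => ?_) ht]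
  · simp only [intervalIntegral.integral_mul_const, integral_cexp_eq_mker]
    rfl
  · rw [mem_closedBall_zero_iff, not_le] at hμ
    simp [hg.eq_zero _ μ hμ.le]

lemma ae_ne (x : Plane) : ∀ᵐ μ : Plane, μ ≠ x := by
  rw [ae_iff]
  simp

/-- In the difference of the products one factor carries `s^(-1/4)` and the singularity of order
`1`, the other the singularity of order `2/3`. The total order `5/3` is below `2`, hence integrable
in the plane, and `∫₀ᵗ s^(-1/4) ds = (4/3) t^(3/4)` is of lower order than `t^(5/6)`. With the rate
`Θ^(-1/2)` instead, the total order would be the critical value `2`. -/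
lemma exists_duhamel_sub_frozen_le (hf : IsCompactFamily R f) (hg : IsCompactFamily R' g)
    (hfb : ProfBounds f C L) (hgb : ProfBounds g C' L') : ∃ K : ℝ, ∀ t ζ, 0 < t → ‖ζ‖ ≤ 1 →
      ‖duhamel k f g t ζ - frozen k f g t ζ‖ ≤ K * t ^ (3 / 4 : ℝ) := by
  have hC := hfb.nonneg
  have hC' := hgb.nonneg
  set D : ℝ := 4 * (C * C') * ballMass (5 / 3) (R' + 1) with hD
  have hD0 : 0 ≤ D := by have := ballMass_nonneg (5 / 3) (R' + 1); positivity
  refine ⟨D * (4 / 3), fun t ζ ht hζ => ?_⟩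
  have inner : ∀ s ∈ Set.Ioc 0 t, ‖interaction k f g s ζ - ∫ μ : Plane,
      Complex.exp (-Complex.I * s * phase k ζ μ) * (f t (ζ + μ) * conj (g t μ))‖
      ≤ D * s ^ (-(1 / 4) : ℝ) := by
    intro s hs
    have hs0 : 0 < s ^ (-(1 / 4) : ℝ) := Real.rpow_pos_of_pos hs.1 _
    unfold interaction
    rw [← integral_sub (integrable_interaction hf hg s s ζ) (integrable_interaction hf hg s t ζ)]
    obtain ⟨hi, hle⟩ := integrableOn_norm_add_rpow (by norm_num : (5 / 3 : ℝ) < 2) ζ R'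
    rw [← setIntegral_eq_integral_of_forall_compl_eq_zero (s := Metric.closedBall (0 : Plane) R')
      (fun μ hμ => by
        rw [mem_closedBall_zero_iff, not_le] at hμ
        simp [hg.eq_zero _ μ hμ.le])]
    have hb : ∀ᵐ μ ∂(volume.restrict (Metric.closedBall (0 : Plane) R')),
        ‖Complex.exp (-Complex.I * s * phase k ζ μ) * (f s (ζ + μ) * conj (g s μ)) -
          Complex.exp (-Complex.I * s * phase k ζ μ) * (f t (ζ + μ) * conj (g t μ))‖
        ≤ 2 * (C * C') * s ^ (-(1 / 4) : ℝ) * (‖ζ + μ‖ ^ (-(5 / 3) : ℝ) + ‖μ‖ ^ (-(5 / 3) : ℝ)) := by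
      filter_upwards [ae_restrict_of_ae (ae_ne 0), ae_restrict_of_ae (ae_ne (-ζ))] with μ h0 h1
      have h1' : ζ + μ ≠ 0 := fun h => h1 (by rw [eq_neg_iff_add_eq_zero, add_comm]; exact h)
      have n0 : 0 < ‖μ‖ := norm_pos_iff.2 h0
      have n1 : 0 < ‖ζ + μ‖ := norm_pos_iff.2 h1'
      rw [← mul_sub, norm_mul, norm_cexp_neg_I_mul, one_mul]
      have e : f s (ζ + μ) * conj (g s μ) - f t (ζ + μ) * conj (g t μ)
          = -((f t (ζ + μ) - f s (ζ + μ)) * conj (g s μ)) - f t (ζ + μ) * conj (g t μ - g s μ) := by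
        rw [map_sub]; ring
      have b1 := hfb.cauchy s t (ζ + μ) hs.1 hs.2 h1'
      have b2 := hgb.cauchy s t μ hs.1 hs.2 h0
      have b3 := hfb.bound t (ζ + μ) ht.le h1'
      have b4 := hgb.bound s μ hs.1.le h0
      have y1 := rpow_mul_rpow_le n1 n0 (p := 1) (q := 2 / 3) (by norm_num) (by norm_num)
      have y2 := rpow_mul_rpow_le n1 n0 (p := 2 / 3) (q := 1) (by norm_num) (by norm_num)
      norm_num only at y1 y2
      rw [Real.rpow_neg_one] at y1 y2
      rw [e]
      refine (norm_sub_le _ _).trans ?_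
      rw [norm_neg, norm_mul, norm_mul, RCLike.norm_conj, RCLike.norm_conj]
      calc _ ≤ (C * s ^ (-(1 / 4) : ℝ) * ‖ζ + μ‖⁻¹) * (C' * ‖μ‖ ^ (-(2 / 3) : ℝ))
            + (C * ‖ζ + μ‖ ^ (-(2 / 3) : ℝ)) * (C' * s ^ (-(1 / 4) : ℝ) * ‖μ‖⁻¹) := by
            gcongr
        _ = (C * C' * s ^ (-(1 / 4) : ℝ)) * (‖ζ + μ‖⁻¹ * ‖μ‖ ^ (-(2 / 3) : ℝ)
            + ‖ζ + μ‖ ^ (-(2 / 3) : ℝ) * ‖μ‖⁻¹) := by ring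
        _ ≤ (C * C' * s ^ (-(1 / 4) : ℝ)) * (2 * (‖ζ + μ‖ ^ (-(5 / 3) : ℝ)
            + ‖μ‖ ^ (-(5 / 3) : ℝ))) := by
            refine mul_le_mul_of_nonneg_left ?_ (by positivity)
            norm_num only at y1 y2 ⊢
            linarith
        _ = _ := by ring
    refine (norm_integral_le_of_norm_le (hi.const_mul _) hb).trans ?_
    rw [integral_const_mul]
    have : ballMass (5 / 3) (R' + ‖ζ‖) ≤ ballMass (5 / 3) (R' + 1) :=
      ballMass_mono (by norm_num) (by linarith)
    calc _ ≤ 2 * (C * C') * s ^ (-(1 / 4) : ℝ) * (2 * ballMass (5 / 3) (R' + 1)) := by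
          gcongr
          exact hle.trans (by linarith)
      _ = _ := by rw [hD]; ring
  have hcf : Continuous fun s : ℝ => ∫ μ : Plane,
      Complex.exp (-Complex.I * s * phase k ζ μ) * (f t (ζ + μ) * conj (g t μ)) := by
    have hf' : IsCompactFamily R (fun _ => f t) :=
      ⟨hf.continuous_comp continuous_const continuous_snd, fun _ => hf.eq_zero t⟩
    have hg' : IsCompactFamily R' (fun _ => g t) :=
      ⟨hg.continuous_comp continuous_const continuous_snd, fun _ => hg.eq_zero t⟩
    exact (continuous_interaction (k := k) hf' hg').comp (by fun_prop : Continuous fun s : ℝ => (s, ζ))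
  have hci : Continuous fun s => interaction k f g s ζ :=
    (continuous_interaction hf hg).comp (by fun_prop : Continuous fun s : ℝ => (s, ζ))
  rw [frozen_eq hf hg ht.le, duhamel, ← intervalIntegral.integral_sub (hci.intervalIntegrable _ _)
    (hcf.intervalIntegrable _ _)]
  refine (intervalIntegral.norm_integral_le_of_norm_le ht.le (Eventually.of_forall inner)
    ((intervalIntegral.intervalIntegrable_rpow' (by norm_num)).const_mul D)).trans ?_
  rw [intervalIntegral.integral_const_mul, integral_rpow (Or.inl (by norm_num)),
    Real.zero_rpow (by norm_num), show (-(1 / 4) + 1 : ℝ) = 3 / 4 by norm_num]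
  exact le_of_eq (by ring)

end

/-! ### Second generation: growth of the interaction at low frequency -/

/-- Large times `t` together with frequencies of length at most `t^(-4/5)`. -/
def window : Filter (ℝ × Plane) :=
  comap Prod.fst atTop ⊓ 𝓟 {x : ℝ × Plane | ‖x.2‖ ≤ x.1 ^ (-(4 / 5) : ℝ)}

instance : window.IsCountablyGenerated := by unfold window; infer_instance

lemma tendsto_fst_window : Tendsto Prod.fst window atTop := tendsto_comap.mono_left inf_le_left

lemma eventually_window : ∀ᶠ x : ℝ × Plane in window, ‖x.2‖ ≤ x.1 ^ (-(4 / 5) : ℝ) :=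
  mem_inf_of_right (mem_principal_self _)

/-- The length scale `t^(-1/4)`. -/
def scale (x : ℝ × Plane) : ℝ := x.1 ^ (-(1 / 4) : ℝ)

lemma tendsto_scale : Tendsto scale window (𝓝 0) :=
  (tendsto_rpow_neg_atTop (by norm_num)).comp tendsto_fst_window

lemma scale_pos {x : ℝ × Plane} (hx : 0 < x.1) : 0 < scale x := Real.rpow_pos_of_pos hx _

lemma scale_pow_four {x : ℝ × Plane} (hx : 0 < x.1) : scale x ^ 4 = x.1⁻¹ := by
  rw [scale, ← Real.rpow_natCast, ← Real.rpow_mul hx.le, ← Real.rpow_neg_one]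
  norm_num

/-- The window `t^(-4/5)` is slightly narrower than `scale³ = t^(-3/4)`, leaving a factor
`t^(-1/20)`. This removes the pairing `⟪ζ, μ⟫` from the limit phase. -/
lemma tendsto_scaled_frequency :
    Tendsto (fun x : ℝ × Plane => (scale x ^ 3)⁻¹ • x.2) window (𝓝 0) := by
  rw [tendsto_zero_iff_norm_tendsto_zero]
  have h : Tendsto (fun x : ℝ × Plane => x.1 ^ (-(1 / 20) : ℝ)) window (𝓝 0) :=
    (tendsto_rpow_neg_atTop (by norm_num)).comp tendsto_fst_window
  refine squeeze_zero' (Eventually.of_forall fun x => norm_nonneg _) ?_ h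
  filter_upwards [eventually_window, tendsto_fst_window.eventually_gt_atTop 0] with x hx h0
  have hs := scale_pos h0
  rw [norm_smul, Real.norm_of_nonneg (by positivity)]
  have e : (scale x ^ 3)⁻¹ = x.1 ^ (3 / 4 : ℝ) := by
    rw [scale, ← Real.rpow_natCast, ← Real.rpow_mul h0.le, ← Real.rpow_neg h0.le]
    norm_num
  rw [e]
  calc _ ≤ x.1 ^ (3 / 4 : ℝ) * x.1 ^ (-(4 / 5) : ℝ) := by gcongr
    _ = _ := by rw [← Real.rpow_add h0]; norm_num

lemma tendsto_shift : Tendsto (fun x : ℝ × Plane => (scale x)⁻¹ • x.2) window (𝓝 0) := by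
  have h := (tendsto_scale.pow 2).smul tendsto_scaled_frequency
  rw [smul_zero] at h
  refine h.congr' ?_
  filter_upwards [tendsto_fst_window.eventually_gt_atTop 0] with x h0
  have hs := scale_pos h0
  rw [smul_smul]
  congr 1
  field_simp

lemma jap_le {k : ℝ} (hk : 0 ≤ k) (x : Plane) : jap k x ≤ 1 + k * ‖x‖ ^ 2 := by
  have h1 := one_le_jap hk x
  have h2 := jap_sq hk x
  nlinarith

/-- For `|y| ≥ 1` and small `a` the quartic term dominates the pairing. The condition `l|y| ≤ R`,
true on the support of the profiles, keeps the denominators bounded, by `J` and `D`. Through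
`norm_mker_le` this provides the decay `|y|⁻⁴` at infinity needed for dominated convergence. -/
lemma exists_scaledPhase_ge {k : ℝ} (hk : 0 < k) (R : ℝ) : ∃ c η : ℝ, 0 < c ∧ 0 < η ∧
    ∀ (l : ℝ) (a y : Plane), 0 < l → l ≤ 1 → ‖a‖ ≤ η → 1 ≤ ‖y‖ → l * ‖y‖ ≤ R →
      c * ‖y‖ ^ 4 ≤ scaledPhase k l a y := by
  set J : ℝ := 2 + k + k * R ^ 2 with hJ
  have hJ0 : 0 < J := by positivity
  set D : ℝ := 2 * (1 + k / 2 * (1 + R) ^ 2) + J with hD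
  have hD0 : 0 < D := by positivity
  -- The quartic term is at least `k²|y|⁴/(4J²)`, and `η` is chosen so that the pairing takes at
  -- most half of it.
  refine ⟨k ^ 2 / (8 * J ^ 2 * D), min (1 / 2) (k / (32 * J ^ 2)), by positivity, by positivity,
    fun l a y hl hl1 ha hy hR => ?_⟩
  have ha1 : ‖a‖ ≤ 1 / 2 := ha.trans (min_le_left _ _)
  have ha2 : ‖a‖ ≤ k / (32 * J ^ 2) := ha.trans (min_le_right _ _)
  have n1 : ‖l ^ 3 • a‖ ≤ 1 := by
    rw [norm_smul, norm_pow, Real.norm_of_nonneg hl.le]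
    have : l ^ 3 ≤ 1 := pow_le_one₀ hl.le hl1
    nlinarith [norm_nonneg a, pow_pos hl 3]
  have n2 : ‖l • y‖ ≤ R := by rwa [norm_smul, Real.norm_of_nonneg hl.le]
  have n3 : ‖l ^ 3 • a + l • y‖ ≤ 1 + R := (norm_add_le _ _).trans (add_le_add n1 n2)
  have j1 := jap_le hk.le (l ^ 3 • a)
  have j2 := jap_le hk.le (l • y)
  have j3 := jap_le (by positivity : 0 ≤ k / 2) (l ^ 3 • a + l • y)
  have p1 := jap_pos hk.le (l ^ 3 • a)
  have p2 := jap_pos hk.le (l • y)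
  have p3 := jap_pos (by positivity : 0 ≤ k / 2) (l ^ 3 • a + l • y)
  have q1 : k * ‖l ^ 3 • a‖ ^ 2 ≤ k * 1 ^ 2 := by gcongr
  have q2 : k * ‖l • y‖ ^ 2 ≤ k * R ^ 2 := by gcongr
  have q3 : k / 2 * ‖l ^ 3 • a + l • y‖ ^ 2 ≤ k / 2 * (1 + R) ^ 2 := by gcongr
  unfold scaledPhase
  generalize jap k (l ^ 3 • a) = j₁ at *
  generalize jap k (l • y) = j₂ at *
  generalize jap (k / 2) (l ^ 3 • a + l • y) = j₃ at *
  have hJle : j₁ + j₂ ≤ J := by rw [hJ]; linarith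
  have hDle : 2 * j₃ + j₁ + j₂ ≤ D := by rw [hD]; linarith
  have i1 : (‖y‖ ^ 2 / 2) ^ 2 ≤ (l ^ 4 * ‖a‖ ^ 2 - ‖y‖ ^ 2) ^ 2 := by
    rw [← neg_sq (l ^ 4 * ‖a‖ ^ 2 - ‖y‖ ^ 2)]
    apply pow_le_pow_left₀ (by positivity)
    have h4 : l ^ 4 ≤ 1 := pow_le_one₀ hl.le hl1
    have h5 : ‖a‖ ^ 2 ≤ 1 / 4 := by nlinarith [norm_nonneg a]
    have h6 : l ^ 4 * ‖a‖ ^ 2 ≤ 1 * (1 / 4) := by gcongr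
    nlinarith
  have i2 : k ^ 2 * (‖y‖ ^ 2 / 2) ^ 2 / J ^ 2
      ≤ k ^ 2 * (l ^ 4 * ‖a‖ ^ 2 - ‖y‖ ^ 2) ^ 2 / (j₁ + j₂) ^ 2 := by gcongr
  have i3 : -(4 * k * (k / (32 * J ^ 2)) * ‖y‖ ^ 4) ≤ 4 * k * ⟪a, y⟫ := by
    have h1 := neg_le_of_abs_le (abs_real_inner_le_norm a y)
    have h2 : ‖y‖ ≤ ‖y‖ ^ 4 := le_self_pow₀ hy (by norm_num)
    have h3 : ‖a‖ * ‖y‖ ≤ k / (32 * J ^ 2) * ‖y‖ ^ 4 := by gcongr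
    nlinarith
  have i4 : k ^ 2 / (8 * J ^ 2) * ‖y‖ ^ 4
      ≤ k ^ 2 * (l ^ 4 * ‖a‖ ^ 2 - ‖y‖ ^ 2) ^ 2 / (j₁ + j₂) ^ 2 + 4 * k * ⟪a, y⟫ := by
    have : k ^ 2 / (8 * J ^ 2) * ‖y‖ ^ 4 = k ^ 2 * (‖y‖ ^ 2 / 2) ^ 2 / J ^ 2
        - 4 * k * (k / (32 * J ^ 2)) * ‖y‖ ^ 4 := by field_simp; ring
    linarith
  calc k ^ 2 / (8 * J ^ 2 * D) * ‖y‖ ^ 4 = (k ^ 2 / (8 * J ^ 2) * ‖y‖ ^ 4) / D := by field_simp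
    _ ≤ (k ^ 2 / (8 * J ^ 2) * ‖y‖ ^ 4) / (2 * j₃ + j₁ + j₂) := by gcongr
    _ ≤ _ := div_le_div_of_nonneg_right i4 (by positivity)

section

variable {k R R' C C' : ℝ} {f g : ℝ → Plane → ℂ} {L L' : ℂ}

/-- The integrand of the frozen interaction in scaled variables. -/
def scaledIntegrand (k : ℝ) (f g : ℝ → Plane → ℂ) (x : ℝ × Plane) (y : Plane) : ℂ :=
  mker (scaledPhase k (scale x) ((scale x ^ 3)⁻¹ • x.2) y) *
    ((((scale x) ^ (2 / 3 : ℝ) : ℝ) * f x.1 (scale x • ((scale x)⁻¹ • x.2 + y))) *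
      conj ((((scale x) ^ (2 / 3 : ℝ) : ℝ) : ℂ) * g x.1 (scale x • y)))

/-- The exponent count with `r = t^(-1/4)`: time gives `t`, area gives `r²`, and the two
singularities give `r^(-4/3)`; the product is `t^(5/6)`. The choice of `r` makes `t * phase` equal
to the scaled phase, because `r⁴ = 1/t`. -/
lemma frozen_scaled (hk : 0 ≤ k) {x : ℝ × Plane} (hx : 0 < x.1) :
    ((x.1 ^ (-(5 / 6) : ℝ) : ℝ) : ℂ) * frozen k f g x.1 x.2 = ∫ y, scaledIntegrand k f g x y := by
  obtain ⟨t, ζ⟩ := x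
  simp only at hx ⊢
  have hr : 0 < scale (t, ζ) := scale_pos hx
  have hr4 : scale (t, ζ) ^ 4 = t⁻¹ := scale_pow_four hx
  have hrt : t ^ (-(5 / 6) : ℝ) * (scale (t, ζ) ^ 2 * t)
      = scale (t, ζ) ^ (2 / 3 : ℝ) * scale (t, ζ) ^ (2 / 3 : ℝ) := by
    have h1 : scale (t, ζ) ^ 2 = t ^ (-(1 / 2) : ℝ) := by
      rw [scale, ← Real.rpow_natCast, ← Real.rpow_mul hx.le]; norm_num
    have h2 : scale (t, ζ) ^ (2 / 3 : ℝ) = t ^ (-(1 / 6) : ℝ) := by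
      rw [scale, ← Real.rpow_mul hx.le]; norm_num
    rw [h1, h2, ← Real.rpow_add_one hx.ne', ← Real.rpow_add hx, ← Real.rpow_add hx]
    norm_num
  unfold scaledIntegrand
  simp only
  generalize scale (t, ζ) = r at *
  have key := Measure.integral_comp_smul (volume : Measure Plane) (fun μ : Plane =>
    t * mker (t * phase k ζ μ) * (f t (ζ + μ) * conj (g t μ))) r
  rw [finrank_euclideanSpace_fin, abs_of_pos (by positivity)] at key
  have h1 : frozen k f g t ζ = (r ^ 2 : ℝ) * ∫ y : Plane,
      t * mker (t * phase k ζ (r • y)) * (f t (ζ + r • y) * conj (g t (r • y))) := by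
    rw [key, frozen, Complex.real_smul, ← mul_assoc, ← Complex.ofReal_mul,
      mul_inv_cancel₀ (by positivity)]
    simp
  rw [h1, ← mul_assoc, ← Complex.ofReal_mul, ← integral_const_mul]
  refine integral_congr_ae (Eventually.of_forall fun y => ?_)
  simp only
  have h2 : t * phase k ζ (r • y) = scaledPhase k r ((r ^ 3)⁻¹ • ζ) y := by
    have := phase_scaled hk r ((r ^ 3)⁻¹ • ζ) y
    rw [smul_smul, mul_inv_cancel₀ (by positivity), one_smul, hr4] at this
    rw [this]
    field_simp
  rw [h2, smul_add, smul_smul, mul_inv_cancel₀ hr.ne', one_smul, map_mul, Complex.conj_ofReal]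
  have h3 : ((t ^ (-(5 / 6) : ℝ) * r ^ 2 : ℝ) : ℂ) * t
      = ((r ^ (2 / 3 : ℝ) : ℝ) : ℂ) * ((r ^ (2 / 3 : ℝ) : ℝ) : ℂ) := by
    rw [← Complex.ofReal_mul, ← Complex.ofReal_mul, mul_assoc, hrt]
  linear_combination (mker (scaledPhase k r ((r ^ 3)⁻¹ • ζ) y) * (f t (ζ + r • y) *
    conj (g t (r • y)))) * h3

/-- At frequency `ξ = scale • v` one has `t|ξ|^(4/3) = t^(2/3)|v|^(4/3) → ∞`, so the profiles have
already reached their limiting form at the scale where the second interaction takes place. -/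
lemma ProfBounds.tendsto_scaled (hfb : ProfBounds f C L) {v : ℝ × Plane → Plane} {y : Plane}
    (hy : y ≠ 0) (hv : Tendsto v window (𝓝 y)) :
    Tendsto (fun x : ℝ × Plane => (((scale x) ^ (2 / 3 : ℝ) : ℝ) : ℂ) * f x.1 (scale x • v x)) window
      (𝓝 (((‖y‖ ^ (-(2 / 3) : ℝ) : ℝ) : ℂ) * L)) := by
  have hv0 : ∀ᶠ x in window, v x ≠ 0 := hv.eventually_ne hy
  have ht := tendsto_fst_window.eventually_gt_atTop 0
  have hlim := hfb.limit window Prod.fst (fun x => scale x • v x) ?_ ?_ ?_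
  · have h2 : Tendsto (fun x => ((‖v x‖ ^ (-(2 / 3) : ℝ) : ℝ) : ℂ)) window
        (𝓝 ((‖y‖ ^ (-(2 / 3) : ℝ) : ℝ) : ℂ)) :=
      (Complex.continuous_ofReal.tendsto _).comp
        (hv.norm.rpow_const (Or.inl (norm_ne_zero_iff.2 hy)))
    refine (h2.mul hlim).congr' ?_
    filter_upwards [hv0, ht] with x h0 h1
    have n0 := norm_pos_iff.2 h0
    have hs := scale_pos h1
    rw [← mul_assoc, ← Complex.ofReal_mul, norm_smul, Real.norm_of_nonneg hs.le,
      Real.mul_rpow hs.le n0.le, mul_comm (scale x ^ (2 / 3 : ℝ)), ← mul_assoc, ← Real.rpow_add n0]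
    norm_num
  · filter_upwards [hv0, ht] with x h0 h1
    exact smul_ne_zero (scale_pos h1).ne' h0
  · simpa using tendsto_scale.smul hv
  · have h2 : Tendsto (fun x => x.1 ^ (2 / 3 : ℝ) * ‖v x‖ ^ (4 / 3 : ℝ)) window atTop := by
      refine Tendsto.atTop_mul_pos (C := ‖y‖ ^ (4 / 3 : ℝ)) ?_
        ((tendsto_rpow_atTop (by norm_num)).comp tendsto_fst_window)
        (hv.norm.rpow_const (Or.inr (by norm_num)))
      have := norm_pos_iff.2 hy
      positivity
    refine h2.congr' ?_
    filter_upwards [ht] with x h1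
    have hs := scale_pos h1
    rw [norm_smul, Real.norm_of_nonneg hs.le, Real.mul_rpow hs.le (norm_nonneg _), ← mul_assoc]
    congr 1
    rw [scale, ← Real.rpow_mul h1.le]
    nth_rewrite 2 [← Real.rpow_one x.1]
    rw [← Real.rpow_add h1]
    norm_num

lemma ProfBounds.norm_scaled_le (hfb : ProfBounds f C L) {x : ℝ × Plane} (hx : 0 < x.1) {v : Plane}
    (hv : v ≠ 0) :
    ‖(((scale x) ^ (2 / 3 : ℝ) : ℝ) : ℂ) * f x.1 (scale x • v)‖ ≤ C * ‖v‖ ^ (-(2 / 3) : ℝ) := by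
  have hs := scale_pos hx
  have n0 := norm_pos_iff.2 hv
  have h := hfb.bound x.1 (scale x • v) hx.le (smul_ne_zero hs.ne' hv)
  rw [norm_mul, Complex.norm_real, Real.norm_of_nonneg (by positivity)]
  rw [norm_smul, Real.norm_of_nonneg hs.le, Real.mul_rpow hs.le n0.le] at h
  calc _ ≤ scale x ^ (2 / 3 : ℝ) * (C * (scale x ^ (-(2 / 3) : ℝ) * ‖v‖ ^ (-(2 / 3) : ℝ))) := by
        gcongr
    _ = (scale x ^ (2 / 3 : ℝ) * scale x ^ (-(2 / 3) : ℝ)) * (C * ‖v‖ ^ (-(2 / 3) : ℝ)) := by ring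
    _ = _ := by rw [← Real.rpow_add hs]; norm_num

end

/-- The limit of the scaled integrand, without its constant factor. -/
def limitIntegrand (k : ℝ) (y : Plane) : ℂ :=
  mker (k ^ 2 / 16 * ‖y‖ ^ 4) * ((‖y‖ ^ (-(4 / 3) : ℝ) : ℝ) : ℂ)

/-- An integrable majorant with the singularity `|y|^(-4/3)`. -/
def majorant (c : ℝ) (y : Plane) : ℝ :=
  (Metric.closedBall (0 : Plane) 1).indicator (fun y => ‖y‖ ^ (-(4 / 3) : ℝ)) y
    + c * (1 + ‖y‖) ^ (-4 : ℝ)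

lemma integrable_majorant (c : ℝ) : Integrable (majorant c) := by
  refine ((integrableOn_norm_rpow (by norm_num) 1).integrable_indicator
    Metric.isClosed_closedBall.measurableSet).add (Integrable.const_mul ?_ c)
  exact integrable_one_add_norm (by rw [finrank_euclideanSpace_fin]; norm_num)

lemma norm_mker_mul_le_majorant {c x : ℝ} {y : Plane} (hc : 0 < c)
    (hx : 1 ≤ ‖y‖ → c * ‖y‖ ^ 4 ≤ x) :
    ‖mker x‖ * ‖y‖ ^ (-(4 / 3) : ℝ) ≤ majorant (32 / c) y := by
  unfold majorant
  rcases le_or_gt ‖y‖ 1 with h | h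
  · rw [Set.indicator_of_mem (by simpa using h)]
    have h1 : ‖mker x‖ * ‖y‖ ^ (-(4 / 3) : ℝ) ≤ 1 * ‖y‖ ^ (-(4 / 3) : ℝ) := by
      gcongr; exact norm_mker_le_one x
    have h2 : 0 ≤ 32 / c * (1 + ‖y‖) ^ (-4 : ℝ) := by positivity
    linarith
  · have h0 : 0 < ‖y‖ := by linarith
    have hx0 : 0 < c * ‖y‖ ^ 4 := by positivity
    have hxc := hx h.le
    have h1 : ‖mker x‖ ≤ 2 / (c * ‖y‖ ^ 4) := by
      refine (norm_mker_le (hx0.trans_le hxc).ne').trans ?_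
      rw [abs_of_pos (hx0.trans_le hxc)]
      gcongr
    have h2 : ‖y‖ ^ (-(4 / 3) : ℝ) ≤ 1 := Real.rpow_le_one_of_one_le_of_nonpos h.le (by norm_num)
    have h3 : 2 / (c * ‖y‖ ^ 4) ≤ 32 / c * (1 + ‖y‖) ^ (-4 : ℝ) := by
      rw [Real.rpow_neg (by positivity), show (4 : ℝ) = (4 : ℕ) by norm_num, Real.rpow_natCast,
        ← div_eq_mul_inv, div_div, div_le_div_iff₀ (by positivity) (by positivity)]
      have : (1 + ‖y‖) ^ 4 ≤ (2 * ‖y‖) ^ 4 := by gcongr; linarith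
      have h5 : (2 * ‖y‖) ^ 4 = 16 * ‖y‖ ^ 4 := by ring
      nlinarith
    have h4 : 0 ≤ (Metric.closedBall (0 : Plane) 1).indicator
        (fun y => ‖y‖ ^ (-(4 / 3) : ℝ)) y := Set.indicator_nonneg (fun _ _ => by positivity) _
    calc _ ≤ 2 / (c * ‖y‖ ^ 4) * 1 := by gcongr
      _ ≤ _ := by linarith

lemma aestronglyMeasurable_limitIntegrand (k : ℝ) : AEStronglyMeasurable (limitIntegrand k) := by
  refine AEStronglyMeasurable.mul
    (continuous_mker.comp (by fun_prop)).aestronglyMeasurable ?_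
  exact (by fun_prop : Measurable fun y : Plane =>
    ((‖y‖ ^ (-(4 / 3) : ℝ) : ℝ) : ℂ)).aestronglyMeasurable

lemma integrable_limitIntegrand {k : ℝ} (hk : 0 < k) : Integrable (limitIntegrand k) := by
  refine (integrable_majorant (32 / (k ^ 2 / 16))).mono' (aestronglyMeasurable_limitIntegrand k)
    (Eventually.of_forall fun y => ?_)
  unfold limitIntegrand
  rw [norm_mul, Complex.norm_real, Real.norm_of_nonneg (by positivity)]
  exact norm_mker_mul_le_majorant (by positivity) fun _ => le_rfl

/-- The imaginary part of the kernel is `-(1 - cos x)/x`, which never changes sign on `x > 0` and is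
nonzero for `0 < x < 2`; no cancellation is possible. -/
lemma integral_limitIntegrand_ne_zero {k : ℝ} (hk : 0 < k) : ∫ y, limitIntegrand k y ≠ 0 := by
  have hi := integrable_limitIntegrand hk
  have him : ∀ y : Plane, y ≠ 0 → -(limitIntegrand k y).im
      = (1 - Real.cos (k ^ 2 / 16 * ‖y‖ ^ 4)) / (k ^ 2 / 16 * ‖y‖ ^ 4) * ‖y‖ ^ (-(4 / 3) : ℝ) := by
    intro y hy
    have := norm_pos_iff.2 hy
    unfold limitIntegrand
    rw [Complex.im_mul_ofReal, mker_im (by positivity)]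
    ring
  have hnn : ∀ y : Plane, 0 ≤ -(limitIntegrand k y).im := by
    intro y
    by_cases hy : y = 0
    · simp [hy, limitIntegrand, Real.zero_rpow]
    · rw [him y hy]
      have := Real.cos_le_one (k ^ 2 / 16 * ‖y‖ ^ 4)
      have : 0 ≤ 1 - Real.cos (k ^ 2 / 16 * ‖y‖ ^ 4) := by linarith
      positivity
  have hpos : 0 < ∫ y, -(limitIntegrand k y).im := by
    rw [integral_pos_iff_support_of_nonneg hnn hi.im.neg]
    have hopen : IsOpen {y : Plane | 0 < ‖y‖ ∧ k ^ 2 / 16 * ‖y‖ ^ 4 < 2} := by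
      have h1 : IsOpen {y : Plane | 0 < ‖y‖} := isOpen_lt continuous_const continuous_norm
      have h2 : IsOpen {y : Plane | k ^ 2 / 16 * ‖y‖ ^ 4 < 2} :=
        isOpen_lt (by fun_prop) continuous_const
      exact h1.inter h2
    have hne : {y : Plane | 0 < ‖y‖ ∧ k ^ 2 / 16 * ‖y‖ ^ 4 < 2}.Nonempty := by
      have hc : Tendsto (fun r : ℝ => k ^ 2 / 16 * r ^ 4) (𝓝[>] 0) (𝓝 (k ^ 2 / 16 * 0 ^ 4)) :=
        (by fun_prop : Continuous fun r : ℝ => k ^ 2 / 16 * r ^ 4).continuousWithinAt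
      obtain ⟨r, hr, hr0⟩ := ((hc.eventually_lt_const (by norm_num : _ < (2 : ℝ))).and
        self_mem_nhdsWithin).exists
      refine ⟨r • e₀, ?_⟩
      have hr0' : 0 < r := hr0
      have : ‖r • e₀‖ = r := by rw [norm_smul, norm_e₀, mul_one, Real.norm_of_nonneg hr0'.le]
      exact ⟨by rw [this]; exact hr0', by rw [this]; exact hr⟩
    refine (hopen.measure_pos volume hne).trans_le (measure_mono fun y hy => ?_)
    have hy0 : 0 < ‖y‖ := hy.1
    have hy2 : k ^ 2 / 16 * ‖y‖ ^ 4 < 2 := hy.2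
    rw [Function.mem_support, him y (norm_pos_iff.1 hy0)]
    have h1 : Real.cos (k ^ 2 / 16 * ‖y‖ ^ 4) < 1 := by
      have hx : 0 < k ^ 2 / 16 * ‖y‖ ^ 4 := by positivity
      have := Real.cos_lt_cos_of_nonneg_of_le_pi le_rfl
        (hy2.le.trans (by linarith [Real.pi_gt_three])) hx
      rwa [Real.cos_zero] at this
    have h2 : 0 < 1 - Real.cos (k ^ 2 / 16 * ‖y‖ ^ 4) := by linarith
    positivity
  intro h0
  have := integral_im hi
  rw [h0] at this
  rw [integral_neg] at hpos
  simp only [RCLike.im_eq_complex_im, Complex.zero_im] at this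
  linarith

section

variable {k R R' C C' : ℝ} {f g : ℝ → Plane → ℂ} {L L' : ℂ}

lemma continuous_scaledPhase_slice (hk : 0 ≤ k) (l : ℝ) (a : Plane) :
    Continuous fun y : Plane => scaledPhase k l a y := by
  have h : Continuous fun y : Plane => (l, a, y) := by fun_prop
  have h1 := (contDiff_scaledPhase hk).continuous.comp h
  simpa only [Function.comp_def] using h1

lemma integrable_scaledIntegrand (hk : 0 ≤ k) (hf : IsCompactFamily R f) (hg : IsCompactFamily R' g)
    {x : ℝ × Plane} (hx : 0 < x.1) : Integrable (scaledIntegrand k f g x) := by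
  have hs := scale_pos hx
  have h1 : Continuous fun y : Plane => scaledPhase k (scale x) ((scale x ^ 3)⁻¹ • x.2) y :=
    continuous_scaledPhase_slice hk _ _
  have h2 : Continuous fun y : Plane => f x.1 (scale x • ((scale x)⁻¹ • x.2 + y)) :=
    hf.continuous_comp (by fun_prop) (by fun_prop)
  have h3 : Continuous fun y : Plane => g x.1 (scale x • y) :=
    hg.continuous_comp (by fun_prop) (by fun_prop)
  refine Continuous.integrable_of_hasCompactSupport ((continuous_mker.comp h1).mul
    ((continuous_const.mul h2).mul (Complex.continuous_conj.comp (continuous_const.mul h3))))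
    (HasCompactSupport.intro (isCompact_closedBall 0 (R' / scale x)) fun y hy => ?_)
  rw [mem_closedBall_zero_iff, not_le, div_lt_iff₀ hs] at hy
  have : g x.1 (scale x • y) = 0 := hg.eq_zero _ _ (by
    rw [norm_smul, Real.norm_of_nonneg hs.le, mul_comm]; exact hy.le)
  simp [scaledIntegrand, this]

lemma norm_scaledIntegrand_le (hfb : ProfBounds f C L) (hgb : ProfBounds g C' L') {x : ℝ × Plane}
    (hx : 0 < x.1) {y : Plane} (hy : y ≠ 0) (hy' : (scale x)⁻¹ • x.2 + y ≠ 0) :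
    ‖scaledIntegrand k f g x y‖
      ≤ ‖mker (scaledPhase k (scale x) ((scale x ^ 3)⁻¹ • x.2) y)‖ * (C * C' *
        (‖(scale x)⁻¹ • x.2 + y‖ ^ (-(2 / 3) : ℝ) * ‖y‖ ^ (-(2 / 3) : ℝ))) := by
  have h1 := hfb.norm_scaled_le hx hy'
  have h2 := hgb.norm_scaled_le hx hy
  have := hfb.nonneg
  unfold scaledIntegrand
  rw [norm_mul, norm_mul _ (conj _), RCLike.norm_conj]
  refine mul_le_mul_of_nonneg_left ((mul_le_mul h1 h2 (norm_nonneg _) (by positivity)).trans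
    (le_of_eq (by ring))) (norm_nonneg _)

/-- The factor `f` is singular at the moving point `-ζ/scale`, for which the fixed majorant is of no
use. The disc containing it shrinks, and the mass of a singularity of order `4/3` in a shrinking
disc tends to zero. -/
lemma tendsto_integral_near (hfb : ProfBounds f C L) (hgb : ProfBounds g C' L') :
    Tendsto (fun x : ℝ × Plane => ∫ y in Metric.closedBall (0 : Plane) (2 * ‖(scale x)⁻¹ • x.2‖),
      scaledIntegrand k f g x y) window (𝓝 0) := by
  have hC := hfb.nonneg
  have hC' := hgb.nonneg
  have h1 : Tendsto (fun x : ℝ × Plane => C * C' * (2 * ballMass (4 / 3)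
      (2 * ‖(scale x)⁻¹ • x.2‖ + ‖(scale x)⁻¹ • x.2‖))) window (𝓝 (C * C' * (2 * 0))) := by
    refine Tendsto.const_mul _ (Tendsto.const_mul _ (tendsto_ballMass (by norm_num) ?_))
    have := tendsto_shift.norm
    simpa using (this.const_mul 2).add this
  rw [mul_zero, mul_zero] at h1
  refine squeeze_zero_norm' ?_ h1
  filter_upwards [tendsto_fst_window.eventually_gt_atTop 0] with x hx
  obtain ⟨hi, hle⟩ := integrableOn_norm_add_rpow (by norm_num : (4 / 3 : ℝ) < 2)
    ((scale x)⁻¹ • x.2) (2 * ‖(scale x)⁻¹ • x.2‖)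
  refine (norm_integral_le_of_norm_le (hi.const_mul (C * C')) ?_).trans ?_
  · filter_upwards [ae_restrict_of_ae (ae_ne 0), ae_restrict_of_ae (ae_ne (-((scale x)⁻¹ • x.2)))]
      with y hy hy'
    have hy1 : (scale x)⁻¹ • x.2 + y ≠ 0 := fun h =>
      hy' (by rw [eq_neg_iff_add_eq_zero, add_comm]; exact h)
    refine (norm_scaledIntegrand_le hfb hgb hx hy hy1).trans ?_
    have h2 := rpow_mul_rpow_le (norm_pos_iff.2 hy1) (norm_pos_iff.2 hy) (p := 2 / 3) (q := 2 / 3)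
      (by norm_num) (by norm_num)
    rw [show (2 / 3 + 2 / 3 : ℝ) = 4 / 3 by norm_num] at h2
    refine (mul_le_of_le_one_left (by positivity) (norm_mker_le_one _)).trans ?_
    gcongr
  · rw [integral_const_mul]
    gcongr

/-- Outside the disc `|ζ/scale + y| ≥ |y|/2`, so the moving singularity is controlled by the fixed
one at `y = 0`, and dominated convergence applies. -/
lemma tendsto_integral_far (hk : 0 < k) (hf : IsCompactFamily R f) (hg : IsCompactFamily R' g)
    (hfb : ProfBounds f C L) (hgb : ProfBounds g C' L') :
    Tendsto (fun x : ℝ × Plane => ∫ y, (Metric.closedBall (0 : Plane)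
      (2 * ‖(scale x)⁻¹ • x.2‖))ᶜ.indicator (scaledIntegrand k f g x) y) window
      (𝓝 (∫ y, limitIntegrand k y * (L * conj L'))) := by
  have hC := hfb.nonneg
  have hC' := hgb.nonneg
  obtain ⟨c, η, hc, hη, hph⟩ := exists_scaledPhase_ge hk R'
  have hx0 := tendsto_fst_window.eventually_gt_atTop 0
  refine tendsto_integral_filter_of_dominated_convergence
    (fun y => (2 * (C * C')) * majorant (32 / c) y) ?_ ?_ ((integrable_majorant _).const_mul _) ?_
  · filter_upwards [hx0] with x hx
    exact (integrable_scaledIntegrand hk.le hf hg hx).aestronglyMeasurable.indicator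
      Metric.isClosed_closedBall.measurableSet.compl
  · have h1 : ∀ᶠ x in window, ‖(scale x ^ 3)⁻¹ • x.2‖ ≤ η := by
      have := tendsto_scaled_frequency.norm
      rw [norm_zero] at this
      exact this.eventually_le_const hη
    have h2 : ∀ᶠ x in window, scale x ≤ 1 := tendsto_scale.eventually_le_const one_pos
    filter_upwards [hx0, h1, h2] with x hx hx1 hx2
    have hs := scale_pos hx
    filter_upwards [ae_ne 0] with y hy
    have n0 := norm_pos_iff.2 hy
    have hM : 0 ≤ majorant (32 / c) y :=
      add_nonneg (Set.indicator_nonneg (fun _ _ => by positivity) _) (by positivity)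
    by_cases hmem : y ∈ (Metric.closedBall (0 : Plane) (2 * ‖(scale x)⁻¹ • x.2‖))ᶜ
    swap
    · rw [Set.indicator_of_notMem hmem, norm_zero]; positivity
    rw [Set.indicator_of_mem hmem]
    rw [Set.mem_compl_iff, mem_closedBall_zero_iff, not_le] at hmem
    by_cases hR : R' ≤ scale x * ‖y‖
    · have : g x.1 (scale x • y) = 0 := hg.eq_zero _ _ (by
        rw [norm_smul, Real.norm_of_nonneg hs.le]; exact hR)
      simp only [scaledIntegrand, this, mul_zero, map_zero, norm_zero]
      positivity
    · have hw : ‖y‖ / 2 ≤ ‖(scale x)⁻¹ • x.2 + y‖ := by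
        have := norm_sub_le ((scale x)⁻¹ • x.2 + y) ((scale x)⁻¹ • x.2)
        rw [add_sub_cancel_left] at this
        linarith
      have hy1 : (scale x)⁻¹ • x.2 + y ≠ 0 := norm_pos_iff.1 (by linarith)
      refine (norm_scaledIntegrand_le hfb hgb hx hy hy1).trans ?_
      have h3 : ‖(scale x)⁻¹ • x.2 + y‖ ^ (-(2 / 3) : ℝ) ≤ 2 * ‖y‖ ^ (-(2 / 3) : ℝ) := by
        refine (Real.rpow_le_rpow_of_nonpos (by positivity) hw (by norm_num)).trans ?_
        rw [Real.div_rpow n0.le (by norm_num), div_eq_mul_inv, ← Real.rpow_neg (by norm_num),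
          mul_comm]
        gcongr
        rw [neg_neg]
        calc (2 : ℝ) ^ (2 / 3 : ℝ) ≤ 2 ^ (1 : ℝ) :=
              Real.rpow_le_rpow_of_exponent_le (by norm_num) (by norm_num)
          _ = 2 := Real.rpow_one 2
      have h4 := norm_mker_mul_le_majorant (y := y) hc fun h => hph (scale x)
        ((scale x ^ 3)⁻¹ • x.2) y hs hx2 hx1 h (by linarith)
      have h5 : ‖y‖ ^ (-(2 / 3) : ℝ) * ‖y‖ ^ (-(2 / 3) : ℝ) = ‖y‖ ^ (-(4 / 3) : ℝ) := by
        rw [← Real.rpow_add n0]; norm_num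
      calc _ ≤ ‖mker (scaledPhase k (scale x) ((scale x ^ 3)⁻¹ • x.2) y)‖ * (C * C' *
            ((2 * ‖y‖ ^ (-(2 / 3) : ℝ)) * ‖y‖ ^ (-(2 / 3) : ℝ))) := by gcongr
        _ = 2 * (C * C') * (‖mker (scaledPhase k (scale x) ((scale x ^ 3)⁻¹ • x.2) y)‖ *
            ‖y‖ ^ (-(4 / 3) : ℝ)) := by rw [← h5]; ring
        _ ≤ _ := by gcongr
  · filter_upwards [ae_ne 0] with y hy
    have n0 := norm_pos_iff.2 hy
    have hv : Tendsto (fun x : ℝ × Plane => (scale x)⁻¹ • x.2 + y) window (𝓝 y) := by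
      simpa using tendsto_shift.add_const y
    have l1 := hfb.tendsto_scaled hy hv
    have l2 := hgb.tendsto_scaled hy (tendsto_const_nhds (x := y))
    have l3 : Tendsto (fun x : ℝ × Plane => mker (scaledPhase k (scale x)
        ((scale x ^ 3)⁻¹ • x.2) y)) window (𝓝 (mker (k ^ 2 / 16 * ‖y‖ ^ 4))) := by
      have h1 : Tendsto (fun x : ℝ × Plane => (scale x, (scale x ^ 3)⁻¹ • x.2, y)) window
          (𝓝 (0, 0, y)) :=
        tendsto_scale.prodMk_nhds (tendsto_scaled_frequency.prodMk_nhds tendsto_const_nhds)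
      have h2 := ((contDiff_scaledPhase hk.le).continuous.tendsto (0, 0, y)).comp h1
      simp only [scaledPhase_zero, inner_zero_left, mul_zero, add_zero] at h2
      exact (continuous_mker.tendsto _).comp h2
    have l4 := l3.mul (l1.mul ((Complex.continuous_conj.tendsto _).comp l2))
    have e : mker (k ^ 2 / 16 * ‖y‖ ^ 4) * (((‖y‖ ^ (-(2 / 3) : ℝ) : ℝ) : ℂ) * L *
        conj (((‖y‖ ^ (-(2 / 3) : ℝ) : ℝ) : ℂ) * L')) = limitIntegrand k y * (L * conj L') := by
      unfold limitIntegrand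
      rw [map_mul, Complex.conj_ofReal, show (-(4 / 3) : ℝ) = -(2 / 3) + -(2 / 3) by norm_num,
        Real.rpow_add n0]
      push_cast
      ring
    rw [← e]
    refine l4.congr' ?_
    have h5 : Tendsto (fun x : ℝ × Plane => 2 * ‖(scale x)⁻¹ • x.2‖) window (𝓝 0) := by
      simpa using tendsto_shift.norm.const_mul 2
    filter_upwards [h5.eventually_lt_const n0] with x hx
    rw [Set.indicator_of_mem (by
      rw [Set.mem_compl_iff, mem_closedBall_zero_iff, not_le]; exact hx)]
    rfl

lemma tendsto_frozen (hk : 0 < k) (hf : IsCompactFamily R f) (hg : IsCompactFamily R' g)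
    (hfb : ProfBounds f C L) (hgb : ProfBounds g C' L') :
    Tendsto (fun x : ℝ × Plane => ((x.1 ^ (-(5 / 6) : ℝ) : ℝ) : ℂ) * frozen k f g x.1 x.2) window
      (𝓝 ((∫ y, limitIntegrand k y) * (L * conj L'))) := by
  have h := (tendsto_integral_near (k := k) hfb hgb).add (tendsto_integral_far hk hf hg hfb hgb)
  rw [zero_add, integral_mul_const] at h
  refine h.congr' ?_
  filter_upwards [tendsto_fst_window.eventually_gt_atTop 0] with x hx
  rw [frozen_scaled hk.le hx, integral_indicator Metric.isClosed_closedBall.measurableSet.compl,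
    integral_add_compl Metric.isClosed_closedBall.measurableSet
      (integrable_scaledIntegrand hk.le hf hg hx)]

/-- After normalization the freezing error is `t^(3/4 - 5/6) = t^(-1/12)`, so only the frozen
interaction contributes to the limit. -/
lemma tendsto_duhamel (hk : 0 < k) (hf : IsCompactFamily R f) (hg : IsCompactFamily R' g)
    (hfb : ProfBounds f C L) (hgb : ProfBounds g C' L') :
    Tendsto (fun x : ℝ × Plane => ((x.1 ^ (-(5 / 6) : ℝ) : ℝ) : ℂ) * duhamel k f g x.1 x.2) window
      (𝓝 ((∫ y, limitIntegrand k y) * (L * conj L'))) := by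
  obtain ⟨K, hK⟩ := exists_duhamel_sub_frozen_le (k := k) hf hg hfb hgb
  have h1 : Tendsto (fun x : ℝ × Plane => ((x.1 ^ (-(5 / 6) : ℝ) : ℝ) : ℂ) *
      (duhamel k f g x.1 x.2 - frozen k f g x.1 x.2)) window (𝓝 0) := by
    have h2 : Tendsto (fun x : ℝ × Plane => K * x.1 ^ (-(1 / 12) : ℝ)) window (𝓝 (K * 0)) :=
      Tendsto.const_mul K ((tendsto_rpow_neg_atTop (by norm_num)).comp tendsto_fst_window)
    rw [mul_zero] at h2
    refine squeeze_zero_norm' ?_ h2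
    filter_upwards [tendsto_fst_window.eventually_ge_atTop 1, eventually_window] with x hx hx'
    have h0 : 0 < x.1 := by linarith
    have h3 := hK x.1 x.2 h0 (hx'.trans (Real.rpow_le_one_of_one_le_of_nonpos hx (by norm_num)))
    rw [norm_mul, Complex.norm_real, Real.norm_of_nonneg (by positivity)]
    calc _ ≤ x.1 ^ (-(5 / 6) : ℝ) * (K * x.1 ^ (3 / 4 : ℝ)) := by gcongr
      _ = K * (x.1 ^ (-(5 / 6) : ℝ) * x.1 ^ (3 / 4 : ℝ)) := by ring
      _ = _ := by rw [← Real.rpow_add h0]; norm_num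
  have h4 := h1.add (tendsto_frozen hk hf hg hfb hgb)
  rw [zero_add] at h4
  refine h4.congr fun x => ?_
  ring

/-- The interaction grows at low frequencies. -/
lemma exists_duhamel_ge (hk : 0 < k) (hf : IsCompactFamily R f) (hg : IsCompactFamily R' g)
    (hfb : ProfBounds f C L) (hgb : ProfBounds g C' L') : ∃ c T : ℝ, 0 < c ∧ 0 < T ∧
      ∀ t ζ, T ≤ t → ‖ζ‖ ≤ t ^ (-(4 / 5) : ℝ) → c * t ^ (5 / 6 : ℝ) ≤ ‖duhamel k f g t ζ‖ := by
  have hne : (∫ y, limitIntegrand k y) * (L * conj L') ≠ 0 :=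
    mul_ne_zero (integral_limitIntegrand_ne_zero hk) (mul_ne_zero hfb.ne_zero
      (by simpa using hgb.ne_zero))
  have hlim := tendsto_duhamel hk hf hg hfb hgb
  generalize (∫ y, limitIntegrand k y) * (L * conj L') = M at hne hlim
  have hM0 : 0 < ‖M‖ := norm_pos_iff.2 hne
  have h := hlim.norm.eventually_const_lt (half_lt_self hM0)
  rw [window, eventually_inf_principal, eventually_comap] at h
  obtain ⟨T, hT⟩ := eventually_atTop.1 h
  refine ⟨‖M‖ / 2, max T 1, by positivity, by positivity, fun t ζ ht hζ => ?_⟩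
  have ht0 : 0 < t := lt_of_lt_of_le one_pos ((le_max_right _ _).trans ht)
  have h1 := hT t ((le_max_left _ _).trans ht) (t, ζ) rfl hζ
  simp only at h1
  rw [norm_mul, Complex.norm_real, Real.norm_of_nonneg (by positivity)] at h1
  calc _ ≤ (t ^ (-(5 / 6) : ℝ) * ‖duhamel k f g t ζ‖) * t ^ (5 / 6 : ℝ) := by gcongr
    _ = (t ^ (-(5 / 6) : ℝ) * t ^ (5 / 6 : ℝ)) * ‖duhamel k f g t ζ‖ := by ring
    _ = _ := by rw [← Real.rpow_add ht0]; norm_num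

end

/-! ### From frequency profiles to solutions in `L²` -/

section

variable {R R' : ℝ} {f f' g h : ℝ → Plane → ℂ}

lemma IsCompactFamily.continuous_slice (hf : IsCompactFamily R f) (t : ℝ) : Continuous (f t) :=
  hf.continuous_comp continuous_const continuous_id

lemma IsCompactFamily.hasCompactSupport (hf : IsCompactFamily R f) (t : ℝ) :
    HasCompactSupport (f t) :=
  HasCompactSupport.intro (isCompact_closedBall 0 R) fun x hx => hf.eq_zero t x (by
    rw [mem_closedBall_zero_iff, not_le] at hx; exact hx.le)

lemma IsCompactFamily.memLp (hf : IsCompactFamily R f) (t : ℝ) : MemLp (f t) 2 volume :=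
  (hf.continuous_slice t).memLp_of_hasCompactSupport (hf.hasCompactSupport t)

lemma IsCompactFamily.integrable (hf : IsCompactFamily R f) (t : ℝ) : Integrable (f t) :=
  (hf.continuous_slice t).integrable_of_hasCompactSupport (hf.hasCompactSupport t)

/-- The members of a compact family as elements of `L²`. -/
def IsCompactFamily.toL2 (hf : IsCompactFamily R f) (t : ℝ) : L2 := (hf.memLp t).toLp (f t)

lemma IsCompactFamily.coeFn_toL2 (hf : IsCompactFamily R f) (t : ℝ) :
    hf.toL2 t =ᵐ[volume] f t := (hf.memLp t).coeFn_toLp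

lemma norm_toLp_le {F : Plane → ℂ} (hF : MemLp F 2 volume) {M : ℝ} (hM : 0 ≤ M)
    (hFM : ∀ x, ‖F x‖ ≤ M) (hF0 : ∀ x, R ≤ ‖x‖ → F x = 0) :
    ‖hF.toLp F‖ ≤ volume.real (Metric.closedBall (0 : Plane) R) ^ (1 / 2 : ℝ) * M := by
  have hs : Function.support F ⊆ Metric.closedBall 0 R := fun x hx => by
    rw [mem_closedBall_zero_iff]
    by_contra hcon
    exact hx (hF0 x (by linarith))
  have h1 : eLpNorm F 2 volume ≤ volume (Metric.closedBall (0 : Plane) R) ^ (1 / 2 : ℝ) *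
      ENNReal.ofReal M := by
    rw [← eLpNorm_restrict_eq_of_support_subset hs]
    refine (eLpNorm_le_of_ae_bound (Eventually.of_forall hFM)).trans (le_of_eq ?_)
    rw [Measure.restrict_apply_univ]
    norm_num
  rw [Lp.norm_toLp]
  have hfin : volume (Metric.closedBall (0 : Plane) R) ≠ ⊤ :=
    (isCompact_closedBall _ _).measure_lt_top.ne
  refine (ENNReal.toReal_mono (ENNReal.mul_ne_top (ENNReal.rpow_ne_top_of_nonneg (by norm_num) hfin)
    ENNReal.ofReal_ne_top) h1).trans (le_of_eq ?_)
  rw [ENNReal.toReal_mul, ENNReal.toReal_ofReal hM, ← ENNReal.toReal_rpow, Measure.real]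

/-- A compact family whose pointwise derivative is a compact family is differentiable in `L²`. -/
lemma IsCompactFamily.hasDerivAt_toL2 (hf : IsCompactFamily R f) (hf' : IsCompactFamily R' f')
    (hd : ∀ t ξ, HasDerivAt (fun s => f s ξ) (f' t ξ) t) (t : ℝ) :
    HasDerivAt hf.toL2 (hf'.toL2 t) t := by
  set V : ℝ := volume.real (Metric.closedBall (0 : Plane) (max R R')) ^ (1 / 2 : ℝ) with hV
  have hV0 : 0 ≤ V := by positivity
  rw [hasDerivAt_iff_isLittleO, Asymptotics.isLittleO_iff]
  intro c hc
  set ε : ℝ := c / (V + 1) with hε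
  have hε0 : 0 < ε := by positivity
  have hunif : ∀ᶠ s in 𝓝 t, ∀ ξ ∈ Metric.closedBall (0 : Plane) R', ‖f' s ξ - f' t ξ‖ < ε := by
    refine (isCompact_closedBall (0 : Plane) R').eventually_forall_of_forall_eventually fun ξ _ => ?_
    have h1 : Continuous fun z : ℝ × Plane => ‖f' z.1 z.2 - f' t z.2‖ :=
      ((hf'.continuous_comp continuous_fst continuous_snd).sub
        (hf'.continuous_comp continuous_const continuous_snd)).norm
    exact (h1.tendsto (t, ξ)).eventually (gt_mem_nhds (by simpa using hε0))
  obtain ⟨η, hη, hηs⟩ := Metric.eventually_nhds_iff_ball.1 hunif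
  filter_upwards [Metric.ball_mem_nhds t hη] with s hs
  -- The mean value inequality at each frequency gives a uniform bound, and on a fixed ball a
  -- uniform bound controls the `L²` norm.
  have hpt : ∀ ξ, ‖f s ξ - f t ξ - (s - t) • f' t ξ‖ ≤ ε * ‖s - t‖ := by
    intro ξ
    have hd' : ∀ r ∈ Metric.ball t η, HasDerivWithinAt (fun r => f r ξ - (r - t) • f' t ξ)
        (f' r ξ - f' t ξ) (Metric.ball t η) r := by
      intro r _
      have h2 : HasDerivAt (fun r : ℝ => (r - t) • f' t ξ) ((1 : ℝ) • f' t ξ) r :=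
        ((hasDerivAt_id r).sub_const t).smul_const (f' t ξ)
      rw [one_smul] at h2
      exact ((hd r ξ).sub h2).hasDerivWithinAt
    have hb : ∀ r ∈ Metric.ball t η, ‖f' r ξ - f' t ξ‖ ≤ ε := by
      intro r hr
      by_cases hξ : ξ ∈ Metric.closedBall (0 : Plane) R'
      · exact (hηs r hr ξ hξ).le
      · rw [mem_closedBall_zero_iff, not_le] at hξ
        rw [hf'.eq_zero r ξ hξ.le, hf'.eq_zero t ξ hξ.le, sub_self, norm_zero]
        exact hε0.le
    have := (convex_ball t η).norm_image_sub_le_of_norm_hasDerivWithin_le hd' hb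
      (Metric.mem_ball_self hη) hs
    simp only [sub_self, zero_smul, sub_zero] at this
    rwa [sub_right_comm] at this
  have e : hf.toL2 s - hf.toL2 t - (s - t) • hf'.toL2 t
      = (((hf.memLp s).sub (hf.memLp t)).sub ((hf'.memLp t).const_smul (s - t))).toLp
        (f s - f t - (s - t) • f' t) := by
    rw [MemLp.toLp_sub ((hf.memLp s).sub (hf.memLp t)) ((hf'.memLp t).const_smul (s - t)),
      MemLp.toLp_sub (hf.memLp s) (hf.memLp t), MemLp.toLp_const_smul (s - t) (hf'.memLp t)]
    rfl
  rw [e]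
  refine (norm_toLp_le (R := max R R') _ (by positivity) hpt fun ξ hξ => ?_).trans ?_
  · simp [hf.eq_zero _ ξ ((le_max_left _ _).trans hξ), hf'.eq_zero _ ξ ((le_max_right _ _).trans hξ)]
  · rw [← hV, ← mul_assoc]
    refine mul_le_mul_of_nonneg_right ?_ (norm_nonneg _)
    rw [hε, mul_div_assoc', div_le_iff₀ (by positivity)]
    nlinarith

/-- The inverse Fourier transform in `L²` of a continuous function with compact support is given
by the integral. -/
lemma IsCompactFamily.fourierInv_toL2 (hf : IsCompactFamily R f) (t : ℝ) :
    (𝓕⁻ (hf.toL2 t) : L2) =ᵐ[volume] 𝓕⁻ (f t) := by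
  have hL : Continuous fun p : Plane × Plane => ((-innerₗ Plane) p.1) p.2 := continuous_inner.neg
  have hcont : Continuous (𝓕⁻ (f t)) :=
    VectorFourier.fourierIntegral_continuous Real.continuous_fourierChar hL (hf.integrable t)
  -- The two transforms are compared as distributions: the one in `L²` through its action on
  -- Schwartz functions, the integral by moving the transform to the test function.
  refine ae_eq_of_integral_contDiff_smul_eq
    ((Lp.memLp _).locallyIntegrable (by norm_num)) hcont.locallyIntegrable fun φ hφ hφc => ?_
  set G : 𝓢(Plane, ℂ) := (hφc.comp_left (g := fun x : ℝ => (x : ℂ)) Complex.ofReal_zero).toSchwartzMap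
    (Complex.ofRealCLM.contDiff.comp hφ) with hG
  have hGφ : ∀ x, G x = (φ x : ℂ) := fun x => rfl
  have h1 := congrArg (fun T : 𝓢'(Plane, ℂ) => T G)
    (Lp.fourierInv_toTemperedDistribution_eq (hf.toL2 t))
  simp only [TemperedDistribution.fourierInv_apply, Lp.toTemperedDistribution_apply, hGφ] at h1
  have h2 : ∫ x, (𝓕⁻ G) x • (hf.toL2 t : Plane → ℂ) x = ∫ x, (𝓕⁻ G) x • f t x :=
    integral_congr_ae ((hf.coeFn_toL2 t).mono fun x hx => by simp only [hx])
  have h3 := VectorFourier.integral_fourierIntegral_smul_eq_flip (μ := (volume : Measure Plane))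
    (ν := (volume : Measure Plane)) (L := -innerₗ Plane) Real.continuous_fourierChar hL
    G.integrable (hf.integrable t)
  have h4 : ∫ x, (𝓕⁻ G) x • f t x = ∫ x, G x • 𝓕⁻ (f t) x := by
    have hflip : (-innerₗ Plane).flip = -innerₗ Plane := by
      ext x y
      simp [real_inner_comm]
    rw [hflip] at h3
    rw [SchwartzMap.fourierInv_coe]
    exact h3
  rw [h2, h4] at h1
  simp only [hGφ] at h1
  simpa using h1.symm

/-- `∫ f(ζ + μ) conj g(μ) dμ`, the Fourier transform of a product with a complex conjugate. -/
def correlation (f g : ℝ → Plane → ℂ) (t : ℝ) (ζ : Plane) : ℂ := ∫ μ, f t (ζ + μ) * conj (g t μ)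

lemma continuous_correlation_integrand (hf : IsCompactFamily R f) (hg : IsCompactFamily R' g) :
    Continuous fun z : (ℝ × Plane) × Plane => f z.1.1 (z.1.2 + z.2) * conj (g z.1.1 z.2) :=
  (hf.continuous_comp (by fun_prop) (by fun_prop)).mul (Complex.continuous_conj.comp
    (hg.continuous_comp (by fun_prop) (by fun_prop)))

lemma correlation_integrand_eq_zero (hf : IsCompactFamily R f) (hg : IsCompactFamily R' g)
    (t : ℝ) {ζ μ : Plane} (h : R + R' ≤ ‖ζ‖ ∨ R' ≤ ‖μ‖) : f t (ζ + μ) * conj (g t μ) = 0 := by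
  by_cases hμ : R' ≤ ‖μ‖
  · rw [hg.eq_zero t μ hμ, map_zero, mul_zero]
  · have hζ := h.resolve_right hμ
    rw [hf.eq_zero t (ζ + μ), zero_mul]
    have := norm_sub_le (ζ + μ) μ
    rw [add_sub_cancel_right] at this
    linarith

lemma IsCompactFamily.correlation (hf : IsCompactFamily R f) (hg : IsCompactFamily R' g) :
    IsCompactFamily (R + R') (correlation f g) := by
  refine ⟨?_, fun t ζ hζ => ?_⟩
  · have : (fun x : ℝ × Plane => KleinGordon.correlation f g x.1 x.2) = fun x : ℝ × Plane =>
        ∫ μ in Metric.closedBall (0 : Plane) R', f x.1 (x.2 + μ) * conj (g x.1 μ) := by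
      ext x
      refine (setIntegral_eq_integral_of_forall_compl_eq_zero fun μ hμ => ?_).symm
      rw [mem_closedBall_zero_iff, not_le] at hμ
      exact correlation_integrand_eq_zero hf hg _ (Or.inr hμ.le)
    rw [this]
    exact continuous_parametric_integral_of_continuous (continuous_correlation_integrand hf hg)
      (isCompact_closedBall _ _)
  · unfold KleinGordon.correlation
    simp only [correlation_integrand_eq_zero hf hg t (Or.inl hζ), integral_zero]

lemma fourierInv_correlation (hf : IsCompactFamily R f) (hg : IsCompactFamily R' g) (t : ℝ)
    (x : Plane) : 𝓕⁻ (correlation f g t) x = 𝓕⁻ (f t) x * conj (𝓕⁻ (g t) x) := by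
  simp only [Real.fourierInv_eq', smul_eq_mul]
  set E : Plane → ℂ := fun v => Complex.exp ((2 * Real.pi * ⟪v, x⟫ : ℝ) * Complex.I) with hE
  have hEc : Continuous E := by simp only [hE]; fun_prop
  have hEadd : ∀ v w, E v = E (v + w) * conj (E w) := by
    intro v w
    simp only [hE]
    rw [← Complex.exp_conj, ← Complex.exp_add]
    congr 1
    simp only [map_mul, Complex.conj_ofReal, Complex.conj_I, inner_add_left]
    push_cast
    ring
  have h1 : ∀ ζ, E ζ * correlation f g t ζ = ∫ μ, E ζ * (f t (ζ + μ) * conj (g t μ)) := fun ζ => by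
    rw [integral_const_mul]; rfl
  have hc : Continuous (Function.uncurry fun ζ μ => E ζ * (f t (ζ + μ) * conj (g t μ))) :=
    (hEc.comp continuous_fst).mul ((continuous_correlation_integrand hf hg).comp
      (by fun_prop : Continuous fun z : Plane × Plane => ((t, z.1), z.2)))
  calc ∫ ζ, E ζ * correlation f g t ζ
      = ∫ μ, ∫ ζ, E ζ * (f t (ζ + μ) * conj (g t μ)) := by
        simp only [h1]
        refine integral_integral_swap_of_hasCompactSupport hc (HasCompactSupport.intro
          ((isCompact_closedBall (0 : Plane) (R + R')).prod (isCompact_closedBall (0 : Plane) R'))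
          fun z hz => ?_)
        simp only [Function.uncurry]
        rw [correlation_integrand_eq_zero hf hg t, mul_zero]
        by_contra hcon
        push Not at hcon
        exact hz ⟨by rw [mem_closedBall_zero_iff]; exact hcon.1.le,
          by rw [mem_closedBall_zero_iff]; exact hcon.2.le⟩
    _ = ∫ μ, (∫ ζ, E ζ * f t ζ) * conj (E μ * g t μ) := by
        refine integral_congr_ae (Eventually.of_forall fun μ => ?_)
        simp only
        rw [← integral_mul_const, ← integral_add_right_eq_self (fun ζ => E ζ * f t ζ *
          conj (E μ * g t μ)) μ]
        refine integral_congr_ae (Eventually.of_forall fun ζ => ?_)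
        simp only
        rw [hEadd ζ μ, map_mul]
        ring
    _ = _ := by rw [integral_const_mul, integral_conj]

/-- The free evolution with the symbol `m` of a family. -/
def evolve (m : Plane → ℝ) (f : ℝ → Plane → ℂ) (t : ℝ) (ξ : Plane) : ℂ :=
  Complex.exp (-Complex.I * t * m ξ) * f t ξ

lemma norm_evolve (m : Plane → ℝ) (f : ℝ → Plane → ℂ) (t : ℝ) (ξ : Plane) :
    ‖evolve m f t ξ‖ = ‖f t ξ‖ := by
  rw [evolve, norm_mul, norm_cexp_neg_I_mul, one_mul]

lemma IsCompactFamily.evolve (hf : IsCompactFamily R f) {m : Plane → ℝ} (hm : Continuous m) :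
    IsCompactFamily R (evolve m f) :=
  ⟨(continuous_cexp_neg_I_mul continuous_fst (hm.comp continuous_snd)).mul hf.continuous,
    fun t ξ hξ => by rw [KleinGordon.evolve, hf.eq_zero t ξ hξ, mul_zero]⟩

/-- Since the phase is exactly the combination of the three symbols, the unimodular factors cancel,
and the equation for a profile becomes the Fourier transform of the equation with the product `u ū`.
-/
lemma evolve_integral_eq_correlation {m m' m'' : Plane → ℝ} {p : Plane → Plane → ℝ}
    (hp : ∀ ζ μ, p ζ μ = m' (ζ + μ) - m ζ - m'' μ) :
    evolve m (fun t ζ => ∫ μ, Complex.exp (-Complex.I * t * p ζ μ) * (f t (ζ + μ) * conj (g t μ)))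
      = correlation (evolve m' f) (evolve m'' g) := by
  funext t ζ
  unfold evolve correlation
  rw [← integral_const_mul]
  refine integral_congr_ae (Eventually.of_forall fun μ => ?_)
  simp only [hp, map_mul, ← Complex.exp_conj, map_neg, Complex.conj_I, Complex.conj_ofReal]
  have : Complex.exp (-Complex.I * t * m ζ) *
      Complex.exp (-Complex.I * t * (m' (ζ + μ) - m ζ - m'' μ : ℝ))
      = Complex.exp (-Complex.I * t * m' (ζ + μ)) * Complex.exp (- -Complex.I * t * m'' μ) := by
    rw [← Complex.exp_add, ← Complex.exp_add]
    congr 1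
    push_cast
    ring
  linear_combination (f t (ζ + μ) * conj (g t μ)) * this

lemma hasDerivAt_evolve {m : Plane → ℝ} {t : ℝ} {ξ : Plane}
    (hd : HasDerivAt (fun s => f s ξ) (f' t ξ) t) : HasDerivAt (fun s => evolve m f s ξ)
      (-(Complex.I * (m ξ * evolve m f t ξ)) + evolve m f' t ξ) t := by
  have h1 : HasDerivAt (fun s : ℝ => -Complex.I * (s : ℂ) * (m ξ : ℂ)) (-Complex.I * 1 * m ξ) t :=
    (Complex.ofRealCLM.hasDerivAt.const_mul (-Complex.I)).mul_const (m ξ : ℂ)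
  refine (h1.cexp.mul hd).congr_deriv ?_
  unfold evolve
  ring

/-- The equation satisfied by a family of inverse Fourier transforms. -/
lemma IsCompactFamily.exists_equation {m : Plane → ℝ} (hm : Continuous m)
    (hf : IsCompactFamily R f) (hg : IsCompactFamily R' g)
    (hd : ∀ t ξ, HasDerivAt (fun s => f s ξ) (-(Complex.I * (m ξ * f t ξ)) + g t ξ) t) (t : ℝ) :
    ∃ w n : L2, IsMultiplierImage m (𝓕⁻ (hf.toL2 t)) w ∧ (n =ᵐ[volume] 𝓕⁻ (g t)) ∧
      HasDerivAt (fun s => (𝓕⁻ (hf.toL2 s) : L2)) (-(Complex.I • w) + n) t := by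
  have hmf : IsCompactFamily R fun t ξ => (m ξ : ℂ) * f t ξ :=
    ⟨(Complex.continuous_ofReal.comp (hm.comp continuous_snd)).mul hf.continuous,
      fun t ξ hξ => by rw [hf.eq_zero t ξ hξ, mul_zero]⟩
  have hf' : IsCompactFamily (max R R')
      fun t ξ => -(Complex.I * (m ξ * f t ξ)) + g t ξ :=
    ⟨((continuous_const.mul hmf.continuous).neg).add hg.continuous, fun t ξ hξ => by
      rw [hf.eq_zero t ξ ((le_max_left _ _).trans hξ),
        hg.eq_zero t ξ ((le_max_right _ _).trans hξ)]; simp⟩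
  refine ⟨𝓕⁻ (hmf.toL2 t), 𝓕⁻ (hg.toL2 t), ?_, hg.fourierInv_toL2 t, ?_⟩
  · unfold IsMultiplierImage
    rw [FourierTransform.fourier_fourierInv_eq, FourierTransform.fourier_fourierInv_eq]
    filter_upwards [hmf.coeFn_toL2 t, hf.coeFn_toL2 t] with ξ h1 h2
    rw [h1, h2]
  · have h1 := hf.hasDerivAt_toL2 hf' hd t
    have h2 := ((Lp.fourierTransformₗᵢ Plane ℂ).symm.toContinuousLinearEquiv :
      L2 →L[ℂ] L2).restrictScalars ℝ |>.hasFDerivAt.comp_hasDerivAt t h1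
    refine h2.congr_deriv ?_
    have e : hf'.toL2 t = -(Complex.I • hmf.toL2 t) + hg.toL2 t := by
      refine Lp.ext ?_
      filter_upwards [hf'.coeFn_toL2 t, hmf.coeFn_toL2 t, hg.coeFn_toL2 t,
        Lp.coeFn_add (-(Complex.I • hmf.toL2 t)) (hg.toL2 t), Lp.coeFn_neg (Complex.I • hmf.toL2 t),
        Lp.coeFn_smul Complex.I (hmf.toL2 t)] with ξ h1 h2 h3 h4 h5 h6
      rw [h1, h4, Pi.add_apply, h5, Pi.neg_apply, h6, Pi.smul_apply, h2, h3, smul_eq_mul]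
    rw [e]
    show (Lp.fourierTransformₗᵢ Plane ℂ).symm (-(Complex.I • hmf.toL2 t) + hg.toL2 t) = _
    rw [map_add, map_neg, map_smul]
    rfl

end

/-! ### Energy conservation and uniqueness -/

lemma IsMultiplierImage.sub {m : Plane → ℝ} {f g f' g' : L2} (h : IsMultiplierImage m f g)
    (h' : IsMultiplierImage m f' g') : IsMultiplierImage m (f - f') (g - g') := by
  unfold IsMultiplierImage at *
  have e : ∀ x y : L2, (𝓕 (x - y) : L2) = 𝓕 x - 𝓕 y := fun x y =>
    map_sub (Lp.fourierTransformₗᵢ Plane ℂ) x y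
  rw [e, e]
  filter_upwards [h, h', Lp.coeFn_sub (𝓕 g) (𝓕 g'), Lp.coeFn_sub (𝓕 f) (𝓕 f')] with ξ h1 h2 h3 h4
  rw [h3, h4, Pi.sub_apply, Pi.sub_apply, h1, h2, mul_sub]

/-- A Fourier multiplier with real symbol is symmetric. -/
lemma IsMultiplierImage.im_inner_eq_zero {m : Plane → ℝ} {f g : L2} (h : IsMultiplierImage m f g) :
    (inner ℂ f g).im = 0 := by
  rw [← Lp.inner_fourier_eq, L2.inner_def]
  have e : ∫ ξ, inner ℂ ((𝓕 f : L2) ξ) ((𝓕 g : L2) ξ)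
      = ∫ ξ, ((m ξ * ‖(𝓕 f : L2) ξ‖ ^ 2 : ℝ) : ℂ) := by
    refine integral_congr_ae (h.mono fun ξ hξ => ?_)
    simp only [hξ]
    rw [RCLike.inner_apply, mul_assoc, RCLike.mul_conj]
    push_cast
    rfl
  rw [e, integral_complex_ofReal, Complex.ofReal_im]

/-- Conservation of energy for the linear equation. -/
lemma eq_zero_of_linear_equation {m : Plane → ℝ} {d : ℝ → L2} (h0 : d 0 = 0)
    (h : ∀ t, 0 ≤ t → ∃ w, IsMultiplierImage m (d t) w ∧
      HasDerivWithinAt d (-(Complex.I • w)) (Set.Ici 0) t) {t : ℝ} (ht : 0 ≤ t) : d t = 0 := by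
  have hd : ∀ s ∈ Set.Ici (0 : ℝ),
      HasDerivWithinAt (fun s => inner ℂ (d s) (d s)) 0 (Set.Ici 0) s := by
    intro s hs
    obtain ⟨w, hw, hws⟩ := h s hs
    refine (hws.inner ℂ hws).congr_deriv ?_
    -- As the symbol is real, `⟪d, w⟫` is real, and the two terms in the derivative of `‖d‖²`
    -- cancel.
    have h1 := hw.im_inner_eq_zero
    have h2 : inner ℂ w (d s) = inner ℂ (d s) w := by
      rw [← inner_conj_symm, Complex.conj_eq_iff_im.2 h1]
    rw [inner_neg_right, inner_neg_left, inner_smul_right, inner_smul_left, Complex.conj_I, h2]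
    ring
  have hc : inner ℂ (d t) (d t) = inner ℂ (d 0) (d 0) := by
    have := (convex_Ici (0 : ℝ)).norm_image_sub_le_of_norm_hasDerivWithin_le (C := 0) hd
      (fun s _ => by simp) (Set.self_mem_Ici) ht
    rw [zero_mul] at this
    exact sub_eq_zero.1 (norm_le_zero_iff.1 this)
  rw [h0, inner_zero_left, inner_self_eq_zero] at hc
  exact hc

lemma IsGlobalSolution.component_eq {u₀ : Fin 6 → L2} {u v : ℝ → Fin 6 → L2}
    (hu : IsGlobalSolution u₀ u) (hv : IsGlobalSolution u₀ v) (j : Fin 6)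
    (hN : ∀ t, 0 ≤ t → nonlinearity (fun k => u t k) j = nonlinearity (fun k => v t k) j) {t : ℝ}
    (ht : 0 ≤ t) : v t j = u t j := by
  refine sub_eq_zero.1 (eq_zero_of_linear_equation (m := systemSymbol j)
    (d := fun s => v s j - u s j) ?_ (fun s hs => ?_) ht)
  · simp only [hu.initial, hv.initial, sub_self]
  · obtain ⟨w, n, h1, h2, h3⟩ := hu.equation s hs j
    obtain ⟨w', n', h1', h2', h3'⟩ := hv.equation s hs j
    refine ⟨w' - w, h1'.sub h1, (h3'.sub h3).congr_deriv ?_⟩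
    have : n' = n := Lp.ext (h2'.trans (by rw [← hN s hs]; exact h2.symm))
    rw [this, smul_sub]
    abel

section

variable (v : Fin 6 → Plane → ℂ)

lemma nonlinearity_zero : nonlinearity v 0 = fun _ => 0 := rfl

lemma nonlinearity_one : nonlinearity v 1 = fun _ => 0 := rfl

lemma nonlinearity_two : nonlinearity v 2 = fun _ => 0 := rfl

lemma nonlinearity_three : nonlinearity v 3 = fun x => v 1 x * conj (v 0 x) := rfl

lemma nonlinearity_four : nonlinearity v 4 = fun x => v 2 x * conj (v 1 x) := rfl

lemma nonlinearity_five : nonlinearity v 5 = fun x => v 4 x * conj (v 3 x) := rfl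

end

/-- Uniqueness of global solutions. -/
lemma IsGlobalSolution.unique {u₀ : Fin 6 → L2} {u v : ℝ → Fin 6 → L2}
    (hu : IsGlobalSolution u₀ u) (hv : IsGlobalSolution u₀ v) {t : ℝ} (ht : 0 ≤ t) :
    v t = u t := by
  -- The system is triangular: each quadratic term involves only components already known to agree,
  -- so every difference solves a linear homogeneous equation with zero data.
  have h0 : ∀ s, 0 ≤ s → v s 0 = u s 0 := fun s hs => hu.component_eq hv 0 (fun r _ => by
    rw [nonlinearity_zero, nonlinearity_zero]) hs
  have h1 : ∀ s, 0 ≤ s → v s 1 = u s 1 := fun s hs => hu.component_eq hv 1 (fun r _ => by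
    rw [nonlinearity_one, nonlinearity_one]) hs
  have h2 : ∀ s, 0 ≤ s → v s 2 = u s 2 := fun s hs => hu.component_eq hv 2 (fun r _ => by
    rw [nonlinearity_two, nonlinearity_two]) hs
  have h3 : ∀ s, 0 ≤ s → v s 3 = u s 3 := fun s hs => hu.component_eq hv 3 (fun r hr => by
    rw [nonlinearity_three, nonlinearity_three, h0 r hr, h1 r hr]) hs
  have h4 : ∀ s, 0 ≤ s → v s 4 = u s 4 := fun s hs => hu.component_eq hv 4 (fun r hr => by
    rw [nonlinearity_four, nonlinearity_four, h1 r hr, h2 r hr]) hs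
  have h5 : ∀ s, 0 ≤ s → v s 5 = u s 5 := fun s hs => hu.component_eq hv 5 (fun r hr => by
    rw [nonlinearity_five, nonlinearity_five, h3 r hr, h4 r hr]) hs
  funext j
  fin_cases j
  exacts [h0 t ht, h1 t ht, h2 t ht, h3 t ht, h4 t ht, h5 t ht]

/-! ### Bump data and Littlewood-Paley pieces -/

/-- A smooth bump which is positive exactly on the ball of radius `r`. -/
def bump (r : ℝ) (x : Plane) : ℝ := Real.smoothTransition (r ^ 2 - ‖x‖ ^ 2)

lemma contDiff_bump (r : ℝ) : ContDiff ℝ ∞ (bump r) :=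
  Real.smoothTransition.contDiff.comp (contDiff_const.sub (contDiff_norm_sq ℝ))

lemma bump_eq_zero {r : ℝ} (hr : 0 ≤ r) {x : Plane} (hx : r ≤ ‖x‖) : bump r x = 0 :=
  Real.smoothTransition.zero_of_nonpos (by nlinarith)

lemma bump_pos {r : ℝ} {x : Plane} (hx : ‖x‖ < r) : 0 < bump r x :=
  Real.smoothTransition.pos_of_pos (by nlinarith [norm_nonneg x])

lemma isProfile_bump {r c : ℝ} (hr : 0 < r) (hc : 0 < c) : IsProfile r fun x => c * bump r x where
  smooth := contDiff_const.mul (contDiff_bump r)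
  radial x y h := by simp only [bump, h]
  nonneg x := mul_nonneg hc.le (Real.smoothTransition.nonneg _)
  pos := mul_pos hc (bump_pos (by simpa using hr))
  eq_zero x hx := by rw [bump_eq_zero hr.le hx, mul_zero]

lemma IsProfile.isCompactFamily {δ : ℝ} {a : Plane → ℝ} (ha : IsProfile δ a) :
    IsCompactFamily δ fun _ ξ => (a ξ : ℂ) :=
  ⟨Complex.continuous_ofReal.comp (ha.smooth.continuous.comp continuous_snd),
    fun _ ξ hξ => by rw [ha.eq_zero ξ hξ, Complex.ofReal_zero]⟩

lemma IsCompactFamily.le_norm_toL2 {R : ℝ} {f : ℝ → Plane → ℂ} (hf : IsCompactFamily R f) {t m r : ℝ}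
    (hm : 0 ≤ m) (h : ∀ ξ ∈ Metric.closedBall (0 : Plane) r, m ≤ ‖f t ξ‖) :
    m * volume.real (Metric.closedBall (0 : Plane) r) ^ (1 / 2 : ℝ) ≤ ‖hf.toL2 t‖ := by
  unfold IsCompactFamily.toL2
  rw [Lp.norm_toLp]
  have hle : eLpNorm ((Metric.closedBall (0 : Plane) r).indicator fun _ => m) 2 volume
      ≤ eLpNorm (f t) 2 volume := by
    refine eLpNorm_mono fun ξ => ?_
    by_cases hξ : ξ ∈ Metric.closedBall (0 : Plane) r
    · rw [Set.indicator_of_mem hξ, Real.norm_of_nonneg hm]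
      exact h ξ hξ
    · rw [Set.indicator_of_notMem hξ, norm_zero]
      exact norm_nonneg _
  refine (le_of_eq ?_).trans (ENNReal.toReal_mono (hf.memLp t).eLpNorm_ne_top hle)
  rw [eLpNorm_indicator_const Metric.isClosed_closedBall.measurableSet (by norm_num) (by norm_num),
    ENNReal.toReal_mul, ← ENNReal.toReal_rpow, Measure.real, toReal_enorm, Real.norm_of_nonneg hm]
  norm_num

/-- The norm is not smooth at the origin, but `φ` is constant there. -/
lemma contDiff_radial_cutoff {φ : ℝ → ℝ} (hφ : IsCutoff φ) {c : ℝ} (hc : 0 < c) :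
    ContDiff ℝ ∞ fun ξ : Plane => φ (freq ξ / c) := by
  rw [contDiff_iff_contDiffAt]
  intro ξ
  by_cases hξ : ξ = 0
  · have : (fun ξ : Plane => φ (freq ξ / c)) =ᶠ[𝓝 ξ] fun _ => 1 := by
      have hcont : Tendsto (fun ξ : Plane => freq ξ / c) (𝓝 ξ) (𝓝 (freq ξ / c)) := by
        have : Continuous fun ξ : Plane => freq ξ / c := by unfold freq; fun_prop
        exact this.tendsto ξ
      have h0 : freq ξ / c = 0 := by simp [hξ, freq]
      rw [h0] at hcont
      filter_upwards [hcont.eventually_lt_const (by norm_num : (0 : ℝ) < 1.1)] with η hη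
      refine hφ.eq_one _ ⟨?_, hη.le⟩
      have : 0 ≤ freq η / c := by unfold freq; positivity
      linarith
    exact contDiffAt_const.congr_of_eventuallyEq this
  · have h1 : ContDiffAt ℝ ∞ (fun ξ : Plane => freq ξ / c) ξ := by
      unfold freq
      exact (contDiffAt_const.mul (contDiffAt_norm ℝ hξ)).div_const c
    exact hφ.smooth.contDiffAt.comp ξ h1

lemma cutoff_eq_zero {φ : ℝ → ℝ} (hφ : IsCutoff φ) {x : ℝ} (hx : 1.2 < x) : φ x = 0 := by
  by_contra h
  exact absurd (hφ.support (subset_tsupport _ h)).2 (not_le.2 hx)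

/-- Required for the multiplier in `piece` to act as pointwise multiplication on the Fourier side.
-/
lemma hasTemperateGrowth_pieceSymbol {φ : ℝ → ℝ} (hφ : IsCutoff φ) (l : ℤ) :
    (fun ξ => (pieceSymbol φ l ξ : ℂ)).HasTemperateGrowth := by
  have h1 : ContDiff ℝ ∞ fun ξ => (pieceSymbol φ l ξ : ℂ) :=
    Complex.ofRealCLM.contDiff.comp ((contDiff_radial_cutoff hφ (by positivity)).sub
      (contDiff_radial_cutoff hφ (by positivity)))
  have h2 : HasCompactSupport fun ξ => (pieceSymbol φ l ξ : ℂ) := by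
    refine HasCompactSupport.intro (isCompact_closedBall 0 (1.2 * 2 ^ l)) fun ξ hξ => ?_
    rw [mem_closedBall_zero_iff, not_le] at hξ
    have hf : ‖ξ‖ ≤ freq ξ := by
      unfold freq
      nlinarith [Real.pi_gt_three, norm_nonneg ξ]
    have hp : (0 : ℝ) < 2 ^ l := by positivity
    have e1 : 1.2 < freq ξ / 2 ^ l := by rw [lt_div_iff₀ hp]; linarith
    have e2 : 1.2 < freq ξ / 2 ^ (l - 1) := by
      refine e1.trans_le ?_
      have : 0 ≤ freq ξ := (norm_nonneg ξ).trans hf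
      gcongr
      · norm_num
      · omega
    simp [pieceSymbol, cutoff_eq_zero hφ e1, cutoff_eq_zero hφ e2]
  exact (h2.toSchwartzMap h1).hasTemperateGrowth

lemma fourier_piece_apply {φ : ℝ → ℝ} (hφ : IsCutoff φ) (l : ℤ) (f : 𝓢(Plane, ℂ)) (ξ : Plane) :
    𝓕 (piece φ l f) ξ = (pieceSymbol φ l ξ : ℂ) * 𝓕 f ξ := by
  unfold piece
  rw [SchwartzMap.fourierMultiplierCLM_apply, FourierTransform.fourier_fourierInv_eq,
    SchwartzMap.smulLeftCLM_apply_apply (hasTemperateGrowth_pieceSymbol hφ l), smul_eq_mul]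

/-- At `|ζ| = 1.1 * 2^l` the two arguments of `φ` are `1.1`, where `φ = 1`, and `2.2`, beyond the
support. -/
lemma pieceSymbol_eq_one {φ : ℝ → ℝ} (hφ : IsCutoff φ) (l : ℤ) {ξ : Plane}
    (hξ : freq ξ = 1.1 * 2 ^ l) : pieceSymbol φ l ξ = 1 := by
  have hp : (2 : ℝ) ^ l ≠ 0 := by positivity
  unfold pieceSymbol
  rw [hξ, mul_div_cancel_right₀ _ hp, hφ.eq_one 1.1 (by constructor <;> norm_num),
    cutoff_eq_zero hφ, sub_zero]
  rw [zpow_sub_one₀ two_ne_zero, mul_div_mul_comm]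
  field_simp
  norm_num

/-! ### The explicit solution and the growth of its last component -/

/-- The constant `(2π)²` which relates `‖ξ‖²` to the squared frequency. -/
def kap : ℝ := (2 * Real.pi) ^ 2

lemma kap_pos : 0 < kap := by
  have := Real.pi_pos
  unfold kap; positivity

lemma symbol1_eq (ξ : Plane) : symbol1 ξ = jap kap ξ := by
  unfold symbol1 dispersion jap freq kap
  congr 1; ring

lemma symbol2_eq (ξ : Plane) : symbol2 ξ = 2 * jap (kap / 2) ξ := by
  unfold symbol2 dispersion jap freq kap
  rw [show 2 * (2 * Real.pi * ‖ξ‖) ^ 2 + 4 = 2 ^ 2 * (1 + (2 * Real.pi) ^ 2 / 2 * ‖ξ‖ ^ 2) by ring,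
    Real.sqrt_mul (by norm_num), Real.sqrt_sq (by norm_num)]

lemma symbol3_eq (ξ : Plane) : symbol3 ξ = 4 * jap (kap / 2 / 2) ξ := by
  unfold symbol3 dispersion jap freq kap
  rw [show 4 * (2 * Real.pi * ‖ξ‖) ^ 2 + 16 = 4 ^ 2 * (1 + (2 * Real.pi) ^ 2 / 2 / 2 * ‖ξ‖ ^ 2) by
    ring, Real.sqrt_mul (by norm_num), Real.sqrt_sq (by norm_num)]

lemma continuous_dispersion (c b : ℝ) : Continuous (dispersion c b) := by
  unfold dispersion freq; fun_prop

lemma phase_kap (ζ μ : Plane) : phase kap ζ μ = symbol2 (ζ + μ) - symbol1 ζ - symbol1 μ := by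
  rw [symbol2_eq, symbol1_eq, symbol1_eq, phase]

/-- The triple of symbols `3, 2, 2` is twice the triple `2, 1, 1` with `k` halved. The same analysis
applies with `kap / 2`, and the factor `2` amounts to running time at double speed, whence
`doubledProf`. -/
lemma two_mul_phase_kap (ζ μ : Plane) :
    2 * phase (kap / 2) ζ μ = symbol3 (ζ + μ) - symbol2 ζ - symbol2 μ := by
  rw [symbol3_eq, symbol2_eq, symbol2_eq, phase]
  ring

section

variable {k R R' δ r : ℝ} {a b : Plane → ℝ} {f g : ℝ → Plane → ℂ}

lemma IsProfile.isCompactFamily_prof (ha : IsProfile δ a) (hb : IsProfile δ b) :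
    IsCompactFamily (2 * δ) (prof k a b) :=
  ⟨continuous_prof ha.smooth.continuous hb.smooth.continuous hb.hasCompactSupport,
    fun s _ hξ => prof_eq_zero ha hb s hξ⟩

lemma IsCompactFamily.duhamel (hf : IsCompactFamily R f) (hg : IsCompactFamily R' g) :
    IsCompactFamily (R + R') (duhamel k f g) := by
  refine ⟨continuous_duhamel hf hg, fun t ζ hζ => ?_⟩
  have : ∀ s, interaction k f g s ζ = 0 := fun s => by
    unfold interaction
    simp only [correlation_integrand_eq_zero hf hg s (Or.inl hζ), mul_zero, integral_zero]
  simp [KleinGordon.duhamel, this]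

lemma hasDerivAt_prof (ha : IsProfile δ a) (hb : IsProfile δ b) (t : ℝ) (ξ : Plane) :
    HasDerivAt (fun s => prof k a b s ξ) (source k a b t ξ) t := by
  have h : Continuous fun s => source k a b s ξ :=
    (continuous_source ha.smooth.continuous hb.smooth.continuous hb.hasCompactSupport).comp
      (by fun_prop : Continuous fun s : ℝ => (s, ξ))
  exact (h.integral_hasStrictDerivAt 0 t).hasDerivAt

lemma hasDerivAt_duhamel (hf : IsCompactFamily R f) (hg : IsCompactFamily R' g) (t : ℝ)
    (ξ : Plane) : HasDerivAt (fun s => duhamel k f g s ξ) (interaction k f g t ξ) t := by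
  have h : Continuous fun s => interaction k f g s ξ :=
    (continuous_interaction hf hg).comp (by fun_prop : Continuous fun s : ℝ => (s, ξ))
  exact (h.integral_hasStrictDerivAt 0 t).hasDerivAt

lemma source_eq (a b : Plane → ℝ) (t : ℝ) (ζ : Plane) : source k a b t ζ
    = ∫ μ : Plane, Complex.exp (-Complex.I * t * phase k ζ μ) *
      ((a (ζ + μ) : ℂ) * conj (b μ : ℂ)) := by
  unfold source
  simp only [Complex.ofReal_mul, Complex.conj_ofReal]

/-- The profile at doubled time, for the interaction of the third with the second component. -/
def doubledProf (a b : Plane → ℝ) (t : ℝ) (ξ : Plane) : ℂ := 1 / 2 * prof (kap / 2) a b (2 * t) ξ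

lemma IsProfile.isCompactFamily_doubledProf (ha : IsProfile δ a) (hb : IsProfile δ b) :
    IsCompactFamily (2 * δ) (doubledProf a b) := by
  have h := ha.isCompactFamily_prof (k := kap / 2) hb
  refine ⟨continuous_const.mul (h.continuous_comp (by fun_prop) (by fun_prop)), fun s ξ hξ => ?_⟩
  rw [doubledProf, h.eq_zero _ ξ hξ, mul_zero]

lemma hasDerivAt_doubledProf (ha : IsProfile δ a) (hb : IsProfile δ b) (t : ℝ) (ξ : Plane) :
    HasDerivAt (fun s => doubledProf a b s ξ) (source (kap / 2) a b (2 * t) ξ) t := by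
  have h1 := (hasDerivAt_prof (k := kap / 2) ha hb (2 * t) ξ).scomp t
    ((hasDerivAt_id t).const_mul 2)
  refine (h1.const_mul (1 / 2)).congr_deriv ?_
  rw [Complex.real_smul]
  push_cast
  ring

lemma ProfBounds.doubledProf {C : ℝ} {L : ℂ} (h : ProfBounds (prof (kap / 2) a b) C L) :
    ProfBounds (doubledProf a b) C (1 / 2 * L) := by
  have hn : ‖(1 / 2 : ℂ)‖ = 1 / 2 := by norm_num
  refine ⟨h.nonneg, mul_ne_zero (by norm_num) h.ne_zero, fun s ξ hs hξ => ?_,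
    fun s s' ξ hs hs' hξ => ?_, fun {ι} F s ξ hξ0 hξ hs => ?_⟩
  · have h1 := h.bound (2 * s) ξ (by linarith) hξ
    rw [KleinGordon.doubledProf, norm_mul, hn]
    linarith [norm_nonneg (prof (kap / 2) a b (2 * s) ξ)]
  · have h1 := h.cauchy (2 * s) (2 * s') ξ (by linarith) (by linarith) hξ
    rw [KleinGordon.doubledProf, KleinGordon.doubledProf, ← mul_sub, norm_mul, hn]
    have h2 : (2 * s) ^ (-(1 / 4) : ℝ) ≤ s ^ (-(1 / 4) : ℝ) :=
      Real.rpow_le_rpow_of_nonpos hs (by linarith) (by norm_num)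
    have h3 : C * (2 * s) ^ (-(1 / 4) : ℝ) * ‖ξ‖⁻¹ ≤ C * s ^ (-(1 / 4) : ℝ) * ‖ξ‖⁻¹ := by
      have := h.nonneg
      gcongr
    linarith [norm_nonneg (prof (kap / 2) a b (2 * s') ξ - prof (kap / 2) a b (2 * s) ξ)]
  · have h1 := h.limit F (fun i => 2 * s i) ξ hξ0 hξ (by
      simp only [mul_assoc]
      exact hs.const_mul_atTop (by norm_num))
    refine (h1.const_mul (1 / 2)).congr fun i => ?_
    unfold KleinGordon.doubledProf
    ring

/-- The profile of the sixth component. -/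
def lastProf (a b : Plane → ℝ) (t : ℝ) (ξ : Plane) : ℂ :=
  b ξ + duhamel kap (doubledProf a a) (prof kap a a) t ξ

lemma isCompactFamily_lastProf (ha : IsProfile δ a) (hb : IsProfile r b) :
    IsCompactFamily (max r (2 * δ + 2 * δ)) (lastProf a b) := by
  have h1 := (ha.isCompactFamily_doubledProf ha).duhamel (k := kap)
    (ha.isCompactFamily_prof (k := kap) ha)
  refine ⟨hb.isCompactFamily.continuous.add h1.continuous, fun s ξ hξ => ?_⟩
  rw [lastProf, hb.eq_zero ξ ((le_max_left _ _).trans hξ),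
    h1.eq_zero s ξ ((le_max_right _ _).trans hξ)]
  simp

lemma hasDerivAt_lastProf (ha : IsProfile δ a) (t : ℝ) (ξ : Plane) :
    HasDerivAt (fun s => lastProf a b s ξ)
      (interaction kap (doubledProf a a) (prof kap a a) t ξ) t :=
  (hasDerivAt_duhamel (ha.isCompactFamily_doubledProf ha) (ha.isCompactFamily_prof ha) t
    ξ).const_add _

lemma exists_free_equation {m : Plane → ℝ} (hm : Continuous m) (ha : IsProfile δ a) (t : ℝ) :
    ∃ w n : L2, IsMultiplierImage m (𝓕⁻ ((ha.isCompactFamily.evolve hm).toL2 t)) w ∧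
      (n =ᵐ[volume] fun _ => (0 : ℂ)) ∧
      HasDerivAt (fun s => (𝓕⁻ ((ha.isCompactFamily.evolve hm).toL2 s) : L2))
        (-(Complex.I • w) + n) t := by
  have hz : IsCompactFamily δ fun _ _ => (0 : ℂ) := ⟨continuous_const, fun _ _ _ => rfl⟩
  obtain ⟨w, n, h1, h2, h3⟩ := (ha.isCompactFamily.evolve hm).exists_equation hm hz
    (fun t ξ => (hasDerivAt_evolve (f' := fun _ _ => 0) (hasDerivAt_const t _)).congr_deriv (by
      simp [evolve])) t
  refine ⟨w, n, h1, h2.trans (Eventually.of_forall fun x => ?_), h3⟩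
  simp [Real.fourierInv_eq]

/-- The passage from an ordinary differential equation at each frequency to the equation in `L²`:
the source, once evolved, is a correlation, and its inverse transform is the product of one factor
with the conjugate of the other. -/
lemma exists_quadratic_equation {m : Plane → ℝ} (hm : Continuous m) {R₁ R₂ : ℝ}
    {F S G H : ℝ → Plane → ℂ} (hF : IsCompactFamily R F) (hG : IsCompactFamily R₁ G)
    (hH : IsCompactFamily R₂ H) (hd : ∀ t ξ, HasDerivAt (fun s => F s ξ) (S t ξ) t)
    (hS : evolve m S = correlation G H) (t : ℝ) :
    ∃ w n : L2, IsMultiplierImage m (𝓕⁻ ((hF.evolve hm).toL2 t)) w ∧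
      (n =ᵐ[volume] fun x => (𝓕⁻ (hG.toL2 t) : L2) x * conj ((𝓕⁻ (hH.toL2 t) : L2) x)) ∧
      HasDerivAt (fun s => (𝓕⁻ ((hF.evolve hm).toL2 s) : L2)) (-(Complex.I • w) + n) t := by
  obtain ⟨w, n, h1, h2, h3⟩ := (hF.evolve hm).exists_equation hm (hG.correlation hH)
    (fun t ξ => (hasDerivAt_evolve (hd t ξ)).congr_deriv (by rw [hS])) t
  refine ⟨w, n, h1, ?_, h3⟩
  filter_upwards [h2, hG.fourierInv_toL2 t, hH.fourierInv_toL2 t] with x e1 e2 e3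
  rw [e1, e2, e3, fourierInv_correlation hG hH]

/-- The Fourier transforms of the data. -/
def dataProfile (a b : Plane → ℝ) : Fin 6 → Plane → ℝ := ![a, a, a, 0, 0, b]

lemma norm_fourierInv (f : L2) : ‖(𝓕⁻ f : L2)‖ = ‖f‖ :=
  (Lp.fourierTransformₗᵢ Plane ℂ).symm.norm_map f

lemma IsCompactFamily.fourierInv_toL2_eq (hf : IsCompactFamily R f) {t : ℝ} {v : L2}
    (hv : (𝓕 v : L2) =ᵐ[volume] f t) : (𝓕⁻ (hf.toL2 t) : L2) = v := by
  have : hf.toL2 t = 𝓕 v := Lp.ext ((hf.coeFn_toL2 t).trans hv.symm)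
  rw [this, FourierTransform.fourierInv_fourier_eq]

lemma evolve_zero (m : Plane → ℝ) (f : ℝ → Plane → ℂ) (ξ : Plane) : evolve m f 0 ξ = f 0 ξ := by
  simp [evolve]

/-- Existence of a global solution, with an explicit last component. -/
lemma exists_solution (ha : IsProfile δ a) (hb : IsProfile r b) {u₀ : Fin 6 → L2}
    (hu₀ : ∀ j, (𝓕 (u₀ j) : L2) =ᵐ[volume] fun ξ => (dataProfile a b j ξ : ℂ)) :
    ∃ u : ℝ → Fin 6 → L2, IsGlobalSolution u₀ u ∧ ∀ t, u t 5 =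
      𝓕⁻ (((isCompactFamily_lastProf ha hb).evolve (continuous_dispersion 1 1)).toL2 t) := by
  have c1 : Continuous symbol1 := continuous_dispersion 1 1
  have c2 : Continuous symbol2 := continuous_dispersion 2 4
  have c3 : Continuous symbol3 := continuous_dispersion 4 16
  have h0 := ha.isCompactFamily.evolve c1
  have h1 := ha.isCompactFamily.evolve c2
  have h2 := ha.isCompactFamily.evolve c3
  have h3 := (ha.isCompactFamily_prof (k := kap) ha).evolve c1
  have h4 := (ha.isCompactFamily_doubledProf ha).evolve c2
  have h5 := (isCompactFamily_lastProf ha hb).evolve c1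
  -- The first three profiles are constant in time, the next two start from zero, and the last
  -- starts from `b`.
  refine ⟨fun t => ![𝓕⁻ (h0.toL2 t), 𝓕⁻ (h1.toL2 t), 𝓕⁻ (h2.toL2 t), 𝓕⁻ (h3.toL2 t),
    𝓕⁻ (h4.toL2 t), 𝓕⁻ (h5.toL2 t)], ⟨?_, fun t ht => ?_⟩, fun t => rfl⟩
  · have i0 : (𝓕⁻ (h0.toL2 0) : L2) = u₀ 0 := h0.fourierInv_toL2_eq ((hu₀ 0).trans
      (Eventually.of_forall fun ξ => by simp [evolve_zero, dataProfile]))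
    have i1 : (𝓕⁻ (h1.toL2 0) : L2) = u₀ 1 := h1.fourierInv_toL2_eq ((hu₀ 1).trans
      (Eventually.of_forall fun ξ => by simp [evolve_zero, dataProfile]))
    have i2 : (𝓕⁻ (h2.toL2 0) : L2) = u₀ 2 := h2.fourierInv_toL2_eq ((hu₀ 2).trans
      (Eventually.of_forall fun ξ => by simp [evolve_zero, dataProfile]))
    have i3 : (𝓕⁻ (h3.toL2 0) : L2) = u₀ 3 := h3.fourierInv_toL2_eq ((hu₀ 3).trans
      (Eventually.of_forall fun ξ => by simp [evolve_zero, prof, dataProfile]))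
    have i4 : (𝓕⁻ (h4.toL2 0) : L2) = u₀ 4 := h4.fourierInv_toL2_eq ((hu₀ 4).trans
      (Eventually.of_forall fun ξ => by simp [evolve_zero, doubledProf, prof, dataProfile]))
    have i5 : (𝓕⁻ (h5.toL2 0) : L2) = u₀ 5 := h5.fourierInv_toL2_eq ((hu₀ 5).trans
      (Eventually.of_forall fun ξ => by simp [evolve_zero, lastProf, duhamel, dataProfile]))
    funext j
    fin_cases j
    exacts [i0, i1, i2, i3, i4, i5]
  · obtain ⟨w0, n0, p0, q0, d0⟩ := exists_free_equation c1 ha t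
    obtain ⟨w1, n1, p1, q1, d1⟩ := exists_free_equation c2 ha t
    obtain ⟨w2, n2, p2, q2, d2⟩ := exists_free_equation c3 ha t
    have s3 : evolve symbol1 (source kap a a) = correlation (evolve symbol2 fun _ ξ => (a ξ : ℂ))
        (evolve symbol1 fun _ ξ => (a ξ : ℂ)) := by
      rw [← evolve_integral_eq_correlation phase_kap]
      congr 1
      funext t ζ
      exact source_eq a a t ζ
    have s4 : evolve symbol2 (fun t => source (kap / 2) a a (2 * t))
        = correlation (evolve symbol3 fun _ ξ => (a ξ : ℂ)) (evolve symbol2 fun _ ξ => (a ξ : ℂ)) := by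
      rw [← evolve_integral_eq_correlation two_mul_phase_kap]
      congr 1
      funext t ζ
      rw [source_eq]
      refine integral_congr_ae (Eventually.of_forall fun μ => ?_)
      simp only
      congr 2
      push_cast
      ring
    have s5 : evolve symbol1 (interaction kap (doubledProf a a) (prof kap a a))
        = correlation (evolve symbol2 (doubledProf a a)) (evolve symbol1 (prof kap a a)) := by
      rw [← evolve_integral_eq_correlation phase_kap]
      rfl
    obtain ⟨w3, n3, p3, q3, d3⟩ := exists_quadratic_equation c1 (ha.isCompactFamily_prof ha) h1 h0
      (hasDerivAt_prof ha ha) s3 t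
    obtain ⟨w4, n4, p4, q4, d4⟩ := exists_quadratic_equation c2 (ha.isCompactFamily_doubledProf ha)
      h2 h1 (hasDerivAt_doubledProf ha ha) s4 t
    obtain ⟨w5, n5, p5, q5, d5⟩ := exists_quadratic_equation c1 (isCompactFamily_lastProf ha hb)
      h4 h3 (hasDerivAt_lastProf ha) s5 t
    intro j
    fin_cases j
    exacts [⟨w0, n0, p0, q0, d0.hasDerivWithinAt⟩, ⟨w1, n1, p1, q1, d1.hasDerivWithinAt⟩,
      ⟨w2, n2, p2, q2, d2.hasDerivWithinAt⟩, ⟨w3, n3, p3, q3, d3.hasDerivWithinAt⟩,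
      ⟨w4, n4, p4, q4, d4.hasDerivWithinAt⟩, ⟨w5, n5, p5, q5, d5.hasDerivWithinAt⟩]

lemma norm_le_vecNorm (v : Fin 6 → L2) (j : Fin 6) : ‖v j‖ ≤ vecNorm v := by
  unfold vecNorm
  refine Real.le_sqrt_of_sq_le ?_
  exact Finset.single_le_sum (f := fun j => ‖v j‖ ^ 2) (fun _ _ => by positivity)
    (Finset.mem_univ j)

/-- The `L²` norm of the last component tends to infinity. -/
lemma tendsto_norm_lastProf (ha : IsProfile δ a) (hb : IsProfile r b) {C C' : ℝ} {L L' : ℂ}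
    (h : ProfBounds (prof kap a a) C L) (h' : ProfBounds (prof (kap / 2) a a) C' L')
    {m : Plane → ℝ} (hm : Continuous m) :
    Tendsto (fun t => ‖((isCompactFamily_lastProf ha hb).evolve hm).toL2 t‖) atTop atTop := by
  obtain ⟨c, T, hc, hT, hcT⟩ := exists_duhamel_ge kap_pos (ha.isCompactFamily_doubledProf ha)
    (ha.isCompactFamily_prof ha) h'.doubledProf h
  obtain ⟨M, hM⟩ := hb.hasCompactSupport.exists_bound_of_continuous hb.smooth.continuous
  set V : ℝ := volume.real (Metric.closedBall (0 : Plane) 1) with hV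
  have hV0 : 0 < V := by
    rw [hV, Measure.real, ENNReal.toReal_pos_iff]
    exact ⟨Metric.measure_closedBall_pos volume 0 one_pos,
      (isCompact_closedBall _ _).measure_lt_top⟩
  have hlim : Tendsto (fun t : ℝ => c / 2 * V ^ (1 / 2 : ℝ) * t ^ (1 / 30 : ℝ)) atTop atTop :=
    (tendsto_rpow_atTop (by norm_num)).const_mul_atTop (by positivity)
  refine tendsto_atTop_mono' atTop ?_ hlim
  -- The initial profile `b` of the last component is bounded and cancels at most half of the
  -- growing term.
  have hbig : ∀ᶠ t : ℝ in atTop, M ≤ c / 2 * t ^ (5 / 6 : ℝ) :=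
    ((tendsto_rpow_atTop (by norm_num : (0 : ℝ) < 5 / 6)).const_mul_atTop
      (by positivity : 0 < c / 2)).eventually_ge_atTop M
  filter_upwards [hbig, eventually_ge_atTop T] with t ht1 ht2
  have ht0 : 0 < t := hT.trans_le ht2
  have key := ((isCompactFamily_lastProf ha hb).evolve hm).le_norm_toL2 (t := t)
    (m := c / 2 * t ^ (5 / 6 : ℝ)) (r := t ^ (-(4 / 5) : ℝ)) (by positivity) fun ξ hξ => by
      rw [mem_closedBall_zero_iff] at hξ
      rw [norm_evolve, lastProf]
      have e1 := hcT t ξ ht2 hξ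
      have e2 := hM ξ
      have e3 := norm_sub_norm_le (duhamel kap (doubledProf a a) (prof kap a a) t ξ) (-(b ξ : ℂ))
      rw [norm_neg, Complex.norm_real, sub_neg_eq_add, add_comm _ (b ξ : ℂ)] at e3
      linarith
  refine (le_of_eq ?_).trans key
  have hball : volume.real (Metric.closedBall (0 : Plane) (t ^ (-(4 / 5) : ℝ)))
      = t ^ (-(8 / 5) : ℝ) * V := by
    have e := ballMass_eq 0 (R := t ^ (-(4 / 5) : ℝ)) (by positivity)
    simp only [ballMass, neg_zero, Real.rpow_zero, sub_zero, setIntegral_const, smul_eq_mul,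
      mul_one] at e
    rw [e, ← Real.rpow_mul ht0.le]
    norm_num
    exact Or.inl hV.symm
  rw [hball, Real.mul_rpow (by positivity) hV0.le, ← Real.rpow_mul ht0.le]
  -- The exponent `5/6 - 4/5 = 1/30` is positive because the window `4/5` lies strictly between
  -- `3/4`, needed for the asymptotics, and `5/6`, needed for growth of the norm.
  have e : t ^ (1 / 30 : ℝ) = t ^ (5 / 6 : ℝ) * t ^ (-(8 / 5) * (1 / 2) : ℝ) := by
    rw [← Real.rpow_add ht0]; norm_num
  rw [e]
  ring

end

/-! ### Schwartz data and conclusion -/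

lemma IsProfile.exists_schwartzMap {δ : ℝ} {a : Plane → ℝ} (ha : IsProfile δ a) :
    ∃ f : 𝓢(Plane, ℂ), ∀ ξ, f ξ = a ξ :=
  ⟨(ha.hasCompactSupport.comp_left Complex.ofReal_zero).toSchwartzMap
    (Complex.ofRealCLM.contDiff.comp ha.smooth), fun _ => rfl⟩

/-- Schwartz data with given Fourier transforms. -/
lemma exists_fourier_eq {δ r : ℝ} {a b : Plane → ℝ} (ha : IsProfile δ a) (hb : IsProfile r b) :
    ∃ w : Fin 6 → 𝓢(Plane, ℂ), ∀ j ξ, 𝓕 (w j) ξ = dataProfile a b j ξ := by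
  obtain ⟨f, hf⟩ := ha.exists_schwartzMap
  obtain ⟨g, hg⟩ := hb.exists_schwartzMap
  refine ⟨fun j => 𝓕⁻ ((![f, f, f, 0, 0, g] : Fin 6 → 𝓢(Plane, ℂ)) j), fun j ξ => ?_⟩
  rw [FourierTransform.fourier_fourierInv_eq]
  fin_cases j <;> simp [dataProfile, hf, hg]

lemma vecNorm_smul (c : ℝ) (hc : 0 ≤ c) (w : Fin 6 → 𝓢(Plane, ℂ)) :
    vecNorm (toL2 fun j => (c : ℂ) • w j) = c * vecNorm (toL2 w) := by
  have h : ∀ j, toL2 (fun j => (c : ℂ) • w j) j = (c : ℂ) • toL2 w j := fun j =>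
    (SchwartzMap.toLpCLM ℂ ℂ 2 volume).map_smul (c : ℂ) (w j)
  unfold vecNorm
  simp only [h, norm_smul, Complex.norm_real, Real.norm_of_nonneg hc, mul_pow]
  rw [← Finset.mul_sum, Real.sqrt_mul (by positivity), Real.sqrt_sq hc]

lemma dataProfile_const_mul (c : ℝ) (a b : Plane → ℝ) (j : Fin 6) (ξ : Plane) :
    dataProfile (fun x => c * a x) (fun x => c * b x) j ξ = c * dataProfile a b j ξ := by
  fin_cases j <;> simp [dataProfile]

lemma dataProfile_bump_eq_zero {δ r : ℝ} (hδ : 0 ≤ δ) (hδr : δ ≤ r) {ξ : Plane} (hξ : r ≤ ‖ξ‖)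
    (j : Fin 6) : dataProfile (bump δ) (bump r) j ξ = 0 := by
  have h1 : bump δ ξ = 0 := bump_eq_zero hδ (hδr.trans hξ)
  have h2 : bump r ξ = 0 := bump_eq_zero (hδ.trans hδr) hξ
  fin_cases j <;> simp [dataProfile, h1, h2]

lemma exists_freq_eq {x : ℝ} (hx : 0 ≤ x) : ∃ ξ : Plane, freq ξ = x := by
  have hp := Real.pi_pos
  refine ⟨(x / (2 * Real.pi)) • EuclideanSpace.single 0 1, ?_⟩
  rw [freq, norm_smul, Real.norm_of_nonneg (by positivity), PiLp.norm_single, norm_one]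
  field_simp

/-- There is exactly one solution, and it is unbounded in `L²`. -/
lemma exists_unique_unbounded_solution {δ r : ℝ} {a b : Plane → ℝ} (ha : IsProfile δ a)
    (hb : IsProfile r b) {C C' : ℝ} {L L' : ℂ} (h : ProfBounds (prof kap a a) C L)
    (h' : ProfBounds (prof (kap / 2) a a) C' L') {w : Fin 6 → 𝓢(Plane, ℂ)}
    (hw : ∀ j ξ, 𝓕 (w j) ξ = dataProfile a b j ξ) :
    ∃ u : ℝ → Fin 6 → L2, IsGlobalSolution (toL2 w) u ∧
      (∀ v : ℝ → Fin 6 → L2, IsGlobalSolution (toL2 w) v → ∀ t : ℝ, 0 ≤ t → v t = u t) ∧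
      Tendsto (fun t : ℝ => vecNorm (u t)) atTop atTop := by
  obtain ⟨u, hu, hu5⟩ := exists_solution ha hb (u₀ := toL2 w) fun j => by
    unfold toL2
    rw [SchwartzMap.toLp_fourier_eq]
    filter_upwards [(𝓕 (w j)).coeFn_toLp 2 volume] with ξ hξ
    rw [hξ, hw]
  refine ⟨u, hu, fun v hv t ht => hu.unique hv ht, ?_⟩
  refine tendsto_atTop_mono (fun t => ?_)
    (tendsto_norm_lastProf ha hb h h' (continuous_dispersion 1 1))
  rw [← norm_fourierInv, ← hu5 t]
  exact norm_le_vecNorm _ _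

end KleinGordon

end

theorem theorem1p1 (φ : ℝ → ℝ) (hφ : KleinGordon.IsCutoff φ) (ε : ℝ) (hε : 0 < ε) :
    ∃ u₀ : Fin 6 → 𝓢(KleinGordon.Plane, ℂ),
      -- every low-frequency piece of the data is nonzero
      (∀ l : ℤ, l ≤ 0 → ∃ j, 𝓕 (KleinGordon.piece φ l (u₀ j)) ≠ 0) ∧
      -- the data have no high frequencies
      (∀ ξ : KleinGordon.Plane, 1.2 ≤ KleinGordon.freq ξ → ∀ j, 𝓕 (u₀ j) ξ = 0) ∧
      -- the data are small in `L²`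
      KleinGordon.vecNorm (KleinGordon.toL2 u₀) ≤ ε ∧
      -- there is exactly one global solution, and its `L²` norm tends to infinity
      ∃ u : ℝ → Fin 6 → KleinGordon.L2,
        KleinGordon.IsGlobalSolution (KleinGordon.toL2 u₀) u ∧
        (∀ v : ℝ → Fin 6 → KleinGordon.L2,
          KleinGordon.IsGlobalSolution (KleinGordon.toL2 u₀) v → ∀ t : ℝ, 0 ≤ t → v t = u t) ∧
        Tendsto (fun t : ℝ => KleinGordon.vecNorm (u t)) atTop atTop := by
  obtain ⟨δ₁, hδ₁, H₁⟩ := KleinGordon.exists_profBounds KleinGordon.kap_pos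
  obtain ⟨δ₂, hδ₂, H₂⟩ := KleinGordon.exists_profBounds (half_pos KleinGordon.kap_pos)
  have hp := Real.pi_pos
  -- `‖ξ‖ < r` means `|ζ| < 1.2`. The wide bump of radius `r` in the sixth component serves only to
  -- make all low-frequency pieces nonzero; the growth comes from the narrow bumps of radius `δ`.
  set r : ℝ := 1.2 / (2 * Real.pi) with hr
  have hr0 : 0 < r := by positivity
  set δ : ℝ := min r (min δ₁ δ₂)
  have hδ0 : 0 < δ := lt_min hr0 (lt_min hδ₁ hδ₂)
  have hδr : δ ≤ r := min_le_left _ _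
  obtain ⟨w, hw⟩ := KleinGordon.exists_fourier_eq
    (by simpa using KleinGordon.isProfile_bump hδ0 one_pos : KleinGordon.IsProfile δ (KleinGordon.bump δ))
    (by simpa using KleinGordon.isProfile_bump hr0 one_pos : KleinGordon.IsProfile r (KleinGordon.bump r))
  have hN : 0 ≤ KleinGordon.vecNorm (KleinGordon.toL2 w) := Real.sqrt_nonneg _
  set N := KleinGordon.vecNorm (KleinGordon.toL2 w)
  -- Multiplying all data by `c` makes the norm `c N ≤ ε`. The admissible `δ` was fixed by the
  -- phases alone, so the asymptotics still apply to the rescaled profiles, with other constants.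
  set c : ℝ := ε / (N + 1) with hc
  have hc0 : 0 < c := by positivity
  have hF : ∀ j ξ, 𝓕 ((c : ℂ) • w j) ξ
      = ((c * KleinGordon.dataProfile (KleinGordon.bump δ) (KleinGordon.bump r) j ξ : ℝ) : ℂ) := by
    intro j ξ
    rw [FourierTransform.fourier_smul, smul_apply, hw, smul_eq_mul, Complex.ofReal_mul]
  refine ⟨fun j => (c : ℂ) • w j, fun l hl => ⟨5, fun h => ?_⟩, fun ξ hξ j => ?_, ?_, ?_⟩
  -- For `l ≤ 0` this frequency is at most `1.1 < 1.2`, inside the wide bump, and there the symbol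
  -- of the piece is `1`.
  · obtain ⟨ξ, hξ⟩ := KleinGordon.exists_freq_eq (x := 1.1 * 2 ^ l) (by positivity)
    have h1 := congrArg (fun f : 𝓢(KleinGordon.Plane, ℂ) => f ξ) h
    simp only [zero_apply] at h1
    rw [KleinGordon.fourier_piece_apply hφ, KleinGordon.pieceSymbol_eq_one hφ l hξ, hF,
      Complex.ofReal_one, one_mul, Complex.ofReal_eq_zero] at h1
    have hl1 : (2 : ℝ) ^ l ≤ 1 := zpow_le_one_of_nonpos₀ one_le_two hl
    have h2 : 0 < KleinGordon.bump r ξ := KleinGordon.bump_pos (by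
      rw [hr, lt_div_iff₀ (by positivity)]
      unfold KleinGordon.freq at hξ
      linarith)
    exact (mul_pos hc0 h2).ne' h1
  · rw [hF, KleinGordon.dataProfile_bump_eq_zero hδ0.le hδr, mul_zero, Complex.ofReal_zero]
    rw [hr, div_le_iff₀ (by positivity)]
    unfold KleinGordon.freq at hξ
    linarith
  · rw [KleinGordon.vecNorm_smul c hc0.le, hc, div_mul_eq_mul_div, div_le_iff₀ (by positivity)]
    nlinarith
  · have ha := KleinGordon.isProfile_bump hδ0 hc0
    have hb := KleinGordon.isProfile_bump hr0 hc0
    obtain ⟨C, L, h⟩ := H₁ δ _ _ ((min_le_right _ _).trans (min_le_left _ _)) ha ha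
    obtain ⟨C', L', h'⟩ := H₂ δ _ _ ((min_le_right _ _).trans (min_le_right _ _)) ha ha
    refine KleinGordon.exists_unique_unbounded_solution ha hb h h' fun j ξ => ?_
    rw [hF, KleinGordon.dataProfile_const_mul]
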